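/- **Conventions.** A generalised pseudo-Riemannian metric on a finite-dimensional real Lie algebra $\mathfrak g$ is a pair $(H,\mathcal G_g)$, where $H\in\Lambda^3\mathfrak g^*$ is closed for the Chevalley–Eilenberg differential, $g$ is a pseudo-Riemannian metric on $\mathfrak g$ and $\mathcal G_g(X+\xi)=g^{-1}\xi+gX$ on $E=\mathfrak g\oplus\mathfrak g^*$; it is Lorentzian if $g$ has signature $(n-1,1)$. The space $E$ carries $\langle X+\xi,Y+\eta\rangle=\frac12(\eta(X)+\xi(Y))$ and the Dorfman bracket $[X+\xi,Y+\eta]_H=[X,Y]+\mathcal L_X\eta-\iota_Y\mathrm d\xi+H(X,Y,\cdot)$; $E_\pm$ are the $\pm1$-eigenspaces of $\mathcal G_g$. A generalised Levi-Civita connection is a bilinear map $D:E\times E\to E$, $(u,v)\mapsto D_uv$, with each $D_u$ skew for $\langle\cdot,\cdot\rangle$ and commuting with $\mathcal G_g$, and with zero torsion: $D_uv-D_vu-[u,v]_H+(Du)^*v=0$. Its divergence operator is $\delta_D(e)=\operatorname{tr}(De)$, where $De$ is the endomorphism $u\mapsto D_ue$. The triple $(\mathfrak g,H,\mathcal G_g)$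 is generalised Einstein for $\delta=0$ if, for a generalised Levi-Civita connection $D$ with $\delta_D=0$, the two generalised Ricci curvatures $\operatorname{tr}(E_\pm\ni a\mapsto D_aD_bc-D_bD_ac-D_{[a,b]_H}c\in E_\pm)$, $b\in E_\mp$, $c\in E_\pm$, vanish identically. **Theorem.** Let $(\mathfrak g,H,\mathcal G_g)$ be a four-dimensional generalised Lorentzian Lie algebra with a codimension one Abelian ideal $\mathfrak n$. Choose $X\in\mathfrak g\setminus\mathfrak n$, where, if $g|_{\mathfrak n}$ is non-degenerate, $X$ is required to be orthogonal to $\mathfrak n$ with $g(X,X)\in\{-1,1\}$. Put $f=\operatorname{ad}_X|_{\mathfrak n}$ and $X^\flat=g(X,\cdot)$. Matrices of $f$ are taken with respect to a basis $(e_1,e_2,e_3)$ of $\mathfrak n$ (the $j$-th column is the image of $e_j$), and $e^1,e^2,e^3$ denote the dual one-forms, extended by $0$ on $X$. When $\mathfrak n$ is Riemannian or Lorentzian the basis is orthonormal, in the Lorentzian case with $g(e_1,e_1)=-1$, $g(e_2,e_2)=g(e_3,e_3)=1$. (A) $(\mathfrak g,H,\mathcal G_g)$ is generalised Einstein for $\delta=0$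 if and only if, for a suitable basis, one of the following holds: (i) $\mathfrak n$ is Riemannian, $H=0$, $f=\begin{pmatrix}0&-a&0\\a&0&0\\0&0&0\end{pmatrix}$ for some $a\in\mathbb R$; (ii) $\mathfrak n$ is Lorentzian, $H=0$, $f=\begin{pmatrix}0&0&-1+\sigma\\0&0&-1-\sigma\\-1+\sigma&1+\sigma&0\end{pmatrix}$ for some $\sigma\in\mathbb R$; (iii) $\mathfrak n$ is Lorentzian, $H=0$, $f=\begin{pmatrix}\alpha&-\beta&0\\\beta&\alpha&0\\0&0&a\end{pmatrix}$ with $\beta=\sqrt{\alpha^2+\frac{a^2}{2}}$ for some $(\alpha,a)\in\mathbb R^2$; (iv) $\mathfrak n$ is Lorentzian, $H=0$, $f=\begin{pmatrix}\frac\epsilon2&\frac\epsilon2&v\\-\frac\epsilon2&-\frac\epsilon2&-v\\v&v&0\end{pmatrix}$ for some $\epsilon\in\{-1,1\}$, $v\in\mathbb R$; (v) $\mathfrak n$ is Lorentzian, $H=0$, $f=\frac1{\sqrt2}\begin{pmatrix}0&-1&0\\1&0&1\\0&1&0\end{pmatrix}$; (vi) $\mathfrak n$ is Lorentzian, $H=a\,(e^1+e^3)\wedge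 e^2\wedge X^\flat$ and $f=\frac1{\sqrt2}\begin{pmatrix}0&-1-\frac{a^2}2&0\\1-\frac{a^2}2&0&1-\frac{a^2}2\\0&1+\frac{a^2}2&0\end{pmatrix}$ for some $a\in\mathbb R\setminus\{0\}$; (vii) $\mathfrak n$ is degenerate, $H=0$ and $f=\begin{pmatrix}0&-a&0\\a&0&0\\b_1&b_2&0\end{pmatrix}$ for some $a,b_1,b_2\in\mathbb R$, with respect to a basis such that $g(e_1,e_1)=g(e_2,e_2)=g(e_3,X)=1$, $g(e_1,e_2)=0$, $g(e_3,e_i)=0$ for $i=1,2,3$, $g(X,e_1)=g(X,e_2)=0$. (B) Below, brackets that are not listed, up to anti-symmetry, are zero. $\mathfrak h_3$: $[e_3,e_2]=e_1$. $\mathfrak e(2)$: $[e_3,e_1]=-e_2$, $[e_3,e_2]=e_1$. $\mathfrak e(1,1)$: $[e_3,e_1]=e_2$, $[e_3,e_2]=e_1$. $\mathfrak r'_{3,1}$: $[e_3,e_1]=e_1-e_2$, $[e_3,e_2]=e_1+e_2$. $A_{4,1}$: $[e_4,e_2]=e_1$, $[e_4,e_3]=e_2$. $A_{4,6}^{\alpha,\beta}$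 ($\alpha>0$): $[e_4,e_1]=\alpha e_1$, $[e_4,e_2]=\beta e_2-e_3$, $[e_4,e_3]=e_2+\beta e_3$. In the respective cases, $\mathfrak g$ is isomorphic to: (i) $\mathfrak e(2)\oplus\mathbb R$ if $a\ne0$, $\mathbb R^4$ if $a=0$; (ii) $\mathfrak e(2)\oplus\mathbb R$ if $\sigma>0$, $A_{4,1}$ if $\sigma=0$, $\mathfrak e(1,1)\oplus\mathbb R$ if $\sigma<0$; (iii) $A_{4,6}^{\sqrt2\cos\varphi,\sin\varphi}$ for some $\varphi\in\mathbb R$ with $\cos\varphi>0$ if $a\neq0$, $\mathfrak r'_{3,1}\oplus\mathbb R$ if $a=0\ne\alpha$, $\mathbb R^4$ if $a=\alpha=0$; (iv) $A_{4,1}$ if $v\ne0$, $\mathfrak h_3\oplus\mathbb R$ if $v=0$; (v) $A_{4,1}$; (vi) $A_{4,1}$ if $a\neq\pm\sqrt2$, $\mathfrak h_3\oplus\mathbb R$ if $a=\pm\sqrt2$; (vii) $\mathfrak e(2)\oplus\mathbb R$ if $a\ne0$, $\mathfrak h_3\oplus\mathbb R$ if $a=0$ and $(b_1,b_2)\neq(0,0)$,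 $\mathbb R^4$ if $a=b_1=b_2=0$. (C) Suppose that $\mathfrak n$ is non-degenerate and $H\neq0$. Then $(\mathfrak g,H,\mathcal G_g)$ is generalised Einstein for $\delta=0$ if and only if there are $b\in\mathbb R\setminus\{0\}$ and an orthonormal basis $(e_1,e_2,e_3,e_4)$ of $\mathfrak g$ with $g(e_1,e_1)=-1$, $g(e_i,e_i)=1$ for $i=2,3,4$, and $\mathfrak n=\operatorname{span}(e_1,e_2,e_3)$, such that $H=b\,(e^1+e^3)\wedge e^2\wedge e^4$ and $\operatorname{ad}_{e_4}|_{\mathfrak n}$ has the matrix in (vi) with $a=b$; in this case $\mathfrak g\cong A_{4,1}$ if $b\neq\pm\sqrt2$ and $\mathfrak g\cong\mathfrak h_3\oplus\mathbb R$ if $b=\pm\sqrt2$. In particular, if $(\mathfrak g,H,\mathcal G_g)$ is generalised Einstein for $\delta=0$, then the symmetric part $f^S=\frac12(f+f^*)$ of $f$ with respect to $g|_{\mathfrak n}$ has no non-real eigenvalue. -/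

import Mathlib

open Module

noncomputable section

namespace GenLie

/-! ### Generalised pseudo-Riemannian metrics on a Lie algebra -/

section Metric

variable (𝔤 : Type*) [LieRing 𝔤] [LieAlgebra ℝ 𝔤]

/-- Vanishing of the Chevalley-Eilenberg differential of a three-form on `𝔤`. -/
def IsClosedForm (H : 𝔤 [⋀^Fin 3]→ₗ[ℝ] ℝ) : Prop :=
  ∀ x y z w : 𝔤,
    - H ![⁅x, y⁆, z, w] + H ![⁅x, z⁆, y, w] - H ![⁅x, w⁆, y, z]
      - H ![⁅y, z⁆, x, w] + H ![⁅y, w⁆, x, z] - H ![⁅z, w⁆, x, y] = 0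

/-- The data `(H, g)` of a generalised pseudo-Riemannian metric `(H, 𝒢_g)` on `𝔤`. -/
structure GenMetric where
  /-- the pseudo-Riemannian metric -/
  g : LinearMap.BilinForm ℝ 𝔤
  symm : ∀ x y, g x y = g y x
  nondeg : g.Nondegenerate
  /-- the closed three-form -/
  H : 𝔤 [⋀^Fin 3]→ₗ[ℝ] ℝ
  closed : IsClosedForm 𝔤 H

/-- The (left-invariant sections of the) generalised tangent bundle `𝔤 ⊕ 𝔤*`. -/
abbrev GenTangent : Type _ := 𝔤 × Dual ℝ 𝔤

end Metric

section Signature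

variable {V : Type*} [AddCommGroup V] [Module ℝ V]

/-- `b` is orthonormal for `B` with `b 0` of square `-1` and all other vectors of square `1`. -/
def IsLorentzBasis {m : ℕ} (B : LinearMap.BilinForm ℝ V) (b : Basis (Fin (m + 1)) ℝ V) : Prop :=
  ∀ i j, B (b i) (b j) = if i = j then (if i = 0 then -1 else 1) else 0

/-- `b` is orthonormal for `B`, all vectors having square `1`. -/
def IsEuclidBasis {m : ℕ} (B : LinearMap.BilinForm ℝ V) (b : Basis (Fin m) ℝ V) : Prop :=
  ∀ i j, B (b i) (b j) = if i = j then 1 else 0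

/-- Signature `(n - 1, 1)`. -/
def IsLorentzianForm (B : LinearMap.BilinForm ℝ V) : Prop :=
  ∃ (m : ℕ) (b : Basis (Fin (m + 1)) ℝ V), IsLorentzBasis B b

/-- Symmetric and positive definite. -/
def IsRiemannianForm (B : LinearMap.BilinForm ℝ V) : Prop :=
  (∀ x y, B x y = B y x) ∧ ∀ x, x ≠ 0 → 0 < B x x

/-- The symmetric part `(f + f*) / 2` of an endomorphism with respect to a nondegenerate
(symmetric) form. -/
def symmPart [FiniteDimensional ℝ V] (B : LinearMap.BilinForm ℝ V) (hB : B.Nondegenerate)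
    (f : End ℝ V) : End ℝ V :=
  (1 / 2 : ℝ) • (f + B.leftAdjointOfNondegenerate hB f)

/-- The wedge product of three one-forms,
`(α ∧ β ∧ γ)(x, y, z) = det` of the matrix of values. -/
def wedge3 (α β γ : Dual ℝ V) : V [⋀^Fin 3]→ₗ[ℝ] ℝ :=
  Matrix.detRowAlternating.compLinearMap (LinearMap.pi ![α, β, γ])

end Signature

/-! ### The generalised Einstein condition -/

namespace GenMetric

variable {𝔤 : Type*} [LieRing 𝔤] [LieAlgebra ℝ 𝔤] (M : GenMetric 𝔤)

/-- `⟨X + ξ, Y + η⟩ = (η(X) + ξ(Y)) / 2`. -/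
def pairing (u v : GenTangent 𝔤) : ℝ := (1 / 2 : ℝ) * (v.2 u.1 + u.2 v.1)

section Contract

variable {V : Type*} [AddCommGroup V] [Module ℝ V] (H : V [⋀^Fin 3]→ₗ[ℝ] ℝ)

lemma form_add_zero (x x' y z : V) : H ![x + x', y, z] = H ![x, y, z] + H ![x', y, z] :=
  H.toMultilinearMap.cons_add ![y, z] x x'

lemma form_smul_zero (c : ℝ) (x y z : V) : H ![c • x, y, z] = c * H ![x, y, z] :=
  H.toMultilinearMap.cons_smul ![y, z] c x

lemma form_cycle (x y z : V) : H ![x, y, z] = H ![y, z, x] := by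
  have h := H.map_perm ![x, y, z] (finRotate 3)
  have e : (![x, y, z] : Fin 3 → V) ∘ finRotate 3 = ![y, z, x] := by
    ext i; fin_cases i <;> rfl
  have hs : Equiv.Perm.sign (finRotate 3) = 1 := by decide
  rw [e, hs, one_smul] at h
  exact h.symm

lemma form_add_one (x y y' z : V) : H ![x, y + y', z] = H ![x, y, z] + H ![x, y', z] := by
  simp only [form_cycle H x, form_add_zero]

lemma form_smul_one (c : ℝ) (x y z : V) : H ![x, c • y, z] = c * H ![x, y, z] := by
  simp only [form_cycle H x, form_smul_zero]

lemma form_add_two (x y z z' : V) : H ![x, y, z + z'] = H ![x, y, z] + H ![x, y, z'] := by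
  simp only [← form_cycle H _ x y, form_add_zero]

lemma form_smul_two (c : ℝ) (x y z : V) : H ![x, y, c • z] = c * H ![x, y, z] := by
  simp only [← form_cycle H _ x y, form_smul_zero]

end Contract

/-- The covector part of the `H`-twisted Dorfman bracket of left-invariant sections:
`L_X η - ι_Y dξ + H(X, Y, ·)`, where `(L_X η)(Z) = -η([X, Z])` and `dξ(Y, Z) = -ξ([Y, Z])`. -/
def dorfmanCovector (u v : GenTangent 𝔤) : Dual ℝ 𝔤 where
  toFun z := - v.2 ⁅u.1, z⁆ + u.2 ⁅v.1, z⁆ + M.H ![u.1, v.1, z]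
  map_add' z w := by simp only [lie_add, map_add, form_add_two]; ring
  map_smul' c z := by
    simp only [lie_smul, map_smul, form_smul_two, smul_eq_mul, RingHom.id_apply]; ring

/-- The `H`-twisted Dorfman bracket on `𝔤 ⊕ 𝔤*`. -/
def dorfman : GenTangent 𝔤 →ₗ[ℝ] GenTangent 𝔤 →ₗ[ℝ] GenTangent 𝔤 :=
  LinearMap.mk₂ ℝ (fun u v => (⁅u.1, v.1⁆, M.dorfmanCovector u v))
    (fun u u' v => by
      ext z
      · simp
      · simp [dorfmanCovector, form_add_zero]; ring)
    (fun c u v => by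
      ext z
      · simp
      · simp [dorfmanCovector, form_smul_zero]; ring)
    (fun u v v' => by
      ext z
      · simp
      · simp [dorfmanCovector, form_add_one]; ring)
    (fun c u v => by
      ext z
      · simp
      · simp [dorfmanCovector, form_smul_one]; ring)

variable [FiniteDimensional ℝ 𝔤]

/-- `𝒢_g (X + ξ) = g⁻¹ ξ + g X`. -/
def genEnd : End ℝ (GenTangent 𝔤) where
  toFun u := ((M.g.toDual M.nondeg).symm u.2, M.g u.1)
  map_add' u v := by simp
  map_smul' c u := by simp

lemma genEnd_genEnd (u : GenTangent 𝔤) : M.genEnd (M.genEnd u) = u := by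
  ext z
  · change (M.g.toDual M.nondeg).symm (M.g.toDual M.nondeg u.1) = u.1
    simp
  · change M.g ((M.g.toDual M.nondeg).symm u.2) z = u.2 z
    simp

/-- The eigenbundle `E₊`. -/
def Eplus : Submodule ℝ (GenTangent 𝔤) := End.eigenspace M.genEnd 1

/-- The eigenbundle `E₋`. -/
def Eminus : Submodule ℝ (GenTangent 𝔤) := End.eigenspace M.genEnd (-1)

/-- The projection `e ↦ (e + 𝒢 e) / 2` onto `E₊` along `E₋`. -/
def projPlus : GenTangent 𝔤 →ₗ[ℝ] M.Eplus :=
  LinearMap.codRestrict M.Eplus ((1 / 2 : ℝ) • (LinearMap.id + M.genEnd)) (fun u => by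
    rw [Eplus, End.mem_eigenspace_iff]
    simp [genEnd_genEnd, add_comm])

/-- The projection `e ↦ (e - 𝒢 e) / 2` onto `E₋` along `E₊`. -/
def projMinus : GenTangent 𝔤 →ₗ[ℝ] M.Eminus :=
  LinearMap.codRestrict M.Eminus ((1 / 2 : ℝ) • (LinearMap.id - M.genEnd)) (fun u => by
    rw [Eminus, End.mem_eigenspace_iff]
    simp [genEnd_genEnd, ← smul_neg])

/-- `D u v` is `D_u v`. A (left-invariant) generalised connection `D` is a generalised
Levi-Civita connection of `𝒢_g` if it preserves the pairing, commutes with `𝒢_g`, and has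
vanishing torsion `T(u, v) = D_u v - D_v u - [u, v]_H + (D u)^* v`. As the pairing is
nondegenerate, the last condition is tested against an arbitrary third section `w`. -/
structure IsGenLeviCivita
    (D : GenTangent 𝔤 →ₗ[ℝ] GenTangent 𝔤 →ₗ[ℝ] GenTangent 𝔤) : Prop where
  pairing_skew : ∀ u v w, pairing (D u v) w + pairing v (D u w) = 0
  metric : ∀ u v, D u (M.genEnd v) = M.genEnd (D u v)
  torsion_free : ∀ u v w,
    pairing (D u v - D v u - M.dorfman u v) w + pairing v (D w u) = 0

/-- The endomorphism `a ↦ R_D(a, b) c = D_a D_b c - D_b D_a c - D_{[a, b]} c`. -/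
def curvature (D : GenTangent 𝔤 →ₗ[ℝ] GenTangent 𝔤 →ₗ[ℝ] GenTangent 𝔤)
    (b c : GenTangent 𝔤) : End ℝ (GenTangent 𝔤) :=
  D.flip (D b c) - D b ∘ₗ D.flip c - D.flip c ∘ₗ M.dorfman.flip b

/-- `RC⁺_D(b, c)`, the trace of `E₊ ∋ a ↦ R_D(a, b) c ∈ E₊`, for `b ∈ E₋` and `c ∈ E₊`. -/
def ricciPlus (D : GenTangent 𝔤 →ₗ[ℝ] GenTangent 𝔤 →ₗ[ℝ] GenTangent 𝔤)
    (b : M.Eminus) (c : M.Eplus) : ℝ :=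
  LinearMap.trace ℝ M.Eplus
    (M.projPlus ∘ₗ M.curvature D (b : GenTangent 𝔤) (c : GenTangent 𝔤) ∘ₗ M.Eplus.subtype)

/-- `RC⁻_D(b, c)`, the trace of `E₋ ∋ a ↦ R_D(a, b) c ∈ E₋`, for `b ∈ E₊` and `c ∈ E₋`. -/
def ricciMinus (D : GenTangent 𝔤 →ₗ[ℝ] GenTangent 𝔤 →ₗ[ℝ] GenTangent 𝔤)
    (b : M.Eplus) (c : M.Eminus) : ℝ :=
  LinearMap.trace ℝ M.Eminus
    (M.projMinus ∘ₗ M.curvature D (b : GenTangent 𝔤) (c : GenTangent 𝔤) ∘ₗ M.Eminus.subtype)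

/-- The divergence operator `δ_D(e) = tr (D e)`. -/
def divergence (D : GenTangent 𝔤 →ₗ[ℝ] GenTangent 𝔤 →ₗ[ℝ] GenTangent 𝔤)
    (e : GenTangent 𝔤) : ℝ :=
  LinearMap.trace ℝ (GenTangent 𝔤) (D.flip e)

/-- `(𝔤, H, 𝒢_g, δ)` is generalised Einstein: the generalised Ricci curvature of a generalised
Levi-Civita connection with divergence operator `δ` vanishes. -/
def IsGenEinstein (δ : Dual ℝ (GenTangent 𝔤)) : Prop :=
  ∃ D : GenTangent 𝔤 →ₗ[ℝ] GenTangent 𝔤 →ₗ[ℝ] GenTangent 𝔤,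
    M.IsGenLeviCivita D ∧ (∀ e, divergence D e = δ e) ∧
      (∀ b c, M.ricciPlus D b c = 0) ∧ ∀ b c, M.ricciMinus D b c = 0

end GenMetric

/-! ### Codimension one Abelian ideals and the seven families -/

section Families

variable {𝔤 : Type*} [LieRing 𝔤] [LieAlgebra ℝ 𝔤]

/-- `ad_X` restricted to the ideal `n`. -/
abbrev adOn (n : LieIdeal ℝ 𝔤) (X : 𝔤) : End ℝ n := LieModule.toEnd ℝ 𝔤 n X

/-- The restriction of the metric to `n`. -/
abbrev GenMetric.gOn (M : GenMetric 𝔤) (n : LieIdeal ℝ 𝔤) : LinearMap.BilinForm ℝ n :=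
  M.g.restrict n.toSubmodule

/-- The choice of `X ∈ 𝔤 \ n`: if the metric is nondegenerate on `n`, then `X` is a unit normal of
`n`; otherwise `X` is arbitrary. -/
def IsComplementary (M : GenMetric 𝔤) (n : LieIdeal ℝ 𝔤) (X : 𝔤) : Prop :=
  X ∉ n ∧ ((M.gOn n).Nondegenerate →
    (∀ Y ∈ n, M.g X Y = 0) ∧ (M.g X X = 1 ∨ M.g X X = -1))

/-- With respect to the basis `e` of `n`, the endomorphism `ad_X` of `n` has matrix `A`. -/
def HasMatrix (n : LieIdeal ℝ 𝔤) (X : 𝔤) (e : Basis (Fin 3) ℝ n)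
    (A : Matrix (Fin 3) (Fin 3) ℝ) : Prop :=
  LinearMap.toMatrix e e (adOn n X) = A

/-- `diag (L₁(α, β), c)`. -/
def matL1 (α β c : ℝ) : Matrix (Fin 3) (Fin 3) ℝ := !![α, -β, 0; β, α, 0; 0, 0, c]

/-- `M₃(σ)`. -/
def matM3 (σ : ℝ) : Matrix (Fin 3) (Fin 3) ℝ :=
  !![0, 0, -1 + σ; 0, 0, -1 - σ; -1 + σ, 1 + σ, 0]

def matIV (ε v : ℝ) : Matrix (Fin 3) (Fin 3) ℝ :=
  !![ε / 2, ε / 2, v; -(ε / 2), -(ε / 2), -v; v, v, 0]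

/-- `L₃(0)`. -/
def matL3 : Matrix (Fin 3) (Fin 3) ℝ :=
  !![0, -(1 / √2), 0; 1 / √2, 0, 1 / √2; 0, 1 / √2, 0]

def matVI (a : ℝ) : Matrix (Fin 3) (Fin 3) ℝ :=
  (1 / √2) • !![0, -1 - a ^ 2 / 2, 0; 1 - a ^ 2 / 2, 0, 1 - a ^ 2 / 2; 0, 1 + a ^ 2 / 2, 0]

def matVII (a b₁ b₂ : ℝ) : Matrix (Fin 3) (Fin 3) ℝ := !![0, -a, 0; a, 0, 0; b₁, b₂, 0]

variable (M : GenMetric 𝔤) (n : LieIdeal ℝ 𝔤) (X : 𝔤)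

def CaseI (a : ℝ) : Prop :=
  IsRiemannianForm (M.gOn n) ∧ M.H = 0 ∧
    ∃ e : Basis (Fin 3) ℝ n, IsEuclidBasis (M.gOn n) e ∧ HasMatrix n X e (matL1 0 a 0)

def CaseII (σ : ℝ) : Prop :=
  IsLorentzianForm (M.gOn n) ∧ M.H = 0 ∧
    ∃ e : Basis (Fin 3) ℝ n, IsLorentzBasis (M.gOn n) e ∧ HasMatrix n X e (matM3 σ)

def CaseIII (α a : ℝ) : Prop :=
  IsLorentzianForm (M.gOn n) ∧ M.H = 0 ∧
    ∃ e : Basis (Fin 3) ℝ n, IsLorentzBasis (M.gOn n) e ∧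
      HasMatrix n X e (matL1 α (√(α ^ 2 + a ^ 2 / 2)) a)

def CaseIV (ε v : ℝ) : Prop :=
  IsLorentzianForm (M.gOn n) ∧ M.H = 0 ∧
    ∃ e : Basis (Fin 3) ℝ n, IsLorentzBasis (M.gOn n) e ∧ HasMatrix n X e (matIV ε v)

def CaseV : Prop :=
  IsLorentzianForm (M.gOn n) ∧ M.H = 0 ∧
    ∃ e : Basis (Fin 3) ℝ n, IsLorentzBasis (M.gOn n) e ∧ HasMatrix n X e matL3

/-- Here `E` is the basis `(e₁, e₂, e₃, X)` of `𝔤`, so that `E.coord 0, E.coord 1, E.coord 2` are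
`e¹, e², e³`, and `X♭ = g(X, ·)`. -/
def CaseVI (a : ℝ) : Prop :=
  IsLorentzianForm (M.gOn n) ∧
    ∃ (e : Basis (Fin 3) ℝ n) (E : Basis (Fin 4) ℝ 𝔤),
      IsLorentzBasis (M.gOn n) e ∧ (∀ i : Fin 3, E i.castSucc = (e i : 𝔤)) ∧ E 3 = X ∧
      M.H = a • wedge3 (E.coord 0 + E.coord 2) (E.coord 1) (M.g X) ∧
      HasMatrix n X e (matVI a)

def CaseVII (a b₁ b₂ : ℝ) : Prop :=
  ¬ (M.gOn n).Nondegenerate ∧ M.H = 0 ∧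
    ∃ e : Basis (Fin 3) ℝ n,
      M.g (e 0) (e 0) = 1 ∧ M.g (e 1) (e 1) = 1 ∧ M.g (e 0) (e 1) = 0 ∧
      (∀ i, M.g (e 2) (e i) = 0) ∧
      M.g (e 2) X = 1 ∧ M.g X (e 0) = 0 ∧ M.g X (e 1) = 0 ∧
      HasMatrix n X e (matVII a b₁ b₂)

/-- The normal form with `H ≠ 0` and `n` nondegenerate, with respect to an orthonormal basis `E`
of `𝔤` whose first three vectors form a basis of `n`. -/
def NormalFormH (b : ℝ) (E : Basis (Fin 4) ℝ 𝔤) : Prop :=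
  IsLorentzBasis M.g E ∧
    M.H = b • wedge3 (E.coord 0 + E.coord 2) (E.coord 1) (E.coord 3) ∧
    ∃ e : Basis (Fin 3) ℝ n, (∀ i : Fin 3, E i.castSucc = (e i : 𝔤)) ∧
      HasMatrix n (E 3) e (matVI b)

end Families

/-! ### The Lie algebras occurring in the classification -/

/-- The semidirect product `ℝ^m ⋊_A ℝ`, with Abelian ideal `ℝ^m` on which the generator `(0, 1)` of
`ℝ` acts by the matrix `A`. -/
def AlmostAbelian {m : ℕ} (_A : Matrix (Fin m) (Fin m) ℝ) : Type := (Fin m → ℝ) × ℝ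

namespace AlmostAbelian

variable {m : ℕ} (A : Matrix (Fin m) (Fin m) ℝ)

instance : AddCommGroup (AlmostAbelian A) := inferInstanceAs (AddCommGroup ((Fin m → ℝ) × ℝ))

instance : Module ℝ (AlmostAbelian A) := inferInstanceAs (Module ℝ ((Fin m → ℝ) × ℝ))

instance : Bracket (AlmostAbelian A) (AlmostAbelian A) where
  bracket p q := (p.2 • A.mulVec q.1 - q.2 • A.mulVec p.1, (0 : ℝ))

instance : LieRing (AlmostAbelian A) where
  add_lie p q r := by
    refine Prod.ext (show (p.2 + q.2) • A.mulVec r.1 - r.2 • A.mulVec (p.1 + q.1) =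
      (p.2 • A.mulVec r.1 - r.2 • A.mulVec p.1) + (q.2 • A.mulVec r.1 - r.2 • A.mulVec q.1) from ?_)
      (show (0 : ℝ) = 0 + 0 from (add_zero 0).symm)
    rw [Matrix.mulVec_add]; module
  lie_add p q r := by
    refine Prod.ext (show p.2 • A.mulVec (q.1 + r.1) - (q.2 + r.2) • A.mulVec p.1 =
      (p.2 • A.mulVec q.1 - q.2 • A.mulVec p.1) + (p.2 • A.mulVec r.1 - r.2 • A.mulVec p.1) from ?_)
      (show (0 : ℝ) = 0 + 0 from (add_zero 0).symm)
    rw [Matrix.mulVec_add]; module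
  lie_self p := Prod.ext (sub_self (p.2 • A.mulVec p.1)) rfl
  leibniz_lie p q r := by
    refine Prod.ext (show p.2 • A.mulVec (q.2 • A.mulVec r.1 - r.2 • A.mulVec q.1) -
        (0 : ℝ) • A.mulVec p.1 =
      ((0 : ℝ) • A.mulVec r.1 - r.2 • A.mulVec (p.2 • A.mulVec q.1 - q.2 • A.mulVec p.1)) +
      (q.2 • A.mulVec (p.2 • A.mulVec r.1 - r.2 • A.mulVec p.1) - (0 : ℝ) • A.mulVec q.1) from ?_)
      (show (0 : ℝ) = 0 + 0 from (add_zero 0).symm)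
    simp only [Matrix.mulVec_sub, Matrix.mulVec_smul]; module

instance : LieAlgebra ℝ (AlmostAbelian A) where
  lie_smul c p q := by
    refine Prod.ext (show p.2 • A.mulVec (c • q.1) - (c * q.2) • A.mulVec p.1 =
      c • (p.2 • A.mulVec q.1 - q.2 • A.mulVec p.1) from ?_)
      (show (0 : ℝ) = c * 0 from (mul_zero c).symm)
    rw [Matrix.mulVec_smul]; module

end AlmostAbelian

/-- The Heisenberg algebra `𝔥₃`: `[e₃, e₂] = e₁`. -/
abbrev Heis3 : Type := AlmostAbelian !![(0 : ℝ), 1; 0, 0]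

/-- `𝔢(2)`, the Euclidean motions of the plane: `[e₃, e₁] = -e₂`, `[e₃, e₂] = e₁`. -/
abbrev Euc2 : Type := AlmostAbelian !![(0 : ℝ), 1; -1, 0]

/-- `𝔢(1,1)`, the motions of the Minkowski plane: `[e₃, e₁] = e₂`, `[e₃, e₂] = e₁`. -/
abbrev Euc11 : Type := AlmostAbelian !![(0 : ℝ), 1; 1, 0]

/-- `𝔯'_{3,μ}`: `[e₃, e₁] = μ e₁ - e₂`, `[e₃, e₂] = e₁ + μ e₂`. -/
abbrev R3' (μ : ℝ) : Type := AlmostAbelian !![μ, 1; -1, μ]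

/-- `A_{4,1}`: `[e₄, e₂] = e₁`, `[e₄, e₃] = e₂`. -/
abbrev A41 : Type := AlmostAbelian !![(0 : ℝ), 1, 0; 0, 0, 1; 0, 0, 0]

/-- `A_{4,6}^{α,β}`: `[e₄, e₁] = α e₁`, `[e₄, e₂] = β e₂ - e₃`, `[e₄, e₃] = e₂ + β e₃`. -/
abbrev A46 (α β : ℝ) : Type := AlmostAbelian !![α, 0, 0; 0, β, 1; 0, -1, β]

/-- The Abelian Lie algebra `ℝ^m`. -/
def AbelianLie (m : ℕ) : Type := Fin m → ℝ

namespace AbelianLie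

variable (m : ℕ)

instance : AddCommGroup (AbelianLie m) := inferInstanceAs (AddCommGroup (Fin m → ℝ))

instance : Module ℝ (AbelianLie m) := inferInstanceAs (Module ℝ (Fin m → ℝ))

instance : Bracket (AbelianLie m) (AbelianLie m) where
  bracket _ _ := 0

instance : LieRing (AbelianLie m) where
  add_lie _ _ _ := (add_zero (0 : AbelianLie m)).symm
  lie_add _ _ _ := (add_zero (0 : AbelianLie m)).symm
  lie_self _ := rfl
  leibniz_lie _ _ _ := (add_zero (0 : AbelianLie m)).symm

instance : LieAlgebra ℝ (AbelianLie m) where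
  lie_smul c _ _ := (smul_zero c : c • (0 : AbelianLie m) = 0).symm

end AbelianLie

/-- The one-dimensional Lie algebra `ℝ`. -/
abbrev R1 : Type := AbelianLie 1

/-- The Abelian Lie algebra `ℝ⁴`. -/
abbrev R4 : Type := AbelianLie 4

/-- Isomorphism of real Lie algebras. -/
def LieIso (𝔤 𝔥 : Type*) [LieRing 𝔤] [LieAlgebra ℝ 𝔤] [LieRing 𝔥] [LieAlgebra ℝ 𝔥] : Prop :=
  Nonempty (𝔤 ≃ₗ⁅ℝ⁆ 𝔥)

end GenLie

end

open GenLie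

/-! A divergence-free generalised Levi-Civita connection `D` enters its Ricci curvature only through
components fixed by the bracket. In the trace over `a ∈ E₊` of `R(a, b)c`, the term `D_a D_b c`
contributes the divergence of `D_b c`, which is zero. The `E₊`-part of `[a, b]` is `-D_b a`, and its
contribution cancels `D_b D_a c` by cyclicity of the trace. Only the `E₋`-part of `[a, b]` remains,
and there `D` is mixed, hence determined by vanishing torsion. The result is `-tr(∇⁺c ∘ ∇⁻b)`, with
`∇^±` the metric connections of torsion `±H`. Since a divergence-free `D` exists, the Einstein
condition is `tr(∇⁺x ∘ ∇⁻y) = 0` for all `x, y` (`isGenEinstein_zero_iff`).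

In a frame adapted to `n` and `X` these are sixteen quadratic equations in the matrix of `f`, the
number `h` representing `H` on `n`, and the two-form `β = H(·, ·, X)` on `n`. If `n` is Riemannian
or degenerate, suitable components are, up to sign, sums of squares once previously vanishing terms
are removed. They force `H = 0` and leave a rotation, respectively the family (vii).

Let `n` be Lorentzian. The mixed components and the trace over `n` give `h = 0` and show that the
kernel of `β` is null if `β ≠ 0` (`form_eq_of_isGenEinstein`). If `β ≠ 0`, in a null basis starting
with this kernel the antisymmetric part of the equations makes `f` nilpotent and strictly
triangular, with one quadratic relation (`nilpotent_of_kernel`). A null rotation and a boost then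
produce (vi). If `H = 0`, the equations say that the symmetric and skew parts of `f` commute and
that the squared symmetric part has trace zero. The normal forms follow from the causal type of the
axis of the skew part, or of a real eigenvector when `f` is symmetric
(`isLorentzNormal_of_nullEinstein`).

The converse is substitution into the polynomial tables. The Lie algebras are identified by
conjugating `f` up to a scalar (`lieIso_of_conj`). In (vi) the symmetric part of `f` is the
nilpotent `L₃(0)`, independently of `a`, so all its eigenvalues vanish. -/

noncomputable section

namespace GenLie

/-! ### The generalised Ricci curvature as a trace -/

section AbstractRicci

variable {W : Type*} [AddCommGroup W] [Module ℝ W] [FiniteDimensional ℝ W]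

/-- The abstract form, with complementary projections `p` and `q`, serves both curvatures: their
roles are exchanged for the second one. The right-hand side no longer contains `D`. -/
lemma trace_curvature_comp_proj (D K : W →ₗ[ℝ] W →ₗ[ℝ] W) (p q : End ℝ W)
    (hpq : p + q = LinearMap.id) (hqp : q ∘ₗ p = 0) (hpp : p ∘ₗ p = p)
    (hD : ∀ u, D u ∘ₗ p = p ∘ₗ D u)
    (b c : W) (hb : q b = b) (hc : p c = c)
    (hmixed : ∀ u v, q u = u → p v = v → D u v = p (K u v))
    (hskew : ∀ u, K u b = - K b u)
    (htr : ∀ e, LinearMap.trace ℝ W (D.flip e) = 0) :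
    LinearMap.trace ℝ W ((D.flip (D b c) - D b ∘ₗ D.flip c - D.flip c ∘ₗ K.flip b) ∘ₗ p) =
      - LinearMap.trace ℝ W (p ∘ₗ K.flip c ∘ₗ q ∘ₗ K.flip b ∘ₗ p) := by
  have hq : ∀ x, q x = x - p x := fun x => by
    have := LinearMap.congr_fun hpq x
    simp only [LinearMap.add_apply, LinearMap.id_apply] at this
    exact eq_sub_of_add_eq' this
  have hpp' : ∀ x, p (p x) = p x := fun x => LinearMap.congr_fun hpp x
  have hqq : ∀ x, q (q x) = q x := fun x => by simp [hq, hpp']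
  have hD' : ∀ u v, D u (p v) = p (D u v) := fun u v => LinearMap.congr_fun (hD u) v
  have hpq0 : p ∘ₗ q = 0 := by ext x; simp [hq, hpp']
  -- The endomorphism takes values in the range of `p`, so the complementary diagonal block has no
  -- trace. What remains is the divergence of `D b c`.
  have h1 : LinearMap.trace ℝ W (D.flip (D b c) ∘ₗ p) = 0 := by
    have e1 : D.flip (D b c) = p ∘ₗ D.flip (D b c) := by
      ext x
      simp only [LinearMap.flip_apply, LinearMap.comp_apply]
      rw [← hD', ← hD', hc]
    have e2 : D.flip (D b c) = D.flip (D b c) ∘ₗ p + D.flip (D b c) ∘ₗ q := by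
      rw [← LinearMap.comp_add, hpq, LinearMap.comp_id]
    have e3 : LinearMap.trace ℝ W (D.flip (D b c) ∘ₗ q) = 0 := by
      rw [e1, LinearMap.trace_comp_comm', ← LinearMap.comp_assoc]
      rw [hqp, LinearMap.zero_comp, map_zero]
    have := htr (D b c)
    rw [e2, map_add, e3, add_zero] at this
    exact this
  -- The bracket with `b` splits into its `p`-part, which is minus the `D b`-derivative, and its
  -- `q`-part, along which the derivative of `c` is again mixed.
  have h2 : D.flip c ∘ₗ K.flip b ∘ₗ p =
      - (D.flip c ∘ₗ (p ∘ₗ D b)) + p ∘ₗ K.flip c ∘ₗ q ∘ₗ K.flip b ∘ₗ p := by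
    ext x
    simp only [LinearMap.flip_apply, LinearMap.comp_apply, LinearMap.add_apply,
      LinearMap.neg_apply]
    have a1 : p (D b x) = p (K b (p x)) := by rw [← hD']; exact hmixed b (p x) hb (hpp' x)
    have a2 := hmixed (q (K (p x) b)) c (hqq _) hc
    rw [← a2, a1, hq, map_sub, LinearMap.sub_apply, hskew (p x), map_neg,
      map_neg, map_neg, LinearMap.neg_apply, LinearMap.neg_apply]
    abel
  have h3 : LinearMap.trace ℝ W (D b ∘ₗ (D.flip c ∘ₗ p)) =
      LinearMap.trace ℝ W (D.flip c ∘ₗ (p ∘ₗ D b)) := by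
    rw [LinearMap.trace_comp_comm', LinearMap.comp_assoc]
  rw [LinearMap.sub_comp, LinearMap.sub_comp, LinearMap.comp_assoc, LinearMap.comp_assoc, h2,
    map_sub, map_sub, h1, h3, map_add, map_neg]
  ring

end AbstractRicci

namespace GenMetric

variable {𝔤 : Type*} [LieRing 𝔤] [LieAlgebra ℝ 𝔤] (M : GenMetric 𝔤)

/-- `X ↦ X + gX`. -/
def liftPlus : 𝔤 →ₗ[ℝ] GenTangent 𝔤 := LinearMap.prod LinearMap.id M.g

/-- `X ↦ X - gX`. -/
def liftMinus : 𝔤 →ₗ[ℝ] GenTangent 𝔤 := LinearMap.prod LinearMap.id (-M.g)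

/-- The symmetric part of a Dorfman bracket is the differential of the pairing, and left-invariant
sections pair to constants. -/
lemma dorfman_skew (u v : GenTangent 𝔤) : M.dorfman u v = - M.dorfman v u := by
  refine Prod.ext (lie_skew u.1 v.1).symm ?_
  ext z
  change - v.2 ⁅u.1, z⁆ + u.2 ⁅v.1, z⁆ + M.H ![u.1, v.1, z] =
    - (- u.2 ⁅v.1, z⁆ + v.2 ⁅u.1, z⁆ + M.H ![v.1, u.1, z])
  have h := M.H.map_swap ![v.1, u.1, z] (i := 0) (j := 1) (by decide)
  have e : (![v.1, u.1, z] : Fin 3 → 𝔤) ∘ Equiv.swap 0 1 = ![u.1, v.1, z] := by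
    ext i; fin_cases i <;> rfl
  rw [e] at h
  rw [h]; ring

lemma form_swap_last (x y z : 𝔤) : M.H ![x, z, y] = - M.H ![x, y, z] := by
  have h := M.H.map_swap ![x, y, z] (i := 1) (j := 2) (by decide)
  have e : (![x, y, z] : Fin 3 → 𝔤) ∘ Equiv.swap 1 2 = ![x, z, y] := by
    ext i; fin_cases i <;> rfl
  rw [e] at h
  exact h

/-- Constancy of the pairings again. Together with `dorfman_skew` this makes `⟨[u, v], w⟩` totally
antisymmetric. -/
lemma pairing_dorfman_skew (u v w : GenTangent 𝔤) :
    pairing (M.dorfman u v) w = - pairing v (M.dorfman u w) := by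
  change (1 / 2 : ℝ) * (w.2 ⁅u.1, v.1⁆ + (- v.2 ⁅u.1, w.1⁆ + u.2 ⁅v.1, w.1⁆ + M.H ![u.1, v.1, w.1]))
    = - ((1 / 2 : ℝ) * ((- w.2 ⁅u.1, v.1⁆ + u.2 ⁅w.1, v.1⁆ + M.H ![u.1, w.1, v.1]) + v.2 ⁅u.1, w.1⁆))
  rw [form_swap_last, ← lie_skew w.1 v.1, map_neg]
  ring

lemma pairing_comm (u v : GenTangent 𝔤) : pairing u v = pairing v u := by
  simp only [pairing]; ring

lemma pairing_add_left (u u' v : GenTangent 𝔤) :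
    pairing (u + u') v = pairing u v + pairing u' v := by
  simp [pairing]; ring

lemma pairing_smul_left (c : ℝ) (u v : GenTangent 𝔤) :
    pairing (c • u) v = c * pairing u v := by
  simp [pairing]; ring

lemma pairing_neg_left (u v : GenTangent 𝔤) : pairing (-u) v = - pairing u v := by
  simp [pairing]; ring

lemma pairing_sub_left (u u' v : GenTangent 𝔤) :
    pairing (u - u') v = pairing u v - pairing u' v := by
  rw [sub_eq_add_neg, pairing_add_left, pairing_neg_left, sub_eq_add_neg]

lemma pairing_add_right (u v v' : GenTangent 𝔤) :
    pairing u (v + v') = pairing u v + pairing u v' := by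
  simp [pairing]; ring

lemma pairing_liftPlus_liftMinus (x y : 𝔤) :
    pairing (M.liftPlus x) (M.liftMinus y) = 0 := by
  simp [pairing, liftPlus, liftMinus, M.symm y x]

lemma eq_zero_of_eq_neg_self {x : 𝔤} (h : x = -x) : x = 0 := by
  have h2 : (2 : ℝ) • x = 0 := by rw [two_smul]; nth_rewrite 1 [h]; simp
  exact (smul_eq_zero.mp h2).resolve_left two_ne_zero

lemma pairing_dorfman_swap (u v w : GenTangent 𝔤) :
    pairing (M.dorfman u w) v = - pairing (M.dorfman u v) w := by
  rw [pairing_dorfman_skew, pairing_comm]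

lemma pairing_dorfman_swap' (u v w : GenTangent 𝔤) :
    pairing (M.dorfman v u) w = - pairing (M.dorfman u v) w := by
  rw [dorfman_skew, pairing_neg_left]

lemma pairing_dorfman_cycle (u v w : GenTangent 𝔤) :
    pairing (M.dorfman w u) v = pairing (M.dorfman u v) w := by
  rw [pairing_dorfman_swap', pairing_dorfman_swap, neg_neg]

variable [FiniteDimensional ℝ 𝔤]

/-- The component in `𝔤 ≃ E₊`. -/
def partPlus : GenTangent 𝔤 →ₗ[ℝ] 𝔤 :=
  (1 / 2 : ℝ) • (LinearMap.fst ℝ 𝔤 (Dual ℝ 𝔤) +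
    (M.g.toDual M.nondeg).symm.toLinearMap ∘ₗ LinearMap.snd ℝ 𝔤 (Dual ℝ 𝔤))

/-- The component in `𝔤 ≃ E₋`. -/
def partMinus : GenTangent 𝔤 →ₗ[ℝ] 𝔤 :=
  (1 / 2 : ℝ) • (LinearMap.fst ℝ 𝔤 (Dual ℝ 𝔤) -
    (M.g.toDual M.nondeg).symm.toLinearMap ∘ₗ LinearMap.snd ℝ 𝔤 (Dual ℝ 𝔤))

lemma toDual_symm_g (x : 𝔤) : (M.g.toDual M.nondeg).symm (M.g x) = x :=
  (M.g.toDual M.nondeg).symm_apply_apply x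

lemma g_toDual_symm (ξ : Dual ℝ 𝔤) : M.g ((M.g.toDual M.nondeg).symm ξ) = ξ :=
  (M.g.toDual M.nondeg).apply_symm_apply ξ

lemma g_partPlus (u : GenTangent 𝔤) (w : 𝔤) :
    M.g (M.partPlus u) w = pairing u (M.liftPlus w) := by
  simp [partPlus, g_toDual_symm, pairing, liftPlus, M.symm w]; ring

lemma g_partMinus (u : GenTangent 𝔤) (w : 𝔤) :
    M.g (M.partMinus u) w = - pairing u (M.liftMinus w) := by
  simp [partMinus, g_toDual_symm, pairing, liftMinus, M.symm w]; ring

lemma partPlus_liftPlus (x : 𝔤) : M.partPlus (M.liftPlus x) = x := by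
  simp [partPlus, liftPlus, toDual_symm_g]; module

lemma partPlus_liftMinus (x : 𝔤) : M.partPlus (M.liftMinus x) = 0 := by
  simp [partPlus, liftMinus, toDual_symm_g]

lemma partMinus_liftMinus (x : 𝔤) : M.partMinus (M.liftMinus x) = x := by
  simp [partMinus, liftMinus, toDual_symm_g]; module

lemma partMinus_liftPlus (x : 𝔤) : M.partMinus (M.liftPlus x) = 0 := by
  simp [partMinus, liftPlus, toDual_symm_g]

lemma lift_part_add (u : GenTangent 𝔤) :
    M.liftPlus (M.partPlus u) + M.liftMinus (M.partMinus u) = u := by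
  refine Prod.ext ?_ ?_
  · simp [partPlus, partMinus, liftPlus, liftMinus]
    module
  · simp [partPlus, partMinus, liftPlus, liftMinus, g_toDual_symm]
    module

lemma genEnd_liftPlus (x : 𝔤) : M.genEnd (M.liftPlus x) = M.liftPlus x :=
  Prod.ext (M.toDual_symm_g x) rfl

lemma genEnd_liftMinus (x : 𝔤) : M.genEnd (M.liftMinus x) = - M.liftMinus x := by
  refine Prod.ext ?_ ?_
  · change (M.g.toDual M.nondeg).symm (- M.g x) = - x
    rw [map_neg, toDual_symm_g]
  · change M.g x = - - M.g x
    simp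

lemma partPlus_genEnd (u : GenTangent 𝔤) : M.partPlus (M.genEnd u) = M.partPlus u := by
  conv_lhs => rw [← M.lift_part_add u]
  rw [map_add, map_add, genEnd_liftPlus, genEnd_liftMinus, map_neg, partPlus_liftMinus,
    partPlus_liftPlus]
  simp

lemma partMinus_genEnd (u : GenTangent 𝔤) : M.partMinus (M.genEnd u) = - M.partMinus u := by
  conv_lhs => rw [← M.lift_part_add u]
  rw [map_add, map_add, genEnd_liftPlus, genEnd_liftMinus, map_neg, partMinus_liftMinus,
    partMinus_liftPlus]
  simp

/-- The projection onto `E₊` as an endomorphism of `E`. -/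
def endPlus : End ℝ (GenTangent 𝔤) := M.liftPlus ∘ₗ M.partPlus

/-- The projection onto `E₋` as an endomorphism of `E`. -/
def endMinus : End ℝ (GenTangent 𝔤) := M.liftMinus ∘ₗ M.partMinus

lemma endPlus_add_endMinus : M.endPlus + M.endMinus = LinearMap.id :=
  LinearMap.ext fun u => M.lift_part_add u

lemma endMinus_comp_endPlus : M.endMinus ∘ₗ M.endPlus = 0 :=
  LinearMap.ext fun u => by simp [endMinus, endPlus, partMinus_liftPlus]

lemma endPlus_comp_endMinus : M.endPlus ∘ₗ M.endMinus = 0 :=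
  LinearMap.ext fun u => by simp [endMinus, endPlus, partPlus_liftMinus]

lemma endPlus_comp_endPlus : M.endPlus ∘ₗ M.endPlus = M.endPlus :=
  LinearMap.ext fun u => by simp [endPlus, partPlus_liftPlus]

lemma endMinus_comp_endMinus : M.endMinus ∘ₗ M.endMinus = M.endMinus :=
  LinearMap.ext fun u => by simp [endMinus, partMinus_liftMinus]

lemma coe_projPlus (u : GenTangent 𝔤) : (M.projPlus u : GenTangent 𝔤) = M.endPlus u := by
  change (1 / 2 : ℝ) • (u + M.genEnd u) = _
  conv_lhs => rw [← M.lift_part_add u]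
  rw [map_add, genEnd_liftPlus, genEnd_liftMinus]
  simp only [endPlus, LinearMap.comp_apply]
  module

lemma coe_projMinus (u : GenTangent 𝔤) : (M.projMinus u : GenTangent 𝔤) = M.endMinus u := by
  change (1 / 2 : ℝ) • (u - M.genEnd u) = _
  conv_lhs => rw [← M.lift_part_add u]
  rw [map_add, genEnd_liftPlus, genEnd_liftMinus]
  simp only [endMinus, LinearMap.comp_apply]
  module

lemma eq_liftPlus (c : M.Eplus) : (c : GenTangent 𝔤) = M.liftPlus (c : GenTangent 𝔤).1 := by
  have h : M.genEnd c = c := by simpa [Eplus, End.mem_eigenspace_iff] using c.2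
  exact Prod.ext rfl (congrArg Prod.snd h).symm

lemma eq_liftMinus (c : M.Eminus) : (c : GenTangent 𝔤) = M.liftMinus (c : GenTangent 𝔤).1 := by
  have h : M.genEnd c = - (c : GenTangent 𝔤) := by
    simpa [Eminus, End.mem_eigenspace_iff] using c.2
  refine Prod.ext rfl ?_
  have := congrArg Prod.snd h
  change M.g (c : GenTangent 𝔤).1 = - (c : GenTangent 𝔤).2 at this
  change (c : GenTangent 𝔤).2 = - M.g (c : GenTangent 𝔤).1
  rw [this, neg_neg]

lemma liftPlus_mem (x : 𝔤) : M.liftPlus x ∈ M.Eplus := by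
  simp [Eplus, genEnd_liftPlus]

lemma liftMinus_mem (x : 𝔤) : M.liftMinus x ∈ M.Eminus := by
  simp [Eminus, genEnd_liftMinus]

/-- `Z ↦ ∇⁺_Z Y`, where `∇⁺` is the metric connection with torsion `H`. -/
def covPlus (Y : 𝔤) : End ℝ 𝔤 := M.partPlus ∘ₗ M.dorfman.flip (M.liftPlus Y) ∘ₗ M.liftMinus

/-- `Z ↦ ∇⁻_Z Y`, where `∇⁻` is the metric connection with torsion `-H`. -/
def covMinus (Y : 𝔤) : End ℝ 𝔤 := M.partMinus ∘ₗ M.dorfman.flip (M.liftMinus Y) ∘ₗ M.liftPlus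

/-- The Koszul formula for left-invariant fields, with the torsion contributing half of `H`. -/
lemma g_covPlus (Y Z W : 𝔤) : M.g (M.covPlus Y Z) W =
    (1 / 2 : ℝ) * (M.g ⁅Z, Y⁆ W - M.g Y ⁅Z, W⁆ - M.g Z ⁅Y, W⁆ + M.H ![Z, Y, W]) := by
  rw [covPlus, LinearMap.comp_apply, g_partPlus]
  change (1 / 2 : ℝ) * (M.g W ⁅Z, Y⁆ + (- M.g Y ⁅Z, W⁆ + - M.g Z ⁅Y, W⁆ + M.H ![Z, Y, W])) = _
  rw [M.symm W]; ring

lemma g_covMinus (Y Z W : 𝔤) : M.g (M.covMinus Y Z) W =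
    (1 / 2 : ℝ) * (M.g ⁅Z, Y⁆ W - M.g Y ⁅Z, W⁆ - M.g Z ⁅Y, W⁆ - M.H ![Z, Y, W]) := by
  rw [covMinus, LinearMap.comp_apply, g_partMinus]
  change - ((1 / 2 : ℝ) *
    (- M.g W ⁅Z, Y⁆ + (- - M.g Y ⁅Z, W⁆ + M.g Z ⁅Y, W⁆ + M.H ![Z, Y, W]))) = _
  rw [M.symm W]; ring

/-- Cyclicity of the trace moves the projection to the right of the inclusion, turning a trace over
`E₊` into one over all of `E`. -/
lemma ricciPlus_eq_trace (D : GenTangent 𝔤 →ₗ[ℝ] GenTangent 𝔤 →ₗ[ℝ] GenTangent 𝔤)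
    (b : M.Eminus) (c : M.Eplus) : M.ricciPlus D b c =
      LinearMap.trace ℝ (GenTangent 𝔤) (M.curvature D b c ∘ₗ M.endPlus) := by
  have : Module.Free ℝ M.Eplus := by
    exact @Module.Free.of_divisionRing ℝ M.Eplus _ (Submodule.addCommGroup M.Eplus) M.Eplus.module
  refine (LinearMap.trace_comp_comm' (M := M.Eplus)
    (M.curvature D b c ∘ₗ M.Eplus.subtype) M.projPlus).trans ?_
  rw [LinearMap.comp_assoc]
  congr 2
  exact LinearMap.ext fun u => M.coe_projPlus u

lemma ricciMinus_eq_trace (D : GenTangent 𝔤 →ₗ[ℝ] GenTangent 𝔤 →ₗ[ℝ] GenTangent 𝔤)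
    (b : M.Eplus) (c : M.Eminus) : M.ricciMinus D b c =
      LinearMap.trace ℝ (GenTangent 𝔤) (M.curvature D b c ∘ₗ M.endMinus) := by
  have : Module.Free ℝ M.Eminus := by
    exact @Module.Free.of_divisionRing ℝ M.Eminus _ (Submodule.addCommGroup M.Eminus) M.Eminus.module
  refine (LinearMap.trace_comp_comm' (M := M.Eminus)
    (M.curvature D b c ∘ₗ M.Eminus.subtype) M.projMinus).trans ?_
  rw [LinearMap.comp_assoc]
  congr 2
  exact LinearMap.ext fun u => M.coe_projMinus u

section LeviCivita

variable {M} {D : GenTangent 𝔤 →ₗ[ℝ] GenTangent 𝔤 →ₗ[ℝ] GenTangent 𝔤}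

lemma IsGenLeviCivita.partMinus_liftPlus (hD : M.IsGenLeviCivita D) (u : GenTangent 𝔤) (x : 𝔤) :
    M.partMinus (D u (M.liftPlus x)) = 0 := by
  have h := congrArg M.partMinus (hD.metric u (M.liftPlus x))
  rw [genEnd_liftPlus, partMinus_genEnd] at h
  exact eq_zero_of_eq_neg_self h

lemma IsGenLeviCivita.partPlus_liftMinus (hD : M.IsGenLeviCivita D) (u : GenTangent 𝔤) (x : 𝔤) :
    M.partPlus (D u (M.liftMinus x)) = 0 := by
  have h := congrArg M.partPlus (hD.metric u (M.liftMinus x))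
  rw [genEnd_liftMinus, partPlus_genEnd, map_neg, map_neg] at h
  exact eq_zero_of_eq_neg_self h.symm

lemma IsGenLeviCivita.liftPlus_part (hD : M.IsGenLeviCivita D) (u : GenTangent 𝔤) (x : 𝔤) :
    D u (M.liftPlus x) = M.liftPlus (M.partPlus (D u (M.liftPlus x))) := by
  conv_lhs => rw [← M.lift_part_add (D u (M.liftPlus x))]
  rw [hD.partMinus_liftPlus, map_zero, add_zero]

lemma IsGenLeviCivita.liftMinus_part (hD : M.IsGenLeviCivita D) (u : GenTangent 𝔤) (x : 𝔤) :
    D u (M.liftMinus x) = M.liftMinus (M.partMinus (D u (M.liftMinus x))) := by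
  conv_lhs => rw [← M.lift_part_add (D u (M.liftMinus x))]
  rw [hD.partPlus_liftMinus, map_zero, zero_add]

/-- `D` preserves the mutually orthogonal eigenbundles. Torsion-freeness tested on one section of
`E₋` and two of `E₊` therefore loses every term but `D_u v` and the bracket. -/
lemma IsGenLeviCivita.mixed_plus (hD : M.IsGenLeviCivita D) (x y : 𝔤) :
    D (M.liftMinus x) (M.liftPlus y) =
      M.endPlus (M.dorfman (M.liftMinus x) (M.liftPlus y)) := by
  rw [hD.liftPlus_part, endPlus, LinearMap.comp_apply]
  congr 1
  refine (M.g.toDual M.nondeg).injective ?_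
  ext w
  change M.g _ w = M.g _ w
  have h := hD.torsion_free (M.liftMinus x) (M.liftPlus y) (M.liftPlus w)
  rw [hD.liftMinus_part (M.liftPlus y), hD.liftMinus_part (M.liftPlus w),
    pairing_sub_left, pairing_sub_left, pairing_liftPlus_liftMinus,
    pairing_comm (M.liftMinus _), pairing_liftPlus_liftMinus] at h
  rw [g_partPlus, g_partPlus]
  linarith

lemma IsGenLeviCivita.mixed_minus (hD : M.IsGenLeviCivita D) (x y : 𝔤) :
    D (M.liftPlus x) (M.liftMinus y) =
      M.endMinus (M.dorfman (M.liftPlus x) (M.liftMinus y)) := by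
  rw [hD.liftMinus_part, endMinus, LinearMap.comp_apply]
  congr 1
  refine (M.g.toDual M.nondeg).injective ?_
  ext w
  change M.g _ w = M.g _ w
  have h := hD.torsion_free (M.liftPlus x) (M.liftMinus y) (M.liftMinus w)
  rw [hD.liftPlus_part (M.liftMinus y), hD.liftPlus_part (M.liftMinus w),
    pairing_sub_left, pairing_sub_left, pairing_liftPlus_liftMinus,
    pairing_comm (M.liftMinus _), pairing_liftPlus_liftMinus] at h
  rw [g_partMinus, g_partMinus]
  linarith

lemma IsGenLeviCivita.comp_endPlus (hD : M.IsGenLeviCivita D) (u : GenTangent 𝔤) :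
    D u ∘ₗ M.endPlus = M.endPlus ∘ₗ D u := by
  refine LinearMap.ext fun x => ?_
  simp only [LinearMap.comp_apply, endPlus]
  rw [hD.liftPlus_part]
  conv_rhs => rw [← M.lift_part_add x]
  rw [map_add, map_add, hD.partPlus_liftMinus, add_zero]

lemma IsGenLeviCivita.comp_endMinus (hD : M.IsGenLeviCivita D) (u : GenTangent 𝔤) :
    D u ∘ₗ M.endMinus = M.endMinus ∘ₗ D u := by
  refine LinearMap.ext fun x => ?_
  simp only [LinearMap.comp_apply, endMinus]
  rw [hD.liftMinus_part]
  conv_rhs => rw [← M.lift_part_add x]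
  rw [map_add, map_add, hD.partMinus_liftPlus, zero_add]

lemma eq_liftPlus_of_endPlus {u : GenTangent 𝔤} (h : M.endPlus u = u) :
    u = M.liftPlus (M.partPlus u) := h.symm

lemma eq_liftMinus_of_endMinus {u : GenTangent 𝔤} (h : M.endMinus u = u) :
    u = M.liftMinus (M.partMinus u) := h.symm

lemma endPlus_liftPlus (x : 𝔤) : M.endPlus (M.liftPlus x) = M.liftPlus x := by
  simp [endPlus, partPlus_liftPlus]

lemma endMinus_liftMinus (x : 𝔤) : M.endMinus (M.liftMinus x) = M.liftMinus x := by
  simp [endMinus, partMinus_liftMinus]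

lemma IsGenLeviCivita.trace_plus (hD : M.IsGenLeviCivita D) (hdiv : ∀ e, divergence D e = 0)
    (x y : 𝔤) :
    LinearMap.trace ℝ _ (M.curvature D (M.liftMinus x) (M.liftPlus y) ∘ₗ M.endPlus) =
      - LinearMap.trace ℝ 𝔤 (M.covPlus y ∘ₗ M.covMinus x) := by
  have h := trace_curvature_comp_proj D M.dorfman M.endPlus M.endMinus M.endPlus_add_endMinus
    M.endMinus_comp_endPlus M.endPlus_comp_endPlus hD.comp_endPlus (M.liftMinus x) (M.liftPlus y)
    (endMinus_liftMinus x) (endPlus_liftPlus y)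
    (fun u v hu hv => by
      rw [eq_liftMinus_of_endMinus hu, eq_liftPlus_of_endPlus hv]; exact hD.mixed_plus _ _)
    (fun u => M.dorfman_skew _ _) hdiv
  rw [curvature, h, neg_inj]
  have e : M.endPlus ∘ₗ M.dorfman.flip (M.liftPlus y) ∘ₗ M.endMinus ∘ₗ
      M.dorfman.flip (M.liftMinus x) ∘ₗ M.endPlus =
      M.liftPlus ∘ₗ (M.covPlus y ∘ₗ M.covMinus x ∘ₗ M.partPlus) := rfl
  rw [e, LinearMap.trace_comp_comm']
  congr 1
  refine LinearMap.ext fun z => ?_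
  simp [partPlus_liftPlus]

/-- Up to naming of the arguments this is the trace occurring in `trace_plus`. Hence one family of
equations controls both Ricci curvatures. -/
lemma IsGenLeviCivita.trace_minus (hD : M.IsGenLeviCivita D) (hdiv : ∀ e, divergence D e = 0)
    (x y : 𝔤) :
    LinearMap.trace ℝ _ (M.curvature D (M.liftPlus x) (M.liftMinus y) ∘ₗ M.endMinus) =
      - LinearMap.trace ℝ 𝔤 (M.covPlus x ∘ₗ M.covMinus y) := by
  have h := trace_curvature_comp_proj D M.dorfman M.endMinus M.endPlus
    (by rw [add_comm]; exact M.endPlus_add_endMinus)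
    M.endPlus_comp_endMinus M.endMinus_comp_endMinus hD.comp_endMinus (M.liftPlus x)
    (M.liftMinus y) (endPlus_liftPlus x) (endMinus_liftMinus y)
    (fun u v hu hv => by
      rw [eq_liftPlus_of_endPlus hu, eq_liftMinus_of_endMinus hv]; exact hD.mixed_minus _ _)
    (fun u => M.dorfman_skew _ _) hdiv
  rw [curvature, h, neg_inj]
  have e : M.endMinus ∘ₗ M.dorfman.flip (M.liftMinus y) ∘ₗ M.endPlus ∘ₗ
      M.dorfman.flip (M.liftPlus x) ∘ₗ M.endMinus =
      M.liftMinus ∘ₗ (M.covMinus y ∘ₗ M.covPlus x ∘ₗ M.partMinus) := rfl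
  rw [e, LinearMap.trace_comp_comm', ← LinearMap.trace_comp_comm' (M.covPlus x)]
  congr 1
  refine LinearMap.ext fun z => ?_
  simp [partMinus_liftMinus]

end LeviCivita

/-! ### The canonical generalised Levi-Civita connection -/

/-- The metric conjugates a skew endomorphism to minus its transpose, so its trace equals its own
negative. -/
lemma trace_eq_zero_of_skew (C : End ℝ 𝔤) (hC : ∀ x y, M.g (C x) y = - M.g x (C y)) :
    LinearMap.trace ℝ 𝔤 C = 0 := by
  have h1 : (M.g.toDual M.nondeg).conj C = - Module.Dual.transpose C := by
    refine LinearMap.ext fun ξ => ?_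
    ext y
    rw [LinearEquiv.conj_apply_apply]
    change M.g (C ((M.g.toDual M.nondeg).symm ξ)) y = - ξ (C y)
    rw [hC, g_toDual_symm]
  have h2 := LinearMap.trace_conj' C (M.g.toDual M.nondeg)
  rw [h1] at h2
  have h3 := LinearMap.trace_transpose' (R := ℝ) C
  have h4 := map_neg (LinearMap.trace ℝ (Dual ℝ 𝔤)) (Module.Dual.transpose (R := ℝ) C)
  linarith

/-- The generalised Levi-Civita connection whose pure components are a third of the bracket. -/
def canonicalConnection : GenTangent 𝔤 →ₗ[ℝ] GenTangent 𝔤 →ₗ[ℝ] GenTangent 𝔤 :=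
  (M.dorfman.compl₁₂ M.endMinus M.endPlus).compr₂ M.endPlus +
  (M.dorfman.compl₁₂ M.endPlus M.endMinus).compr₂ M.endMinus +
  (1 / 3 : ℝ) • (M.dorfman.compl₁₂ M.endPlus M.endPlus).compr₂ M.endPlus +
  (1 / 3 : ℝ) • (M.dorfman.compl₁₂ M.endMinus M.endMinus).compr₂ M.endMinus

lemma canonicalConnection_apply (u v : GenTangent 𝔤) : M.canonicalConnection u v =
    M.endPlus (M.dorfman (M.endMinus u) (M.endPlus v)) +
    M.endMinus (M.dorfman (M.endPlus u) (M.endMinus v)) +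
    (1 / 3 : ℝ) • M.endPlus (M.dorfman (M.endPlus u) (M.endPlus v)) +
    (1 / 3 : ℝ) • M.endMinus (M.dorfman (M.endMinus u) (M.endMinus v)) := rfl

lemma pairing_endPlus (u v : GenTangent 𝔤) :
    pairing (M.endPlus u) v = pairing u (M.endPlus v) := by
  rw [← M.lift_part_add u, ← M.lift_part_add v]
  simp only [endPlus, LinearMap.comp_apply, map_add, partPlus_liftPlus, partPlus_liftMinus,
    add_zero, map_zero, pairing_add_left, pairing_add_right, pairing_liftPlus_liftMinus]
  rw [pairing_comm (M.liftMinus _), pairing_liftPlus_liftMinus, add_zero]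

lemma pairing_endMinus (u v : GenTangent 𝔤) :
    pairing (M.endMinus u) v = pairing u (M.endMinus v) := by
  rw [← M.lift_part_add u, ← M.lift_part_add v]
  simp only [endMinus, LinearMap.comp_apply, map_add, partMinus_liftPlus, partMinus_liftMinus,
    zero_add, map_zero, pairing_add_left, pairing_add_right, pairing_liftPlus_liftMinus]
  rw [pairing_comm (M.liftMinus _), pairing_liftPlus_liftMinus, zero_add]

lemma pairing_canonicalConnection (u v w : GenTangent 𝔤) :
    pairing (M.canonicalConnection u v) w =
      pairing (M.dorfman (M.endMinus u) (M.endPlus v)) (M.endPlus w) +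
      pairing (M.dorfman (M.endPlus u) (M.endMinus v)) (M.endMinus w) +
      1 / 3 * pairing (M.dorfman (M.endPlus u) (M.endPlus v)) (M.endPlus w) +
      1 / 3 * pairing (M.dorfman (M.endMinus u) (M.endMinus v)) (M.endMinus w) := by
  rw [canonicalConnection_apply, pairing_add_left, pairing_add_left, pairing_add_left,
    pairing_smul_left, pairing_smul_left, pairing_endPlus, pairing_endPlus, pairing_endMinus,
    pairing_endMinus]

/-- The factor one third is forced by the torsion: on a pure triple it is a sum of three terms which
total antisymmetry makes equal, and together they must cancel one bracket. -/
lemma isGenLeviCivita_canonicalConnection : M.IsGenLeviCivita M.canonicalConnection where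
  pairing_skew u v w := by
    rw [pairing_comm v, pairing_canonicalConnection, pairing_canonicalConnection,
      M.pairing_dorfman_swap (M.endMinus u) (M.endPlus v),
      M.pairing_dorfman_swap (M.endPlus u) (M.endMinus v),
      M.pairing_dorfman_swap (M.endPlus u) (M.endPlus v),
      M.pairing_dorfman_swap (M.endMinus u) (M.endMinus v)]
    ring
  metric u v := by
    have h1 : ∀ x, M.genEnd (M.endPlus x) = M.endPlus x := fun x => M.genEnd_liftPlus _
    have h2 : ∀ x, M.genEnd (M.endMinus x) = - M.endMinus x := fun x => M.genEnd_liftMinus _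
    have h3 : ∀ x, M.endPlus (M.genEnd x) = M.endPlus x := fun x => by
      simp [endPlus, partPlus_genEnd]
    have h4 : ∀ x, M.endMinus (M.genEnd x) = - M.endMinus x := fun x => by
      simp [endMinus, partMinus_genEnd]
    simp only [canonicalConnection_apply, map_add, map_smul, h1, h2, h3, h4, map_neg]
  torsion_free u v w := by
    have hu : M.endPlus u + M.endMinus u = u := M.lift_part_add u
    have hv : M.endPlus v + M.endMinus v = v := M.lift_part_add v
    have hw : M.endPlus w + M.endMinus w = w := M.lift_part_add w
    have hT : pairing (M.dorfman u v) w =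
        pairing (M.dorfman (M.endPlus u + M.endMinus u) (M.endPlus v + M.endMinus v))
          (M.endPlus w + M.endMinus w) := by rw [hu, hv, hw]
    simp only [map_add, LinearMap.add_apply, pairing_add_left, pairing_add_right] at hT
    rw [pairing_sub_left, pairing_sub_left, pairing_comm v, hT]
    simp only [pairing_canonicalConnection]
    rw [M.pairing_dorfman_swap' (M.endPlus u) (M.endMinus v),
      M.pairing_dorfman_swap' (M.endMinus u) (M.endPlus v),
      M.pairing_dorfman_swap' (M.endPlus u) (M.endPlus v),
      M.pairing_dorfman_swap' (M.endMinus u) (M.endMinus v),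
      M.pairing_dorfman_cycle (M.endPlus u), M.pairing_dorfman_cycle (M.endPlus u),
      M.pairing_dorfman_cycle (M.endMinus u), M.pairing_dorfman_cycle (M.endMinus u)]
    ring

/-- The mixed parts map one eigenbundle into the other and have no trace. The pure parts are skew
for `g`. -/
lemma divergence_canonicalConnection (e : GenTangent 𝔤) :
    divergence M.canonicalConnection e = 0 := by
  have h : M.canonicalConnection.flip e =
      M.liftPlus ∘ₗ (M.partPlus ∘ₗ M.dorfman.flip (M.endPlus e) ∘ₗ M.endMinus) +
      M.liftMinus ∘ₗ (M.partMinus ∘ₗ M.dorfman.flip (M.endMinus e) ∘ₗ M.endPlus) +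
      (1 / 3 : ℝ) • (M.liftPlus ∘ₗ (M.partPlus ∘ₗ M.dorfman.flip (M.endPlus e) ∘ₗ M.endPlus)) +
      (1 / 3 : ℝ) • (M.liftMinus ∘ₗ
        (M.partMinus ∘ₗ M.dorfman.flip (M.endMinus e) ∘ₗ M.endMinus)) := rfl
  have h1 : LinearMap.trace ℝ 𝔤 ((M.partPlus ∘ₗ M.dorfman.flip (M.endPlus e) ∘ₗ M.endMinus) ∘ₗ
      M.liftPlus) = 0 := by
    convert map_zero (LinearMap.trace ℝ 𝔤)
    exact LinearMap.ext fun z => by simp [endMinus, partMinus_liftPlus]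
  have h2 : LinearMap.trace ℝ 𝔤 ((M.partMinus ∘ₗ M.dorfman.flip (M.endMinus e) ∘ₗ M.endPlus) ∘ₗ
      M.liftMinus) = 0 := by
    convert map_zero (LinearMap.trace ℝ 𝔤)
    exact LinearMap.ext fun z => by simp [endPlus, partPlus_liftMinus]
  have h3 : LinearMap.trace ℝ 𝔤 ((M.partPlus ∘ₗ M.dorfman.flip (M.endPlus e) ∘ₗ M.endPlus) ∘ₗ
      M.liftPlus) = 0 := by
    refine M.trace_eq_zero_of_skew _ fun x y => ?_
    simp only [LinearMap.comp_apply, LinearMap.flip_apply]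
    rw [M.symm x, g_partPlus, g_partPlus]
    simp only [endPlus, LinearMap.comp_apply, partPlus_liftPlus]
    rw [pairing_dorfman_cycle, pairing_dorfman_swap]
    rw [← pairing_dorfman_cycle, M.pairing_dorfman_swap']
  have h4 : LinearMap.trace ℝ 𝔤 ((M.partMinus ∘ₗ M.dorfman.flip (M.endMinus e) ∘ₗ M.endMinus) ∘ₗ
      M.liftMinus) = 0 := by
    refine M.trace_eq_zero_of_skew _ fun x y => ?_
    simp only [LinearMap.comp_apply, LinearMap.flip_apply]
    rw [M.symm x, g_partMinus, g_partMinus]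
    simp only [endMinus, LinearMap.comp_apply, partMinus_liftMinus]
    rw [pairing_dorfman_cycle, pairing_dorfman_swap]
    rw [← pairing_dorfman_cycle, M.pairing_dorfman_swap']
  rw [divergence, h, map_add, map_add, map_add, map_smul, map_smul]
  rw [← LinearMap.trace_comp_comm'] at h1 h2 h3 h4
  rw [h1, h2, h3, h4]
  simp

/-- The generalised Einstein condition with vanishing divergence in terms of `∇⁺` and `∇⁻`. -/
theorem isGenEinstein_zero_iff : M.IsGenEinstein 0 ↔
    ∀ x y, LinearMap.trace ℝ 𝔤 (M.covPlus x ∘ₗ M.covMinus y) = 0 := by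
  constructor
  · rintro ⟨D, hD, hdiv, hp, -⟩ x y
    have h := hp ⟨M.liftMinus y, M.liftMinus_mem y⟩ ⟨M.liftPlus x, M.liftPlus_mem x⟩
    rw [ricciPlus_eq_trace, hD.trace_plus (fun e => by simpa using hdiv e)] at h
    linarith
  · intro h
    -- The trace formula holds for every divergence-free connection, so the canonical one can serve
    -- as witness.
    have hD := M.isGenLeviCivita_canonicalConnection
    refine ⟨M.canonicalConnection, hD, fun e => by simp [divergence_canonicalConnection],
      fun b c => ?_, fun b c => ?_⟩
    · rw [ricciPlus_eq_trace, eq_liftMinus, eq_liftPlus,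
        hD.trace_plus M.divergence_canonicalConnection, h, neg_zero]
    · rw [ricciMinus_eq_trace, eq_liftMinus, eq_liftPlus,
        hD.trace_minus M.divergence_canonicalConnection, h, neg_zero]

end GenMetric

/-! ### The generalised Einstein equations in a frame -/

/-- The matrix entries of `2 ∇^σ E_a` in a frame with Gram matrix `s i δ_{j, π i}`, structure
constants `c` and components `η` of the three-form, for the connection with torsion `σ H`. -/
def covEntry (π : Fin 4 → Fin 4) (s : Fin 4 → ℝ) (c η : Fin 4 → Fin 4 → Fin 4 → ℝ) (σ : ℝ)
    (a i j : Fin 4) : ℝ :=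
  c j a i - s i * s a * c j (π i) (π a) - s i * s j * c a (π i) (π j) + σ * (s i * η j a (π i))

/-- The components of the generalised Ricci curvature in a frame, up to sign. -/
def frameRicci (π : Fin 4 → Fin 4) (s : Fin 4 → ℝ) (c η : Fin 4 → Fin 4 → Fin 4 → ℝ)
    (a b : Fin 4) : ℝ :=
  1 / 4 * ∑ i, ∑ j, covEntry π s c η 1 a i j * covEntry π s c η (-1) b j i

/-- The structure constants of the semidirect product defined by `F`. -/
def bracketTable (F : Matrix (Fin 3) (Fin 3) ℝ) : Fin 4 → Fin 4 → Fin 4 → ℝ :=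
  ![![0, 0, 0, ![-F 0 0, -F 1 0, -F 2 0, 0]],
    ![0, 0, 0, ![-F 0 1, -F 1 1, -F 2 1, 0]],
    ![0, 0, 0, ![-F 0 2, -F 1 2, -F 2 2, 0]],
    ![![F 0 0, F 1 0, F 2 0, 0], ![F 0 1, F 1 1, F 2 1, 0], ![F 0 2, F 1 2, F 2 2, 0], 0]]

/-- The components of a three-form on a four-dimensional space. -/
def formTable (h b01 b02 b12 : ℝ) : Fin 4 → Fin 4 → Fin 4 → ℝ :=
  ![![0, ![0, 0, h, b01], ![0, -h, 0, b02], ![0, -b01, -b02, 0]],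
    ![![0, 0, -h, -b01], 0, ![h, 0, 0, b12], ![b01, 0, -b12, 0]],
    ![![0, h, 0, -b02], ![-h, 0, 0, -b12], 0, ![b02, b12, 0, 0]],
    ![![0, b01, b02, 0], ![-b01, 0, b12, 0], ![-b02, -b12, 0, 0], 0]]

/-- The frame has a timelike fourth vector orthogonal to a Euclidean basis of `n`. The last diagonal
entry is `tr((f^S)²)` plus half the squared norm of `H(·, ·, X)`, a sum of squares. -/
lemma frameRicci_euclid (f00 f01 f02 f10 f11 f12 f20 f21 f22 h b01 b02 b12 : ℝ) (a b : Fin 4) :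
    frameRicci ![0, 1, 2, 3] ![1, 1, 1, -1]
      (bracketTable !![f00, f01, f02; f10, f11, f12; f20, f21, f22])
      (formTable h b01 b02 b12) a b =
      (![![-1 / 2 * b01 * b01 - 1 / 2 * b02 * b02 + 1 / 2 * f01 * f01 + 1 / 2 * f02 * f02 - 1 / 2 * f10 * f10 - 1 / 2 * f20 * f20 + 1 / 2 * h * h,
        -1 / 2 * b01 * f00 - 1 / 2 * b01 * f11 - 1 / 2 * b02 * b12 - 1 / 2 * b02 * f12 + 1 / 2 * b12 * f02 - 1 / 2 * f00 * f01 + 1 / 2 * f00 * f10 + 1 / 2 * f01 * f11 + 1 / 2 * f02 * f12 - 1 / 2 * f10 * f11 - 1 / 2 * f20 * f21,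
        1 / 2 * b01 * b12 - 1 / 2 * b01 * f21 - 1 / 2 * b02 * f00 - 1 / 2 * b02 * f22 - 1 / 2 * b12 * f01 - 1 / 2 * f00 * f02 + 1 / 2 * f00 * f20 + 1 / 2 * f01 * f21 + 1 / 2 * f02 * f22 - 1 / 2 * f10 * f12 - 1 / 2 * f20 * f22,
        1 / 2 * b12 * h],
      ![1 / 2 * b01 * f00 + 1 / 2 * b01 * f11 - 1 / 2 * b02 * b12 + 1 / 2 * b02 * f12 - 1 / 2 * b12 * f02 - 1 / 2 * f00 * f01 + 1 / 2 * f00 * f10 + 1 / 2 * f01 * f11 + 1 / 2 * f02 * f12 - 1 / 2 * f10 * f11 - 1 / 2 * f20 * f21,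
        -1 / 2 * b01 * b01 - 1 / 2 * b12 * b12 - 1 / 2 * f01 * f01 + 1 / 2 * f10 * f10 + 1 / 2 * f12 * f12 - 1 / 2 * f21 * f21 + 1 / 2 * h * h,
        -1 / 2 * b01 * b02 + 1 / 2 * b01 * f20 - 1 / 2 * b02 * f10 - 1 / 2 * b12 * f11 - 1 / 2 * b12 * f22 - 1 / 2 * f01 * f02 + 1 / 2 * f10 * f20 - 1 / 2 * f11 * f12 + 1 / 2 * f11 * f21 + 1 / 2 * f12 * f22 - 1 / 2 * f21 * f22,
        -1 / 2 * b02 * h],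
      ![1 / 2 * b01 * b12 + 1 / 2 * b01 * f21 + 1 / 2 * b02 * f00 + 1 / 2 * b02 * f22 + 1 / 2 * b12 * f01 - 1 / 2 * f00 * f02 + 1 / 2 * f00 * f20 + 1 / 2 * f01 * f21 + 1 / 2 * f02 * f22 - 1 / 2 * f10 * f12 - 1 / 2 * f20 * f22,
        -1 / 2 * b01 * b02 - 1 / 2 * b01 * f20 + 1 / 2 * b02 * f10 + 1 / 2 * b12 * f11 + 1 / 2 * b12 * f22 - 1 / 2 * f01 * f02 + 1 / 2 * f10 * f20 - 1 / 2 * f11 * f12 + 1 / 2 * f11 * f21 + 1 / 2 * f12 * f22 - 1 / 2 * f21 * f22,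
        -1 / 2 * b02 * b02 - 1 / 2 * b12 * b12 - 1 / 2 * f02 * f02 - 1 / 2 * f12 * f12 + 1 / 2 * f20 * f20 + 1 / 2 * f21 * f21 + 1 / 2 * h * h,
        1 / 2 * b01 * h],
      ![1 / 2 * b12 * h,
        -1 / 2 * b02 * h,
        1 / 2 * b01 * h,
        1 / 2 * b01 * b01 + 1 / 2 * b02 * b02 + 1 / 2 * b12 * b12 + f00 * f00 + 1 / 2 * f01 * f01 + f01 * f10 + 1 / 2 * f02 * f02 + f02 * f20 + 1 / 2 * f10 * f10 + f11 * f11 + 1 / 2 * f12 * f12 + f12 * f21 + 1 / 2 * f20 * f20 + 1 / 2 * f21 * f21 + f22 * f22]] : Fin 4 → Fin 4 → ℝ) a b := by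
  fin_cases a <;> fin_cases b <;>
    simp [frameRicci, covEntry, Fin.sum_univ_four, bracketTable, formTable] <;> ring

/-- This orthonormal table serves to verify the listed normal forms; solving the equations is easier
in the null table below. -/
lemma frameRicci_lorentz (f00 f01 f02 f10 f11 f12 f20 f21 f22 h b01 b02 b12 : ℝ) (a b : Fin 4) :
    frameRicci ![0, 1, 2, 3] ![-1, 1, 1, 1]
      (bracketTable !![f00, f01, f02; f10, f11, f12; f20, f21, f22])
      (formTable h b01 b02 b12) a b =
      (![![1 / 2 * b01 * b01 + 1 / 2 * b02 * b02 - 1 / 2 * f01 * f01 - 1 / 2 * f02 * f02 + 1 / 2 * f10 * f10 + 1 / 2 * f20 * f20 + 1 / 2 * h * h,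
        1 / 2 * b01 * f00 + 1 / 2 * b01 * f11 + 1 / 2 * b02 * b12 + 1 / 2 * b02 * f12 + 1 / 2 * b12 * f02 - 1 / 2 * f00 * f01 - 1 / 2 * f00 * f10 + 1 / 2 * f01 * f11 + 1 / 2 * f02 * f12 + 1 / 2 * f10 * f11 + 1 / 2 * f20 * f21,
        -1 / 2 * b01 * b12 + 1 / 2 * b01 * f21 + 1 / 2 * b02 * f00 + 1 / 2 * b02 * f22 - 1 / 2 * b12 * f01 - 1 / 2 * f00 * f02 - 1 / 2 * f00 * f20 + 1 / 2 * f01 * f21 + 1 / 2 * f02 * f22 + 1 / 2 * f10 * f12 + 1 / 2 * f20 * f22,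
        1 / 2 * b12 * h],
      ![-1 / 2 * b01 * f00 - 1 / 2 * b01 * f11 + 1 / 2 * b02 * b12 - 1 / 2 * b02 * f12 - 1 / 2 * b12 * f02 - 1 / 2 * f00 * f01 - 1 / 2 * f00 * f10 + 1 / 2 * f01 * f11 + 1 / 2 * f02 * f12 + 1 / 2 * f10 * f11 + 1 / 2 * f20 * f21,
        -1 / 2 * b01 * b01 + 1 / 2 * b12 * b12 - 1 / 2 * f01 * f01 + 1 / 2 * f10 * f10 - 1 / 2 * f12 * f12 + 1 / 2 * f21 * f21 - 1 / 2 * h * h,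
        -1 / 2 * b01 * b02 + 1 / 2 * b01 * f20 - 1 / 2 * b02 * f10 + 1 / 2 * b12 * f11 + 1 / 2 * b12 * f22 - 1 / 2 * f01 * f02 + 1 / 2 * f10 * f20 + 1 / 2 * f11 * f12 - 1 / 2 * f11 * f21 - 1 / 2 * f12 * f22 + 1 / 2 * f21 * f22,
        1 / 2 * b02 * h],
      ![-1 / 2 * b01 * b12 - 1 / 2 * b01 * f21 - 1 / 2 * b02 * f00 - 1 / 2 * b02 * f22 + 1 / 2 * b12 * f01 - 1 / 2 * f00 * f02 - 1 / 2 * f00 * f20 + 1 / 2 * f01 * f21 + 1 / 2 * f02 * f22 + 1 / 2 * f10 * f12 + 1 / 2 * f20 * f22,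
        -1 / 2 * b01 * b02 - 1 / 2 * b01 * f20 + 1 / 2 * b02 * f10 - 1 / 2 * b12 * f11 - 1 / 2 * b12 * f22 - 1 / 2 * f01 * f02 + 1 / 2 * f10 * f20 + 1 / 2 * f11 * f12 - 1 / 2 * f11 * f21 - 1 / 2 * f12 * f22 + 1 / 2 * f21 * f22,
        -1 / 2 * b02 * b02 + 1 / 2 * b12 * b12 - 1 / 2 * f02 * f02 + 1 / 2 * f12 * f12 + 1 / 2 * f20 * f20 - 1 / 2 * f21 * f21 - 1 / 2 * h * h,
        -1 / 2 * b01 * h],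
      ![1 / 2 * b12 * h,
        1 / 2 * b02 * h,
        -1 / 2 * b01 * h,
        -1 / 2 * b01 * b01 - 1 / 2 * b02 * b02 + 1 / 2 * b12 * b12 + f00 * f00 - 1 / 2 * f01 * f01 + f01 * f10 - 1 / 2 * f02 * f02 + f02 * f20 - 1 / 2 * f10 * f10 + f11 * f11 + 1 / 2 * f12 * f12 + f12 * f21 - 1 / 2 * f20 * f20 + 1 / 2 * f21 * f21 + f22 * f22]] : Fin 4 → Fin 4 → ℝ) a b := by
  fin_cases a <;> fin_cases b <;>
    simp [frameRicci, covEntry, Fin.sum_univ_four, bracketTable, formTable] <;> ring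

/-- The involution exchanges the two null vectors `e₀` and `e₂` of `n`. -/
lemma frameRicci_null (f00 f01 f02 f10 f11 f12 f20 f21 f22 h b01 b02 b12 : ℝ) (a b : Fin 4) :
    frameRicci ![2, 1, 0, 3] ![1, 1, 1, 1]
      (bracketTable !![f00, f01, f02; f10, f11, f12; f20, f21, f22])
      (formTable h b01 b02 b12) a b =
      (![![1 / 2 * b01 * b01 + f00 * f20 + 1 / 2 * f10 * f10 - f20 * f22 - 1 / 2 * f21 * f21,
        -1 / 2 * b01 * b02 + 1 / 2 * b01 * f11 + 1 / 2 * b01 * f22 + 1 / 2 * b02 * f10 - 1 / 2 * b12 * f20 + 1 / 2 * f00 * f21 + 1 / 2 * f01 * f20 + 1 / 2 * f10 * f11 - 1 / 2 * f10 * f22 - 1 / 2 * f11 * f21 - 1 / 2 * f12 * f20,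
        -1 / 2 * b01 * b12 + 1 / 2 * b01 * f01 - 1 / 2 * b02 * b02 + 1 / 2 * b02 * f00 + 1 / 2 * b02 * f22 + 1 / 2 * b12 * f21 - 1 / 2 * f01 * f21 + 1 / 2 * f10 * f12 - 1 / 2 * h * h,
        -1 / 2 * b01 * h],
      ![-1 / 2 * b01 * b02 - 1 / 2 * b01 * f11 - 1 / 2 * b01 * f22 - 1 / 2 * b02 * f10 + 1 / 2 * b12 * f20 + 1 / 2 * f00 * f21 + 1 / 2 * f01 * f20 + 1 / 2 * f10 * f11 - 1 / 2 * f10 * f22 - 1 / 2 * f11 * f21 - 1 / 2 * f12 * f20,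
        -b01 * b12 + f01 * f21 - f10 * f12 - 1 / 2 * h * h,
        -1 / 2 * b01 * f02 - 1 / 2 * b02 * b12 + 1 / 2 * b02 * f12 + 1 / 2 * b12 * f00 + 1 / 2 * b12 * f11 - 1 / 2 * f00 * f12 - 1 / 2 * f01 * f11 + 1 / 2 * f01 * f22 - 1 / 2 * f02 * f10 + 1 / 2 * f02 * f21 + 1 / 2 * f11 * f12,
        1 / 2 * b02 * h],
      ![-1 / 2 * b01 * b12 - 1 / 2 * b01 * f01 - 1 / 2 * b02 * b02 - 1 / 2 * b02 * f00 - 1 / 2 * b02 * f22 - 1 / 2 * b12 * f21 - 1 / 2 * f01 * f21 + 1 / 2 * f10 * f12 - 1 / 2 * h * h,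
        1 / 2 * b01 * f02 - 1 / 2 * b02 * b12 - 1 / 2 * b02 * f12 - 1 / 2 * b12 * f00 - 1 / 2 * b12 * f11 - 1 / 2 * f00 * f12 - 1 / 2 * f01 * f11 + 1 / 2 * f01 * f22 - 1 / 2 * f02 * f10 + 1 / 2 * f02 * f21 + 1 / 2 * f11 * f12,
        1 / 2 * b12 * b12 - f00 * f02 - 1 / 2 * f01 * f01 + f02 * f22 + 1 / 2 * f12 * f12,
        -1 / 2 * b12 * h],
      ![-1 / 2 * b01 * h,
        1 / 2 * b02 * h,
        -1 / 2 * b12 * h,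
        -b01 * b12 - 1 / 2 * b02 * b02 + 1 / 2 * f00 * f00 + f00 * f22 + f01 * f10 + f01 * f21 + 2 * f02 * f20 + f10 * f12 + f11 * f11 + f12 * f21 + 1 / 2 * f22 * f22]] : Fin 4 → Fin 4 → ℝ) a b := by
  fin_cases a <;> fin_cases b <;>
    simp [frameRicci, covEntry, Fin.sum_univ_four, bracketTable, formTable] <;> ring

/-- The radical vector `e₂` of `n` is paired with a null vector outside `n`, so the involution
exchanges the last two indices. -/
lemma frameRicci_degenerate (f00 f01 f02 f10 f11 f12 f20 f21 f22 h b01 b02 b12 : ℝ) (a b : Fin 4) :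
    frameRicci ![0, 1, 3, 2] ![1, 1, 1, 1]
      (bracketTable !![f00, f01, f02; f10, f11, f12; f20, f21, f22])
      (formTable h b01 b02 b12) a b =
      (![![b01 * h - 1 / 2 * b02 * b02 + 1 / 2 * f02 * f02,
        -1 / 2 * b02 * b12 - 1 / 2 * b02 * f12 + 1 / 2 * b12 * f02 + 1 / 2 * f00 * h + 1 / 2 * f02 * f12 + 1 / 2 * f11 * h,
        -1 / 2 * b12 * h,
        1 / 2 * b01 * b12 - 1 / 2 * b02 * f00 - 1 / 2 * b02 * f22 - 1 / 2 * b12 * f01 - 1 / 2 * f00 * f02 + 1 / 2 * f02 * f22 - 1 / 2 * f10 * f12 + 1 / 2 * f21 * h],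
      ![-1 / 2 * b02 * b12 + 1 / 2 * b02 * f12 - 1 / 2 * b12 * f02 - 1 / 2 * f00 * h + 1 / 2 * f02 * f12 - 1 / 2 * f11 * h,
        b01 * h - 1 / 2 * b12 * b12 + 1 / 2 * f12 * f12,
        1 / 2 * b02 * h,
        -1 / 2 * b01 * b02 - 1 / 2 * b02 * f10 - 1 / 2 * b12 * f11 - 1 / 2 * b12 * f22 - 1 / 2 * f01 * f02 - 1 / 2 * f11 * f12 + 1 / 2 * f12 * f22 - 1 / 2 * f20 * h],
      ![-1 / 2 * b12 * h,
        1 / 2 * b02 * h,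
        1 / 2 * h * h,
        1 / 2 * b01 * h - 1 / 2 * b02 * b02 - 1 / 2 * b12 * b12 - 1 / 2 * f02 * f02 - 1 / 2 * f12 * f12],
      ![1 / 2 * b01 * b12 + 1 / 2 * b02 * f00 + 1 / 2 * b02 * f22 + 1 / 2 * b12 * f01 - 1 / 2 * f00 * f02 + 1 / 2 * f02 * f22 - 1 / 2 * f10 * f12 - 1 / 2 * f21 * h,
        -1 / 2 * b01 * b02 + 1 / 2 * b02 * f10 + 1 / 2 * b12 * f11 + 1 / 2 * b12 * f22 - 1 / 2 * f01 * f02 - 1 / 2 * f11 * f12 + 1 / 2 * f12 * f22 + 1 / 2 * f20 * h,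
        1 / 2 * b01 * h - 1 / 2 * b02 * b02 - 1 / 2 * b12 * b12 - 1 / 2 * f02 * f02 - 1 / 2 * f12 * f12,
        1 / 2 * b01 * b01 + f00 * f00 + 1 / 2 * f01 * f01 + f01 * f10 + f02 * f20 + 1 / 2 * f10 * f10 + f11 * f11 + f12 * f21 + f22 * f22]] : Fin 4 → Fin 4 → ℝ) a b := by
  fin_cases a <;> fin_cases b <;>
    simp [frameRicci, covEntry, Fin.sum_univ_four, bracketTable, formTable] <;> ring

section FrameTheorem

variable {𝔤 : Type*} [LieRing 𝔤] [LieAlgebra ℝ 𝔤] [FiniteDimensional ℝ 𝔤]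

lemma repr_eq_of_gram {ι V : Type*} [Fintype ι] [DecidableEq ι] [AddCommGroup V] [Module ℝ V]
    (B : LinearMap.BilinForm ℝ V) (E : Basis ι ℝ V) (E' : ι → V)
    (h : ∀ i j, B (E' i) (E j) = if i = j then 1 else 0) (x : V) (i : ι) :
    E.repr x i = B (E' i) x := by
  conv_rhs => rw [← E.sum_repr x, map_sum]
  simp only [map_smul (B (E' i)), h]
  simp

lemma trace_comp_eq_sum {ι V : Type*} [Fintype ι] [DecidableEq ι] [AddCommGroup V] [Module ℝ V]
    (B : LinearMap.BilinForm ℝ V) (E : Basis ι ℝ V) (E' : ι → V)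
    (h : ∀ i j, B (E' i) (E j) = if i = j then 1 else 0) (P Q : End ℝ V) :
    LinearMap.trace ℝ V (P ∘ₗ Q) = ∑ i, ∑ j, B (E' i) (P (E j)) * B (E' j) (Q (E i)) := by
  rw [LinearMap.trace_eq_matrix_trace ℝ E, LinearMap.toMatrix_comp E E E, Matrix.trace]
  refine Finset.sum_congr rfl fun i _ => ?_
  rw [Matrix.diag_apply, Matrix.mul_apply]
  refine Finset.sum_congr rfl fun j _ => ?_
  rw [LinearMap.toMatrix_apply, LinearMap.toMatrix_apply, repr_eq_of_gram B E E' h,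
    repr_eq_of_gram B E E' h]

/-- Allowing an involution `π` in the Gram matrix treats orthonormal and null frames together: in
each case the dual frame is `s i • E (π i)`. -/
lemma GenMetric.isGenEinstein_iff_frameRicci (M : GenMetric 𝔤) (E : Basis (Fin 4) ℝ 𝔤)
    (π : Fin 4 → Fin 4) (s : Fin 4 → ℝ) (c η : Fin 4 → Fin 4 → Fin 4 → ℝ)
    (hπ : ∀ i, π (π i) = i) (hs : ∀ i, s i * s i = 1) (hsπ : ∀ i, s (π i) = s i)
    (hg : ∀ i j, M.g (E i) (E j) = if j = π i then s i else 0)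
    (hc : ∀ i j, ⁅E i, E j⁆ = ∑ k, c i j k • E k)
    (hη : ∀ i j k, M.H ![E i, E j, E k] = η i j k) :
    M.IsGenEinstein 0 ↔ ∀ a b, frameRicci π s c η a b = 0 := by
  have hd : ∀ i j, M.g (s i • E (π i)) (E j) = if i = j then 1 else 0 := fun i j => by
    rw [map_smul, LinearMap.smul_apply, hg, hπ, hsπ]
    by_cases h : i = j
    · rw [if_pos h.symm, if_pos h, smul_eq_mul, hs]
    · rw [if_neg (Ne.symm h), if_neg h, smul_zero]
  have hbr : ∀ i j k, M.g ⁅E i, E j⁆ (s k • E (π k)) = c i j k := fun i j k => by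
    rw [M.symm, hc, map_sum]
    simp only [map_smul (M.g (s k • E (π k))), hd]
    simp
  have hbr' : ∀ i j k, M.g (E k) ⁅E i, E j⁆ = s k * c i j (π k) := fun i j k => by
    rw [← hbr, hπ, hsπ, M.symm, map_smul, smul_eq_mul, ← mul_assoc, hs, one_mul]
  have hP : ∀ a i j, M.g (s i • E (π i)) (M.covPlus (E a) (E j)) =
      1 / 2 * covEntry π s c η 1 a i j := fun a i j => by
    rw [M.symm, M.g_covPlus, hbr, lie_smul, lie_smul, map_smul, map_smul, hbr', hbr',
      GenMetric.form_smul_two, hη, covEntry, smul_eq_mul, smul_eq_mul]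
    ring
  have hM : ∀ a i j, M.g (s i • E (π i)) (M.covMinus (E a) (E j)) =
      1 / 2 * covEntry π s c η (-1) a i j := fun a i j => by
    rw [M.symm, M.g_covMinus, hbr, lie_smul, lie_smul, map_smul, map_smul, hbr', hbr',
      GenMetric.form_smul_two, hη, covEntry, smul_eq_mul, smul_eq_mul]
    ring
  have key : ∀ a b, LinearMap.trace ℝ 𝔤 (M.covPlus (E a) ∘ₗ M.covMinus (E b)) =
      frameRicci π s c η a b := fun a b => by
    rw [trace_comp_eq_sum M.g E (fun i => s i • E (π i)) hd, frameRicci, Finset.mul_sum]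
    refine Finset.sum_congr rfl fun i _ => ?_
    rw [Finset.mul_sum]
    refine Finset.sum_congr rfl fun j _ => ?_
    rw [hP, hM]; ring
  rw [M.isGenEinstein_zero_iff]
  constructor
  · intro h a b
    rw [← key, h]
  · intro h
    -- The trace is bilinear in both arguments, so its vanishing on the frame suffices.
    let T : 𝔤 →ₗ[ℝ] 𝔤 →ₗ[ℝ] ℝ := LinearMap.mk₂ ℝ
      (fun x y => LinearMap.trace ℝ 𝔤 (M.covPlus x ∘ₗ M.covMinus y))
      (fun x x' y => by
        have e : M.covPlus (x + x') = M.covPlus x + M.covPlus x' := by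
          simp [GenMetric.covPlus, LinearMap.add_comp, LinearMap.comp_add]
        rw [e, LinearMap.add_comp, map_add])
      (fun r x y => by
        have e : M.covPlus (r • x) = r • M.covPlus x := by
          simp [GenMetric.covPlus, LinearMap.smul_comp, LinearMap.comp_smul]
        rw [e, LinearMap.smul_comp, map_smul])
      (fun x y y' => by
        have e : M.covMinus (y + y') = M.covMinus y + M.covMinus y' := by
          simp [GenMetric.covMinus, LinearMap.add_comp, LinearMap.comp_add]
        rw [e, LinearMap.comp_add, map_add])
      (fun r x y => by
        have e : M.covMinus (r • y) = r • M.covMinus y := by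
          simp [GenMetric.covMinus, LinearMap.smul_comp, LinearMap.comp_smul]
        rw [e, LinearMap.comp_smul, map_smul])
    have hT : T = 0 := E.ext fun a => E.ext fun b => by
      change LinearMap.trace ℝ 𝔤 (M.covPlus (E a) ∘ₗ M.covMinus (E b)) = 0
      rw [key, h]
    intro x y
    exact LinearMap.congr_fun (LinearMap.congr_fun hT x) y

end FrameTheorem

/-! ### Components of three-forms and brackets in a basis -/

section Tables

variable {𝔤 : Type*} [LieRing 𝔤] [LieAlgebra ℝ 𝔤]

lemma form_swap_zero_one (H : 𝔤 [⋀^Fin 3]→ₗ[ℝ] ℝ) (x y z : 𝔤) :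
    H ![y, x, z] = - H ![x, y, z] := by
  have h := H.map_swap ![x, y, z] (i := 0) (j := 1) (by decide)
  have e : (![x, y, z] : Fin 3 → 𝔤) ∘ Equiv.swap 0 1 = ![y, x, z] := by
    ext i; fin_cases i <;> rfl
  rw [e] at h
  exact h

lemma form_self_zero_one (H : 𝔤 [⋀^Fin 3]→ₗ[ℝ] ℝ) (x z : 𝔤) : H ![x, x, z] = 0 :=
  H.map_eq_zero_of_eq _ (i := 0) (j := 1) rfl (by decide)

lemma form_self_one_two (H : 𝔤 [⋀^Fin 3]→ₗ[ℝ] ℝ) (x z : 𝔤) : H ![z, x, x] = 0 :=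
  H.map_eq_zero_of_eq _ (i := 1) (j := 2) rfl (by decide)

lemma form_self_zero_two (H : 𝔤 [⋀^Fin 3]→ₗ[ℝ] ℝ) (x z : 𝔤) : H ![x, z, x] = 0 :=
  H.map_eq_zero_of_eq _ (i := 0) (j := 2) rfl (by decide)

lemma form_eq_formTable (H : 𝔤 [⋀^Fin 3]→ₗ[ℝ] ℝ) (E : Fin 4 → 𝔤) (i j k : Fin 4) :
    H ![E i, E j, E k] = formTable (H ![E 0, E 1, E 2]) (H ![E 0, E 1, E 3])
      (H ![E 0, E 2, E 3]) (H ![E 1, E 2, E 3]) i j k := by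
  have sw := form_swap_zero_one H
  have cy := GenMetric.form_cycle H
  fin_cases i <;> fin_cases j <;> fin_cases k <;>
    simp [formTable, form_self_zero_one, form_self_one_two, form_self_zero_two]
  all_goals first
    | exact sw _ _ _
    | exact cy _ _ _
    | exact (cy _ _ _).symm
    | exact (cy _ _ _).trans (sw _ _ _)
    | exact ((cy _ _ _).trans (cy _ _ _)).trans (sw _ _ _)

lemma form_ext {H H' : 𝔤 [⋀^Fin 3]→ₗ[ℝ] ℝ} (E : Basis (Fin 4) ℝ 𝔤)
    (h0 : H ![E 0, E 1, E 2] = H' ![E 0, E 1, E 2])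
    (h1 : H ![E 0, E 1, E 3] = H' ![E 0, E 1, E 3])
    (h2 : H ![E 0, E 2, E 3] = H' ![E 0, E 2, E 3])
    (h3 : H ![E 1, E 2, E 3] = H' ![E 1, E 2, E 3]) : H = H' := by
  refine Basis.ext_alternating E fun v _ => ?_
  have e : (fun i => E (v i)) = ![E (v 0), E (v 1), E (v 2)] := by
    ext i; fin_cases i <;> rfl
  rw [e, form_eq_formTable H E, form_eq_formTable H' E, h0, h1, h2, h3]

end Tables

section Extend

variable {𝔤 : Type*} [LieRing 𝔤] [LieAlgebra ℝ 𝔤] {n : LieIdeal ℝ 𝔤} {X : 𝔤}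

/-- The basis `(e₁, e₂, e₃, X)` of `𝔤`. -/
lemma exists_basis_extend (hdim : finrank ℝ 𝔤 = 4) (hX : X ∉ n) (e : Basis (Fin 3) ℝ n) :
    ∃ E : Basis (Fin 4) ℝ 𝔤, (∀ i : Fin 3, E i.castSucc = (e i : 𝔤)) ∧ E 3 = X := by
  have hli : LinearIndependent ℝ (fun i => (e i : 𝔤)) :=
    e.linearIndependent.map' n.toSubmodule.subtype (Submodule.ker_subtype _)
  have hspan : X ∉ Submodule.span ℝ (Set.range fun i => (e i : 𝔤)) := fun h => hX <| by
    refine (Submodule.span_le (p := n.toSubmodule)).mpr ?_ h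
    rintro _ ⟨i, rfl⟩
    exact (e i).2
  have hs : LinearIndependent ℝ (Fin.snoc (fun i => (e i : 𝔤)) X : Fin 4 → 𝔤) :=
    linearIndependent_finSnoc.mpr ⟨hli, hspan⟩
  refine ⟨basisOfLinearIndependentOfCardEqFinrank hs (by simp [hdim]), fun i => ?_, ?_⟩
  · rw [coe_basisOfLinearIndependentOfCardEqFinrank, Fin.snoc_castSucc]
  · rw [coe_basisOfLinearIndependentOfCardEqFinrank]
    exact Fin.snoc_last (α := fun _ => 𝔤) X _

lemma hasMatrix_iff (e : Basis (Fin 3) ℝ n) (A : Matrix (Fin 3) (Fin 3) ℝ) :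
    HasMatrix n X e A ↔ ∀ j, adOn n X (e j) = ∑ i, A i j • e i := by
  rw [HasMatrix]
  constructor
  · rintro rfl j
    rw [← e.sum_repr (adOn n X (e j))]
    simp [LinearMap.toMatrix_apply]
  · intro h
    ext i j
    rw [LinearMap.toMatrix_apply, h, map_sum]
    simp [Finsupp.single_apply]

lemma lie_eq_bracketTable (hab : IsLieAbelian n) (e : Basis (Fin 3) ℝ n) (E : Basis (Fin 4) ℝ 𝔤)
    (hE : ∀ i : Fin 3, E i.castSucc = (e i : 𝔤)) (hX : E 3 = X) {A : Matrix (Fin 3) (Fin 3) ℝ}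
    (hA : HasMatrix n X e A) (i j : Fin 4) : ⁅E i, E j⁆ = ∑ k, bracketTable A i j k • E k := by
  rw [hasMatrix_iff] at hA
  have hn : ∀ i j : Fin 3, ⁅E i.castSucc, E j.castSucc⁆ = 0 := fun i j => by
    rw [hE, hE]
    exact congrArg Subtype.val (hab.trivial (e i) (e j))
  have hx : ∀ j : Fin 3, ⁅E 3, E j.castSucc⁆ = ∑ i : Fin 3, A i j • E i.castSucc := fun j => by
    simp only [hE, hX]
    have := congrArg Subtype.val (hA j)
    simpa using this
  have hx' : ∀ j : Fin 3, ⁅E j.castSucc, E 3⁆ = -∑ i : Fin 3, A i j • E i.castSucc := fun j => by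
    rw [← hx, lie_skew]
  have h01 := hn 0 1; have h02 := hn 0 2
  have h10 := hn 1 0; have h12 := hn 1 2
  have h20 := hn 2 0; have h21 := hn 2 1
  have h30 := hx 0; have h31 := hx 1; have h32 := hx 2
  have h03 := hx' 0; have h13 := hx' 1; have h23 := hx' 2
  simp only [Fin.sum_univ_three, Fin.castSucc_zero, Fin.castSucc_one, Fin.reduceCastSucc] at *
  fin_cases i <;> fin_cases j <;>
    simp [Fin.sum_univ_four, bracketTable, h01, h02, h10, h12, h20, h21, h30, h31,
      h32, h03, h13, h23] <;> module

end Extend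

/-! ### Linear algebra of Lorentzian forms -/

section LinearAlgebra

variable {V : Type*} [AddCommGroup V] [Module ℝ V]

/-- In a Lorentzian space the orthogonal complement of a timelike vector is positive definite. -/
lemma pos_of_orthogonal_timelike {B : LinearMap.BilinForm ℝ V} (hB : IsLorentzianForm B)
    {x y : V} (hx : B x x < 0) (hxy : B x y = 0) (hy : y ≠ 0) : 0 < B y y := by
  obtain ⟨m, b, hb⟩ := hB
  have key : ∀ u w : V, B u w = - (b.repr u 0 * b.repr w 0) +
      ∑ i : Fin m, b.repr u i.succ * b.repr w i.succ := fun u w => by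
    conv_lhs => rw [← b.sum_repr u, ← b.sum_repr w]
    simp only [map_sum, LinearMap.sum_apply, map_smul, LinearMap.smul_apply, hb _ _]
    simp [Fin.sum_univ_succ, Fin.succ_ne_zero, mul_comm]
  rw [key] at hx hxy ⊢
  -- The reversed Cauchy-Schwarz argument: the spatial inner product equals `x0 * y0`, while `p < x0
  -- ^ 2`. If `q ≤ y0 ^ 2`, this leaves only `y = 0`.
  have cs := Finset.sum_mul_sq_le_sq_mul_sq Finset.univ (fun i : Fin m => b.repr x i.succ)
    (fun i : Fin m => b.repr y i.succ)
  set x0 := b.repr x 0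
  set y0 := b.repr y 0
  simp only [← pow_two] at hx hxy ⊢
  set p := ∑ i : Fin m, b.repr x i.succ ^ 2
  set q := ∑ i : Fin m, b.repr y i.succ ^ 2 with hq
  set r := ∑ i : Fin m, b.repr x i.succ * b.repr y i.succ
  have hq0 : 0 ≤ q := Finset.sum_nonneg fun i _ => sq_nonneg _
  have hr : r = x0 * y0 := by linarith
  rw [hr] at cs
  by_contra hneg
  have hle : q ≤ y0 ^ 2 := by linarith
  have hp0 : 0 ≤ p := Finset.sum_nonneg fun i _ => sq_nonneg _
  have hpx : p < x0 ^ 2 := by linarith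
  have hy0 : y0 ^ 2 = 0 := by
    by_contra h0
    have h0' : 0 < y0 ^ 2 := lt_of_le_of_ne (sq_nonneg _) (Ne.symm h0)
    nlinarith [mul_le_mul_of_nonneg_left hle hp0, mul_lt_mul_of_pos_right hpx h0']
  have hq' : q = 0 := by linarith
  apply hy
  refine b.repr.map_eq_zero_iff.mp (Finsupp.ext fun i => ?_)
  refine Fin.cases ?_ (fun i => ?_) i
  · simpa using hy0
  · rw [hq, Finset.sum_eq_zero_iff_of_nonneg fun i _ => sq_nonneg _] at hq'
    simpa using hq' i (Finset.mem_univ i)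

lemma exists_euclidBasis [FiniteDimensional ℝ V] {B : LinearMap.BilinForm ℝ V} {d : ℕ}
    (hd : finrank ℝ V = d) (hs : ∀ x y, B x y = B y x) (hp : ∀ x, x ≠ 0 → 0 < B x x) :
    ∃ e : Basis (Fin d) ℝ V, IsEuclidBasis B e := by
  subst hd
  obtain ⟨v, hv⟩ := LinearMap.BilinForm.exists_orthogonal_basis (B := B)
    ⟨fun x y => by simpa using hs x y⟩
  have hpos : ∀ i, 0 < B (v i) (v i) := fun i => hp _ (v.ne_zero i)
  have hu : ∀ i, IsUnit ((√(B (v i) (v i)))⁻¹) := fun i =>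
    (inv_ne_zero (Real.sqrt_pos.mpr (hpos i)).ne').isUnit
  refine ⟨v.isUnitSMul hu, fun i j => ?_⟩
  rw [Basis.isUnitSMul_apply, Basis.isUnitSMul_apply, map_smul, map_smul, LinearMap.smul_apply]
  by_cases h : i = j
  · subst h
    have h1 := Real.mul_self_sqrt (hpos i).le
    have h2 := (Real.sqrt_pos.mpr (hpos i)).ne'
    simp only [smul_eq_mul, if_true]
    field_simp
    rw [pow_two, h1]
  · have : B (v i) (v j) = 0 := hv h
    simp [h, this]

/-- A linear relation among the vectors lies in the kernel of their Gram matrix, so an invertible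
Gram matrix gives independence. -/
lemma exists_basis_of_gram [FiniteDimensional ℝ V] {B : LinearMap.BilinForm ℝ V} {d : ℕ}
    (hd : finrank ℝ V = d) (v : Fin d → V) (G : Matrix (Fin d) (Fin d) ℝ)
    (hG : IsUnit G.det) (hv : ∀ i j, B (v i) (v j) = G i j) :
    ∃ e : Basis (Fin d) ℝ V, ∀ i, e i = v i := by
  have hli : LinearIndependent ℝ v := by
    rw [Fintype.linearIndependent_iff]
    intro c hc
    have h0 : G.mulVec c = 0 := by
      ext i
      have : B (v i) (∑ j, c j • v j) = 0 := by rw [hc, map_zero]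
      rw [map_sum] at this
      simp only [map_smul (B (v i)), hv, smul_eq_mul] at this
      rw [Matrix.mulVec, dotProduct, Pi.zero_apply, ← this]
      exact Finset.sum_congr rfl fun j _ => mul_comm _ _
    have h1 : c = 0 := by
      have := congrArg (G⁻¹.mulVec) h0
      rwa [Matrix.mulVec_mulVec, Matrix.nonsing_inv_mul _ hG, Matrix.one_mulVec,
        Matrix.mulVec_zero] at this
    exact fun i => congrFun h1 i
  exact ⟨basisOfLinearIndependentOfCardEqFinrank' v hli (by simp [hd]), fun i => by simp⟩

/-- All normal forms are reached through this lemma. The condition `G' * G' = 1`, true of both Gram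
matrices in use, certifies invertibility, and `F * P = P * A` avoids computing an inverse of `P`. -/
lemma exists_basis_change {B : LinearMap.BilinForm ℝ V} (e : Basis (Fin 3) ℝ V)
    {G G' : Matrix (Fin 3) (Fin 3) ℝ} (hG : ∀ i j, B (e i) (e j) = G i j) (hG' : G' * G' = 1)
    (P : Matrix (Fin 3) (Fin 3) ℝ) (hP : P.transpose * G * P = G') :
    ∃ e' : Basis (Fin 3) ℝ V, (∀ j, e' j = ∑ i, P i j • e i) ∧
      (∀ i j, B (e' i) (e' j) = G' i j) ∧
      ∀ (f : End ℝ V) (F A : Matrix (Fin 3) (Fin 3) ℝ), LinearMap.toMatrix e e f = F →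
        F * P = P * A → LinearMap.toMatrix e' e' f = A := by
  have : FiniteDimensional ℝ V := Module.Finite.of_basis e
  have hgram : ∀ i j, B (∑ k, P k i • e k) (∑ k, P k j • e k) = G' i j := fun i j => by
    rw [← hP]
    simp only [map_sum, map_smul, LinearMap.sum_apply, LinearMap.smul_apply, hG, smul_eq_mul,
      Matrix.mul_apply, Matrix.transpose_apply, Finset.sum_mul, Finset.mul_sum]
    refine Finset.sum_congr rfl fun k _ => Finset.sum_congr rfl fun l _ => ?_
    ring
  obtain ⟨e', he'⟩ := exists_basis_of_gram (B := B) (finrank_eq_card_basis e |>.trans (by simp))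
    (fun j => ∑ i, P i j • e i) G' (IsUnit.of_mul_eq_one G'.det (by
      rw [← Matrix.det_mul, hG', Matrix.det_one])) hgram
  refine ⟨e', he', fun i j => by rw [he', he', hgram], fun f F A hF hFA => ?_⟩
  have hf : ∀ j, f (e j) = ∑ i, F i j • e i := fun j => by
    rw [← hF, ← e.sum_repr (f (e j))]
    simp [LinearMap.toMatrix_apply]
  have hfe : ∀ j, f (e' j) = ∑ i, A i j • e' i := fun j => by
    simp only [he', map_sum, map_smul, hf, Finset.smul_sum, smul_smul]
    rw [Finset.sum_comm]
    conv_rhs => rw [Finset.sum_comm]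
    refine Finset.sum_congr rfl fun k _ => ?_
    rw [← Finset.sum_smul, ← Finset.sum_smul]
    have := congrFun (congrFun hFA k) j
    rw [Matrix.mul_apply, Matrix.mul_apply] at this
    have h1 : ∑ i, P i j * F k i = ∑ i, F k i * P i j :=
      Finset.sum_congr rfl fun _ _ => mul_comm _ _
    rw [h1, this]
    exact congrArg (· • e k) (Finset.sum_congr rfl fun _ _ => mul_comm _ _)
  ext i j
  rw [LinearMap.toMatrix_apply, hfe, map_sum]
  simp [Finsupp.single_apply]

/-- The Gram matrix of a Lorentzian orthonormal basis. -/
def gramLorentz : Matrix (Fin 3) (Fin 3) ℝ := !![-1, 0, 0; 0, 1, 0; 0, 0, 1]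

/-- The Gram matrix of a null basis `(u, e, v)`. -/
def gramNull : Matrix (Fin 3) (Fin 3) ℝ := !![0, 0, 1; 0, 1, 0; 1, 0, 0]

/-- `(u, e, v)` is a null basis: `g(u, v) = g(e, e) = 1`, all other products vanish. -/
def IsNullBasis (B : LinearMap.BilinForm ℝ V) (e : Basis (Fin 3) ℝ V) : Prop :=
  ∀ i j, B (e i) (e j) = gramNull i j

lemma isLorentzBasis_iff {B : LinearMap.BilinForm ℝ V} {e : Basis (Fin 3) ℝ V} :
    IsLorentzBasis B e ↔ ∀ i j, B (e i) (e j) = gramLorentz i j := by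
  refine forall_congr' fun i => forall_congr' fun j => ?_
  fin_cases i <;> fin_cases j <;> simp [gramLorentz]

lemma gramNull_sq : gramNull * gramNull = 1 := by
  ext i j; fin_cases i <;> fin_cases j <;> simp [gramNull, Matrix.mul_apply, Fin.sum_univ_three]

lemma gramLorentz_sq : gramLorentz * gramLorentz = 1 := by
  ext i j; fin_cases i <;> fin_cases j <;>
    simp [gramLorentz, Matrix.mul_apply, Fin.sum_univ_three]

/-- Applied to `g(t, ·)` for a timelike `t` in `n`, and to `g(X, ·)` when `n` is degenerate. -/
lemma exists_orthogonal_two {B : LinearMap.BilinForm ℝ V} (hs : ∀ x y, B x y = B y x)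
    [FiniteDimensional ℝ V] (h3 : finrank ℝ V = 3) (φ : Dual ℝ V) (hφ : φ ≠ 0)
    (hp : ∀ x, φ x = 0 → x ≠ 0 → 0 < B x x) :
    ∃ a b : V, φ a = 0 ∧ φ b = 0 ∧ B a a = 1 ∧ B b b = 1 ∧ B a b = 0 := by
  let W := LinearMap.ker φ
  have hW : finrank ℝ W = 2 := by
    have : finrank ℝ W + 1 = finrank ℝ V := Module.Dual.finrank_ker_add_one_of_ne_zero hφ
    omega
  obtain ⟨e, he⟩ := exists_euclidBasis (B := B.restrict W) hW (fun x y => hs x y)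
    (fun x hx => hp x x.2 (by simpa using hx))
  exact ⟨e 0, e 1, (e 0).2, (e 1).2, by simpa using he 0 0, by simpa using he 1 1,
    by simpa using he 0 1⟩

/-- A rotation of the spacelike plane moves any vector into the plane of the first two basis
vectors. -/
lemma exists_lorentzBasis_plane {B : LinearMap.BilinForm ℝ V} (e : Basis (Fin 3) ℝ V)
    (he : IsLorentzBasis B e) (w : V) :
    ∃ e' : Basis (Fin 3) ℝ V, IsLorentzBasis B e' ∧ ∃ x y : ℝ, w = x • e' 0 + y • e' 1 := by
  obtain ⟨x, y, z, hxyz⟩ : ∃ x y z, w = x • e 0 + y • e 1 + z • e 2 :=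
    ⟨e.repr w 0, e.repr w 1, e.repr w 2, by rw [← Fin.sum_univ_three (fun i => e.repr w i • e i),
      e.sum_repr]⟩
  by_cases h : y ^ 2 + z ^ 2 = 0
  · have hz : z = 0 := by nlinarith [sq_nonneg y, sq_nonneg z]
    exact ⟨e, he, x, y, by simp [hxyz, hz]⟩
  obtain ⟨r, hr⟩ : ∃ r : ℝ, r ^ 2 = y ^ 2 + z ^ 2 := ⟨√(y ^ 2 + z ^ 2), Real.sq_sqrt (by positivity)⟩
  have hr0 : r ≠ 0 := by rintro rfl; exact h (by linarith)
  obtain ⟨i, hi⟩ : ∃ i : ℝ, r * i = 1 := ⟨r⁻¹, mul_inv_cancel₀ hr0⟩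
  have hi2 : i ^ 2 * (y ^ 2 + z ^ 2) = 1 := by rw [← hr]; linear_combination (r * i + 1) * hi
  rw [isLorentzBasis_iff] at he
  obtain ⟨e', h1, h2, -⟩ := exists_basis_change e he gramLorentz_sq
    !![1, 0, 0; 0, y * i, -(z * i); 0, z * i, y * i] (by
      ext j k
      fin_cases j <;> fin_cases k <;>
        simp [gramLorentz, Matrix.mul_apply, Fin.sum_univ_three] <;>
        first | ring1 | linear_combination hi2)
  refine ⟨e', isLorentzBasis_iff.mpr h2, x, r, ?_⟩
  rw [hxyz, h1, h1]
  simp only [Fin.sum_univ_three, Matrix.of_apply, Matrix.cons_val]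
  match_scalars <;>
    first | ring1 | linear_combination -y * hi | linear_combination -z * hi

/-- Every nonzero vector of a three-dimensional Lorentzian space is adapted to a null basis. -/
lemma exists_nullBasis_adapted {B : LinearMap.BilinForm ℝ V} (e : Basis (Fin 3) ℝ V)
    (he : IsLorentzBasis B e) (w : V) (hw : w ≠ 0) :
    ∃ e' : Basis (Fin 3) ℝ V, IsNullBasis B e' ∧
      ((∃ c : ℝ, c ≠ 0 ∧ w = c • e' 1) ∨
        (∃ c : ℝ, c ≠ 0 ∧ w = c • e' 0 - (2 * c) • e' 2) ∨ w = e' 0) := by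
  obtain ⟨e, he, x, y, hxy⟩ := exists_lorentzBasis_plane e he w
  rw [isLorentzBasis_iff] at he
  -- As `g(w, w) = y² - x²`, the cases are `w` spacelike, null and timelike. In the timelike case
  -- the unit vector along `w` is half of `e' 0 - 2 e' 2`, whence the coefficients `c` and `-2c`.
  rcases lt_trichotomy (x ^ 2) (y ^ 2) with h | h | h
  · obtain ⟨N, hN⟩ : ∃ N : ℝ, N ^ 2 = y ^ 2 - x ^ 2 :=
      ⟨√(y ^ 2 - x ^ 2), Real.sq_sqrt (by linarith)⟩
    have hN0 : N ≠ 0 := by rintro rfl; linarith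
    obtain ⟨i, hi⟩ : ∃ i : ℝ, N * i = 1 := ⟨N⁻¹, mul_inv_cancel₀ hN0⟩
    have hi2 : i ^ 2 * (y ^ 2 - x ^ 2) = 1 := by rw [← hN]; linear_combination (N * i + 1) * hi
    obtain ⟨e', h1, h2, -⟩ := exists_basis_change e he gramNull_sq
      !![y * i, x * i, -(y * i) / 2; x * i, y * i, -(x * i) / 2; 1, 0, 1 / 2] (by
        ext j k
        fin_cases j <;> fin_cases k <;>
          simp [gramLorentz, gramNull, Matrix.mul_apply, Fin.sum_univ_three] <;>
          first | ring1 | linear_combination hi2 | linear_combination -hi2 |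
            linear_combination hi2 / 2 | linear_combination -hi2 / 4)
    refine ⟨e', h2, Or.inl ⟨N, hN0, ?_⟩⟩
    rw [hxy, h1]
    simp only [Fin.sum_univ_three, Matrix.of_apply, Matrix.cons_val]
    match_scalars <;>
      first | ring1 | linear_combination -x * hi | linear_combination -y * hi
  · have hx : x ≠ 0 := by
      rintro rfl
      have : y = 0 := by nlinarith
      exact hw (by simp [hxy, this])
    obtain ⟨i, hi⟩ : ∃ i : ℝ, x * i = 1 := ⟨x⁻¹, mul_inv_cancel₀ hx⟩
    have hi2 : i ^ 2 * y ^ 2 = 1 := by rw [← h]; linear_combination (x * i + 1) * hi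
    obtain ⟨e', h1, h2, -⟩ := exists_basis_change e he gramNull_sq
      !![x, 0, - i / 2; y, 0, y * i ^ 2 / 2; 0, 1, 0] (by
        ext j k
        fin_cases j <;> fin_cases k <;>
          simp [gramLorentz, gramNull, Matrix.mul_apply, Fin.sum_univ_three] <;>
          first | ring1 | linear_combination h | linear_combination -h |
            linear_combination hi / 2 + hi2 / 2 | linear_combination i ^ 2 / 4 * hi2)
    refine ⟨e', h2, Or.inr (Or.inr ?_)⟩
    rw [hxy, h1]
    simp [Fin.sum_univ_three]
  · obtain ⟨N, hN⟩ : ∃ N : ℝ, N ^ 2 = x ^ 2 - y ^ 2 :=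
      ⟨√(x ^ 2 - y ^ 2), Real.sq_sqrt (by linarith)⟩
    have hN0 : N ≠ 0 := by rintro rfl; linarith
    obtain ⟨i, hi⟩ : ∃ i : ℝ, N * i = 1 := ⟨N⁻¹, mul_inv_cancel₀ hN0⟩
    have hi2 : i ^ 2 * (x ^ 2 - y ^ 2) = 1 := by rw [← hN]; linear_combination (N * i + 1) * hi
    obtain ⟨e', h1, h2, -⟩ := exists_basis_change e he gramNull_sq
      !![x * i, y * i, -(x * i) / 2; y * i, x * i, -(y * i) / 2; 1, 0, 1 / 2] (by
        ext j k
        fin_cases j <;> fin_cases k <;>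
          simp [gramLorentz, gramNull, Matrix.mul_apply, Fin.sum_univ_three] <;>
          first | ring1 | linear_combination hi2 | linear_combination -hi2 |
            linear_combination hi2 / 2 | linear_combination -hi2 / 4)
    refine ⟨e', h2, Or.inr (Or.inl ⟨N / 2, by simpa using hN0, ?_⟩)⟩
    rw [hxy, h1, h1]
    simp only [Fin.sum_univ_three, Matrix.of_apply, Matrix.cons_val]
    match_scalars <;>
      first | ring1 | linear_combination -x * hi | linear_combination -y * hi

/-- A real cubic with leading coefficient `1` has a real root. -/
lemma exists_root_cubic (a b c : ℝ) : ∃ x : ℝ, x ^ 3 + a * x ^ 2 + b * x + c = 0 := by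
  -- At `±R` the cubic term dominates, because `R³` is `R²` times `1 + |a| + |b| + |c|` and `R ≥ 1`.
  -- The values therefore have opposite weak signs.
  set R := 1 + |a| + |b| + |c|
  have ha := abs_nonneg a; have hb := abs_nonneg b; have hc := abs_nonneg c
  have hR : 1 ≤ R := by simp only [R]; linarith
  have hR2 : R ≤ R ^ 2 := by nlinarith
  have hR0 : 1 ≤ R ^ 2 := by nlinarith
  have hcont : Continuous fun x : ℝ => x ^ 3 + a * x ^ 2 + b * x + c := by fun_prop
  have e : R ^ 3 = R ^ 2 + |a| * R ^ 2 + |b| * R ^ 2 + |c| * R ^ 2 := by simp only [R]; ring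
  have ba := mul_le_mul_of_nonneg_right (neg_abs_le a) (by positivity : 0 ≤ R ^ 2)
  have ba' := mul_le_mul_of_nonneg_right (le_abs_self a) (by positivity : 0 ≤ R ^ 2)
  have bb := mul_le_mul_of_nonneg_right (neg_abs_le b) (by positivity : 0 ≤ R)
  have bb' := mul_le_mul_of_nonneg_right (le_abs_self b) (by positivity : 0 ≤ R)
  have b2 := mul_le_mul_of_nonneg_left hR2 hb
  have c2 := mul_le_mul_of_nonneg_left hR0 hc
  have hc1 := neg_abs_le c; have hc2 := le_abs_self c
  obtain ⟨x, -, hx⟩ := intermediate_value_Icc (by linarith : -R ≤ R) hcont.continuousOn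
    (show (0 : ℝ) ∈ Set.Icc _ _ by constructor <;> nlinarith)
  exact ⟨x, hx⟩

/-- An endomorphism of a three-dimensional real space has a real eigenvector. -/
lemma exists_eigenvector [FiniteDimensional ℝ V] (h3 : finrank ℝ V = 3) (f : End ℝ V) :
    ∃ (μ : ℝ) (w : V), w ≠ 0 ∧ f w = μ • w := by
  have hm := LinearMap.charpoly_monic f
  have hd : f.charpoly.natDegree = 3 := by rw [LinearMap.charpoly_natDegree, h3]
  obtain ⟨μ, hμ⟩ := exists_root_cubic (f.charpoly.coeff 2) (f.charpoly.coeff 1)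
    (f.charpoly.coeff 0)
  have hroot : f.charpoly.IsRoot μ := by
    have hc : f.charpoly.coeff 3 = 1 := by rw [← hd]; exact hm
    rw [Polynomial.IsRoot, Polynomial.eval_eq_sum_range, hd]
    simp only [Finset.sum_range_succ, Finset.sum_range_zero, hc]
    linarith
  obtain ⟨w, hw⟩ := ((Module.End.hasEigenvalue_iff_isRoot_charpoly f μ).mpr hroot).exists_hasEigenvector
  exact ⟨μ, w, hw.2, hw.apply_eq_smul⟩

end LinearAlgebra

/-! ### Normal forms of normal endomorphisms with vanishing trace of the squared symmetric part -/

/-- The Einstein equations for `H = 0` in a null basis of `𝔫`, for the matrix `F` of `ad_X`. -/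
structure NullEinstein (F : Matrix (Fin 3) (Fin 3) ℝ) : Prop where
  eq00 : F 0 0 * F 2 0 + F 1 0 ^ 2 / 2 - F 2 0 * F 2 2 - F 2 1 ^ 2 / 2 = 0
  eq01 : F 0 0 * F 2 1 + F 0 1 * F 2 0 + F 1 0 * F 1 1 - F 1 0 * F 2 2 - F 1 1 * F 2 1
    - F 1 2 * F 2 0 = 0
  eq02 : F 1 0 * F 1 2 - F 0 1 * F 2 1 = 0
  eq12 : - F 0 0 * F 1 2 - F 0 1 * F 1 1 + F 0 1 * F 2 2 - F 0 2 * F 1 0 + F 0 2 * F 2 1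
    + F 1 1 * F 1 2 = 0
  eq22 : - F 0 0 * F 0 2 - F 0 1 ^ 2 / 2 + F 0 2 * F 2 2 + F 1 2 ^ 2 / 2 = 0
  eq33 : F 0 0 ^ 2 / 2 + F 0 0 * F 2 2 + F 0 1 * F 1 0 + F 0 1 * F 2 1 + 2 * F 0 2 * F 2 0
    + F 1 0 * F 1 2 + F 1 1 ^ 2 + F 1 2 * F 2 1 + F 2 2 ^ 2 / 2 = 0

section NormalForms

variable {V : Type*} [AddCommGroup V] [Module ℝ V] {B : LinearMap.BilinForm ℝ V} {f : End ℝ V}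

/-- The bilinear form of twice the skew part of `f`. -/
def skewForm (B : LinearMap.BilinForm ℝ V) (f : End ℝ V) : LinearMap.BilinForm ℝ V :=
  B ∘ₗ f - B.compl₂ f

/-- Pairing with `e i` reads off the coordinate with reversed index in a null basis. Thus symmetry
of `f` is symmetry of its matrix about the antidiagonal. -/
lemma skewForm_null {e : Basis (Fin 3) ℝ V} (he : IsNullBasis B e) (i j : Fin 3) :
    skewForm B f (e i) (e j) = LinearMap.toMatrix e e f (Fin.rev j) i -
      LinearMap.toMatrix e e f (Fin.rev i) j := by
  have h : ∀ j, f (e j) = ∑ i, LinearMap.toMatrix e e f i j • e i := fun j => by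
    rw [← e.sum_repr (f (e j))]; simp [LinearMap.toMatrix_apply]
  generalize LinearMap.toMatrix e e f = F at *
  simp only [skewForm, LinearMap.sub_apply, LinearMap.comp_apply, LinearMap.compl₂_apply, h,
    map_sum, map_smul, LinearMap.sum_apply, LinearMap.smul_apply, he _ _]
  fin_cases i <;> fin_cases j <;> simp [Fin.sum_univ_three, gramNull, Fin.rev]

/-- `f` has matrix `A` in some Lorentzian orthonormal basis. -/
def LorentzRep (B : LinearMap.BilinForm ℝ V) (f : End ℝ V) (A : Matrix (Fin 3) (Fin 3) ℝ) : Prop :=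
  ∃ e : Basis (Fin 3) ℝ V, IsLorentzBasis B e ∧ LinearMap.toMatrix e e f = A

lemma lorentzRep_of_null {e : Basis (Fin 3) ℝ V} (he : IsNullBasis B e)
    (P A : Matrix (Fin 3) (Fin 3) ℝ) (hP : P.transpose * gramNull * P = gramLorentz)
    (hF : LinearMap.toMatrix e e f * P = P * A) : LorentzRep B f A := by
  obtain ⟨e', -, h2, h3⟩ := exists_basis_change e he gramLorentz_sq P hP
  exact ⟨e', isLorentzBasis_iff.mpr h2, h3 f _ A rfl hF⟩

lemma matrix_eta_three (F : Matrix (Fin 3) (Fin 3) ℝ) :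
    F = !![F 0 0, F 0 1, F 0 2; F 1 0, F 1 1, F 1 2; F 2 0, F 2 1, F 2 2] :=
  Matrix.eta_fin_three F

lemma lorentzRep_zero {e : Basis (Fin 3) ℝ V} (he : IsNullBasis B e)
    (hF : LinearMap.toMatrix e e f = 0) : LorentzRep B f (matL1 0 0 0) := by
  refine lorentzRep_of_null he !![1 / 2, 1 / 2, 0; 0, 0, 1; -1, 1, 0] _ ?_ ?_
  · ext i j; fin_cases i <;> fin_cases j <;>
      simp [gramNull, gramLorentz, Matrix.mul_apply, Fin.sum_univ_three] <;> norm_num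
  · rw [hF]
    ext i j; fin_cases i <;> fin_cases j <;> simp [matL1, Matrix.mul_apply, Fin.sum_univ_three]

/-- The nonzero eigenvalues of `M₃(σ)` satisfy `λ² = -4σ`, which fixes `σ`. Negative `σ` corresponds
to an infinitesimal boost. -/
lemma lorentzRep_hyperbolic {e : Basis (Fin 3) ℝ V} (he : IsNullBasis B e) {p : ℝ} (hp : p ≠ 0)
    (hF : LinearMap.toMatrix e e f = !![p, 0, 0; 0, 0, 0; 0, 0, -p]) :
    LorentzRep B f (matM3 (-(p / 2) ^ 2)) := by
  obtain ⟨s, rfl⟩ : ∃ s, p = 2 * s := ⟨p / 2, by ring⟩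
  have hs : s ≠ 0 := by simpa using hp
  obtain ⟨i, hi⟩ : ∃ i : ℝ, s * i = 1 := ⟨s⁻¹, mul_inv_cancel₀ hs⟩
  refine lorentzRep_of_null he
    !![-(i + s) / 4, (i - s) / 4, 1 / 2; -(i - s) / 2, (i + s) / 2, 0;
      (i + s) / 2, -(i - s) / 2, 1] _ ?_ ?_
  · ext j k; fin_cases j <;> fin_cases k <;>
      simp [gramNull, gramLorentz, Matrix.mul_apply, Fin.sum_univ_three] <;>
      first | ring1 | linear_combination -hi | linear_combination hi
  · rw [hF]
    ext j k; fin_cases j <;> fin_cases k <;>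
      simp [matM3, Matrix.mul_apply, Fin.sum_univ_three] <;>
      first | ring1 | linear_combination (-1 / 2 : ℝ) * hi | linear_combination (1 / 2 : ℝ) * hi |
        linear_combination hi | linear_combination -hi |
        linear_combination (s / 2) * hi | linear_combination (-s / 2) * hi |
        linear_combination s * hi | linear_combination -s * hi

/-- Here the skew endomorphism has a timelike axis and `λ² = -y²`: a rotation, with positive `σ`. -/
lemma lorentzRep_elliptic {e : Basis (Fin 3) ℝ V} (he : IsNullBasis B e) {y : ℝ} (hy : y ≠ 0)
    (hF : LinearMap.toMatrix e e f = !![0, y / 2, 0; -y, 0, -y / 2; 0, y, 0]) :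
    LorentzRep B f (matM3 ((y / 2) ^ 2)) := by
  obtain ⟨s, rfl⟩ : ∃ s, y = 2 * s := ⟨y / 2, by ring⟩
  have hs : s ≠ 0 := by simpa using hy
  obtain ⟨i, hi⟩ : ∃ i : ℝ, s * i = 1 := ⟨s⁻¹, mul_inv_cancel₀ hs⟩
  refine lorentzRep_of_null he !![i / 2, -i / 2, 0; 0, 0, 1; -s, -s, 0] _ ?_ ?_
  · ext j k; fin_cases j <;> fin_cases k <;>
      simp [gramNull, gramLorentz, Matrix.mul_apply, Fin.sum_univ_three] <;>
      first | ring1 | linear_combination -hi | linear_combination hi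
  · rw [hF]
    ext j k; fin_cases j <;> fin_cases k <;>
      simp [matM3, Matrix.mul_apply, Fin.sum_univ_three] <;>
      first | ring1 | linear_combination hi | linear_combination -hi |
        linear_combination s * hi | linear_combination -s * hi

lemma lorentzRep_parabolic {e : Basis (Fin 3) ℝ V} (he : IsNullBasis B e) {q : ℝ} (hq : q ≠ 0)
    (hF : LinearMap.toMatrix e e f = !![0, q, 0; 0, 0, -q; 0, 0, 0]) :
    LorentzRep B f (matM3 0) := by
  obtain ⟨i, hi⟩ : ∃ i : ℝ, q * i = 1 := ⟨q⁻¹, mul_inv_cancel₀ hq⟩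
  refine lorentzRep_of_null he !![-q / 2, -q / 2, 0; 0, 0, 1; i, -i, 0] _ ?_ ?_
  · ext j k; fin_cases j <;> fin_cases k <;>
      simp [gramNull, gramLorentz, Matrix.mul_apply, Fin.sum_univ_three] <;>
      first | ring1 | linear_combination -hi | linear_combination hi
  · rw [hF]
    ext j k; fin_cases j <;> fin_cases k <;>
      simp [matM3, Matrix.mul_apply, Fin.sum_univ_three] <;>
      first | ring1 | linear_combination hi

lemma lorentzRep_matIV {e : Basis (Fin 3) ℝ V} (he : IsNullBasis B e) {q r : ℝ} (hr : r ≠ 0)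
    (hF : LinearMap.toMatrix e e f = !![0, q, r; 0, 0, -q; 0, 0, 0]) :
    ∃ ε v, (ε = 1 ∨ ε = -1) ∧ LorentzRep B f (matIV ε v) := by
  -- Rescaling the null vectors multiplies the corner entry by a positive square. Only its sign
  -- survives, and it is recorded in `ε`.
  obtain ⟨ε, hε, hεr⟩ : ∃ ε : ℝ, (ε = 1 ∨ ε = -1) ∧ 0 < -(ε * r) := by
    rcases lt_or_gt_of_ne hr with h | h
    · exact ⟨1, Or.inl rfl, by linarith⟩
    · exact ⟨-1, Or.inr rfl, by linarith⟩
  have hε2 : ε * ε = 1 := by rcases hε with rfl | rfl <;> norm_num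
  obtain ⟨b, hb0, hb⟩ : ∃ b : ℝ, b ≠ 0 ∧ -(ε * r) * (2 * b ^ 2) = 1 := by
    refine ⟨√((-(2 * (ε * r)))⁻¹), (Real.sqrt_pos.mpr (inv_pos.mpr (by linarith))).ne', ?_⟩
    rw [Real.sq_sqrt (inv_pos.mpr (by linarith)).le,
      show -(ε * r) * (2 * (-(2 * (ε * r)))⁻¹) = -(2 * (ε * r)) * (-(2 * (ε * r)))⁻¹ by ring]
    exact mul_inv_cancel₀ (by linarith)
  -- `a = -ε r b` satisfies `2 a b = 1`
  have hab : 2 * (-(ε * r) * b) * b = 1 := by linear_combination hb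
  refine ⟨ε, b * q, hε, lorentzRep_of_null he
    !![-(ε * r) * b, ε * r * b, 0; 0, 0, 1; -b, -b, 0] _ ?_ ?_⟩
  · ext j k; fin_cases j <;> fin_cases k <;>
      simp [gramNull, gramLorentz, Matrix.mul_apply, Fin.sum_univ_three] <;>
      first | ring1 | linear_combination -hab | linear_combination hab
  · rw [hF]
    ext j k; fin_cases j <;> fin_cases k <;>
      simp [matIV, Matrix.mul_apply, Fin.sum_univ_three] <;>
      first | ring1 | linear_combination (r * b) * hε2 | linear_combination -(r * b) * hε2 |
        linear_combination q * hab | linear_combination -q * hab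

/-- The change of null basis which kills the `(u, v)`-entry, followed by a rescaling. -/
lemma exists_nullBasis_upper {e : Basis (Fin 3) ℝ V} (he : IsNullBasis B e) {q r t s : ℝ}
    (hs : s ≠ 0) (hqt : q + t = 2 * s)
    (hF : LinearMap.toMatrix e e f = !![0, q, r; 0, 0, t; 0, 0, 0]) :
    ∃ e' : Basis (Fin 3) ℝ V, IsNullBasis B e' ∧ e' 0 = s • e 0 ∧
      (∃ c : ℝ, e' 1 = e 1 + c • e 0) ∧ (∃ c d : ℝ, e' 2 = s⁻¹ • e 2 + c • e 1 + d • e 0) ∧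
      LinearMap.toMatrix e' e' f = !![0, q / s, 0; 0, 0, t / s; 0, 0, 0] := by
  obtain ⟨i, hi⟩ : ∃ i : ℝ, s * i = 1 := ⟨s⁻¹, mul_inv_cancel₀ hs⟩
  have hinv : s⁻¹ = i := (eq_inv_of_mul_eq_one_right hi).symm
  -- The null rotation with parameter `c` changes the corner entry by `-c(q + t) = -2cs`.
  obtain ⟨c, hc⟩ : ∃ c : ℝ, c * (2 * s) = r := ⟨r * i / 2, by linear_combination r * hi⟩
  obtain ⟨e', h1, h2, h3⟩ := exists_basis_change e he gramNull_sq
    !![s, c, -(c ^ 2 / 2) * i; 0, 1, -c * i; 0, 0, i] (by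
      ext j k; fin_cases j <;> fin_cases k <;>
      simp [gramNull, Matrix.mul_apply, Fin.sum_univ_three] <;>
      first | ring1 | linear_combination hi)
  refine ⟨e', h2, ?_, ⟨c, ?_⟩, ⟨-c * i, -(c ^ 2 / 2) * i, ?_⟩, h3 f _ _ hF ?_⟩
  · rw [h1]; simp [Fin.sum_univ_three]
  · rw [h1]; simp [Fin.sum_univ_three]; abel
  · rw [h1, hinv]; simp [Fin.sum_univ_three]; abel
  · rw [div_eq_mul_inv q, div_eq_mul_inv t, hinv]
    ext j k; fin_cases j <;> fin_cases k <;>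
      simp [Matrix.mul_apply, Fin.sum_univ_three] <;>
      first | ring1 | linear_combination -q * hi |
        linear_combination -c * i * hqt - i * hc

/-- The Lorentzian basis defining `L₃(0)` and its deformation, from a null basis. -/
lemma lorentzRep_matVI {e : Basis (Fin 3) ℝ V} (he : IsNullBasis B e) (a : ℝ)
    (hF : LinearMap.toMatrix e e f = !![0, 1 + a ^ 2 / 2, 0; 0, 0, 1 - a ^ 2 / 2; 0, 0, 0]) :
    ∃ e' : Basis (Fin 3) ℝ V, IsLorentzBasis B e' ∧
      e' 0 = (1 / √2) • (e 2 - e 0) ∧ e' 1 = e 1 ∧ e' 2 = (1 / √2) • (e 2 + e 0) ∧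
      LinearMap.toMatrix e' e' f = matVI a := by
  obtain ⟨k, hk⟩ : ∃ k : ℝ, k = 1 / √2 := ⟨_, rfl⟩
  have hk2 : k ^ 2 * 2 = 1 := by
    rw [hk, div_pow, Real.sq_sqrt (by norm_num)]; norm_num
  obtain ⟨e', h1, h2, h3⟩ := exists_basis_change e he gramLorentz_sq
    !![-k, 0, k; 0, 1, 0; k, 0, k] (by
      ext j l; fin_cases j <;> fin_cases l <;>
      simp [gramNull, gramLorentz, Matrix.mul_apply, Fin.sum_univ_three] <;>
      first | ring1 | linear_combination hk2 | linear_combination -hk2)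
  refine ⟨e', isLorentzBasis_iff.mpr h2, ?_, ?_, ?_, h3 f _ _ hF ?_⟩
  · rw [h1, ← hk]; simp [Fin.sum_univ_three]; module
  · rw [h1]; simp [Fin.sum_univ_three]
  · rw [h1, ← hk]; simp [Fin.sum_univ_three]; module
  · rw [matVI, ← hk]
    ext j l; fin_cases j <;> fin_cases l <;>
      simp [Matrix.mul_apply, Fin.sum_univ_three] <;>
      first | ring1 | linear_combination -(1 + a ^ 2 / 2) * hk2

lemma matVI_zero : matVI 0 = matL3 := by
  ext j l; fin_cases j <;> fin_cases l <;> simp [matVI, matL3]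

/-- On the timelike plane the eigenvalues are `α ± iβ` with `β² = -xy`. A boost equalises the
off-diagonal entries up to sign, and the time orientation `δ` makes the lower one equal to `β`. -/
lemma lorentzRep_matL1 {e : Basis (Fin 3) ℝ V} (he : IsNullBasis B e) {α a x y : ℝ}
    (hxy : x * y < 0) (h : 2 * α ^ 2 + 2 * (x * y) + a ^ 2 = 0)
    (hF : LinearMap.toMatrix e e f = !![α, 0, x; 0, a, 0; y, 0, α]) :
    LorentzRep B f (matL1 α (√(α ^ 2 + a ^ 2 / 2)) a) := by
  have hy : y ≠ 0 := by rintro rfl; simp at hxy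
  obtain ⟨δ, hδ, hδy⟩ : ∃ δ : ℝ, δ * δ = 1 ∧ 0 < δ * y := by
    rcases lt_or_gt_of_ne hy with h | h
    · exact ⟨-1, by norm_num, by linarith⟩
    · exact ⟨1, by norm_num, by linarith⟩
  set β := √(α ^ 2 + a ^ 2 / 2) with hβ
  have hβ2 : β ^ 2 = -(x * y) := by rw [hβ, Real.sq_sqrt (by positivity)]; linarith
  have hβ0 : 0 < β := Real.sqrt_pos.mpr (by linarith)
  -- `2 m² y = δ β` and `2 m n = 1`
  obtain ⟨m, hm0, hm⟩ : ∃ m : ℝ, m ≠ 0 ∧ 2 * m ^ 2 * y = δ * β := by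
    refine ⟨√(β / (2 * (δ * y))), (Real.sqrt_pos.mpr (by positivity)).ne', ?_⟩
    rw [Real.sq_sqrt (by positivity)]
    have : δ ≠ 0 := by rintro rfl; simp at hδ
    field_simp
    linear_combination -hδ
  obtain ⟨n, hn⟩ : ∃ n : ℝ, 2 * m * n = 1 := ⟨(2 * m)⁻¹, mul_inv_cancel₀ (by simpa using hm0)⟩
  have hmy : m * y = δ * β * n := by linear_combination n * hm - m * y * hn
  have hnx : n * x = -(δ * β * m) := by
    have : (n * x) * (m * y) = -(δ * β * m) * (m * y) := by
      rw [show (n * x) * (m * y) = (x * y) * (m * n) by ring,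
        show -(δ * β * m) * (m * y) = -(δ * β) * (2 * m ^ 2 * y) / 2 by ring, hm]
      linear_combination (x * y / 2) * hn + (1 / 2) * hβ2 * δ * δ - (x * y / 2) * hδ
    exact mul_right_cancel₀ (mul_ne_zero hm0 hy) this
  refine lorentzRep_of_null he !![δ * m, m, 0; 0, 0, 1; -(δ * n), n, 0] _ ?_ ?_
  · ext j k; fin_cases j <;> fin_cases k <;>
      simp [gramNull, gramLorentz, Matrix.mul_apply, Fin.sum_univ_three] <;>
      first | ring1 | linear_combination -hδ - δ ^ 2 * hn | linear_combination hn
  · rw [hF]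
    ext j k; fin_cases j <;> fin_cases k <;>
      simp [matL1, Matrix.mul_apply, Fin.sum_univ_three] <;>
      first | ring1 |
        linear_combination -δ * hnx + m * β * hδ |
        linear_combination hnx |
        linear_combination δ * hmy + n * β * hδ |
        linear_combination hmy

end NormalForms

/-! ### Exhaustiveness of the Lorentzian normal forms -/

section NormalForms

variable {V : Type*} [AddCommGroup V] [Module ℝ V] {B : LinearMap.BilinForm ℝ V} {f : End ℝ V}

/-- The disjunction of the Lorentzian normal forms with vanishing three-form. -/
def IsLorentzNormal (B : LinearMap.BilinForm ℝ V) (f : End ℝ V) : Prop :=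
  (∃ σ, LorentzRep B f (matM3 σ)) ∨
  (∃ α a, LorentzRep B f (matL1 α (√(α ^ 2 + a ^ 2 / 2)) a)) ∨
  (∃ ε v, (ε = 1 ∨ ε = -1) ∧ LorentzRep B f (matIV ε v)) ∨ LorentzRep B f matL3

lemma isLorentzNormal_of_zero {e : Basis (Fin 3) ℝ V} (he : IsNullBasis B e)
    (h : LinearMap.toMatrix e e f = 0) : IsLorentzNormal B f :=
  Or.inr (Or.inl ⟨0, 0, by simpa using lorentzRep_zero he h⟩)

lemma isLorentzNormal_of_corner {e : Basis (Fin 3) ℝ V} (he : IsNullBasis B e) {r : ℝ}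
    (h : LinearMap.toMatrix e e f = !![0, 0, r; 0, 0, 0; 0, 0, 0]) : IsLorentzNormal B f := by
  by_cases hr : r = 0
  · refine isLorentzNormal_of_zero he (h.trans ?_)
    rw [hr]; ext i j; fin_cases i <;> fin_cases j <;> rfl
  · exact Or.inr (Or.inr (Or.inl (lorentzRep_matIV (q := 0) he hr (by simpa using h))))

lemma IsNullBasis.swap {e : Basis (Fin 3) ℝ V} (he : IsNullBasis B e) {y : ℝ}
    (h : LinearMap.toMatrix e e f = !![0, 0, 0; 0, 0, 0; y, 0, 0]) :
    ∃ e' : Basis (Fin 3) ℝ V, IsNullBasis B e' ∧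
      LinearMap.toMatrix e' e' f = !![0, 0, y; 0, 0, 0; 0, 0, 0] := by
  obtain ⟨e', -, h2, h3⟩ := exists_basis_change e he gramNull_sq gramNull (by
    ext i j; fin_cases i <;> fin_cases j <;> simp [gramNull, Matrix.mul_apply, Fin.sum_univ_three])
  refine ⟨e', h2, h3 f _ _ h ?_⟩
  ext i j; fin_cases i <;> fin_cases j <;> simp [gramNull, Matrix.mul_apply, Fin.sum_univ_three]

/-- The matrix entries of the eigenvector equation. -/
lemma toMatrix_eigenvector {e : Basis (Fin 3) ℝ V} {a b c μ : ℝ}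
    (h : f (a • e 0 + b • e 1 + c • e 2) = μ • (a • e 0 + b • e 1 + c • e 2)) (i : Fin 3) :
    LinearMap.toMatrix e e f i 0 * a + LinearMap.toMatrix e e f i 1 * b +
      LinearMap.toMatrix e e f i 2 * c = μ * ![a, b, c] i := by
  have := congrArg (fun x => e.repr x i) h
  simp only [map_add, map_smul, Finsupp.add_apply, Finsupp.smul_apply, smul_eq_mul,
    ← LinearMap.toMatrix_apply e e f] at this
  have e2 : μ * (a * e.repr (e 0) i + b * e.repr (e 1) i + c * e.repr (e 2) i) =
      μ * ![a, b, c] i := by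
    fin_cases i <;> simp
  linarith

lemma eq_zero_of_sq_add_eq_zero {a b : ℝ} (hb : 0 ≤ b) (h : a ^ 2 + b = 0) : a = 0 := by
  have : a ^ 2 = 0 := by linarith [sq_nonneg a]
  simpa using this

/-- With vanishing skew part only `tr(f²) = 0` is left. A timelike eigenvector makes `f`
diagonalisable, hence zero. A null one makes it nilpotent. A spacelike one leaves a block on a
Lorentzian plane, whose complex eigenvalues give `L₁`. -/
lemma isLorentzNormal_of_symmetric [FiniteDimensional ℝ V] (h3 : finrank ℝ V = 3)
    {e₀ : Basis (Fin 3) ℝ V} (he₀ : IsLorentzBasis B e₀)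
    (hf : ∀ e : Basis (Fin 3) ℝ V, IsNullBasis B e → NullEinstein (LinearMap.toMatrix e e f))
    (hsk : skewForm B f = 0) : IsLorentzNormal B f := by
  obtain ⟨μ, w, hw, hfw⟩ := exists_eigenvector h3 f
  obtain ⟨e, he, htype⟩ := exists_nullBasis_adapted e₀ he₀ w hw
  have k10 := skewForm_null (f := f) he 0 1
  have k20 := skewForm_null (f := f) he 0 2
  have k21 := skewForm_null (f := f) he 1 2
  simp [hsk, Fin.rev] at k10 k20 k21
  have hev : ∀ a b c : ℝ, w = a • e 0 + b • e 1 + c • e 2 → ∀ i,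
      LinearMap.toMatrix e e f i 0 * a + LinearMap.toMatrix e e f i 1 * b +
      LinearMap.toMatrix e e f i 2 * c = μ * ![a, b, c] i := fun a b c h =>
    toMatrix_eigenvector (by rw [← h, hfw])
  obtain ⟨F, hF⟩ : ∃ F, LinearMap.toMatrix e e f = F := ⟨_, rfl⟩
  have E := (hf e he).eq33
  rw [hF] at k10 k20 k21 hev E
  have heta := hF.trans (matrix_eta_three F)
  clear hF hf
  have h10 : F 1 0 = F 2 1 := by linarith
  have h22 : F 2 2 = F 0 0 := by linarith
  have h12 : F 1 2 = F 0 1 := by linarith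
  rw [h10, h22, h12] at E heta
  rcases htype with ⟨c, hc, hwc⟩ | ⟨c, hc, hwc⟩ | hwc
  · have hv := hev 0 c 0 (by simp [hwc])
    have v0 := hv 0
    have v2 := hv 2
    simp [hc] at v0 v2
    rw [v0, v2] at E heta
    generalize F 0 0 = α at *
    generalize F 1 1 = a at *
    generalize F 0 2 = x at *
    generalize F 2 0 = y at *
    -- If `xy ≥ 0`, the trace equation is a sum of nonnegative terms, so at most one null corner
    -- entry remains.
    by_cases hxy : x * y < 0
    · exact Or.inr (Or.inl ⟨α, a, lorentzRep_matL1 he hxy (by linarith) heta⟩)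
    · have hxy' := not_lt.mp hxy
      have hα : α = 0 := eq_zero_of_sq_add_eq_zero (b := x * y + a ^ 2 / 2)
        (by positivity) (by linear_combination E / 2)
      have ha : a = 0 := eq_zero_of_sq_add_eq_zero (b := 2 * (x * y) + 2 * α ^ 2)
        (by positivity) (by linear_combination E)
      rw [hα, ha] at heta
      have hxy0 : x * y = 0 := by rw [hα, ha] at E; linarith
      rcases mul_eq_zero.mp hxy0 with h | h
      · rw [h] at heta
        obtain ⟨e', he', h'⟩ := he.swap heta
        exact isLorentzNormal_of_corner he' h'
      · rw [h] at heta
        exact isLorentzNormal_of_corner he heta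
  · have hv := hev c 0 (-(2 * c)) (by rw [hwc]; module)
    have v0 := hv 0
    have v1 := hv 1
    have v2 := hv 2
    simp only [Matrix.cons_val, h10, h22, h12] at v0 v1 v2
    generalize F 0 0 = p at *
    generalize F 0 1 = q at *
    generalize F 0 2 = r at *
    generalize F 1 1 = m at *
    generalize F 2 0 = x at *
    generalize F 2 1 = y at *
    have hμ : μ = p - 2 * r := mul_left_cancel₀ hc (by linear_combination -v0)
    have hy : y = 2 * q := mul_left_cancel₀ hc (by linear_combination v1)
    have hx : x = 4 * r := mul_left_cancel₀ hc (by linear_combination v2 - 2 * c * hμ)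
    rw [hy, hx] at E heta
    have hm : m = 0 := eq_zero_of_sq_add_eq_zero (b := 2 * p ^ 2 + 8 * q ^ 2 + 8 * r ^ 2)
      (by positivity) (by linear_combination E)
    have hp : p = 0 := eq_zero_of_sq_add_eq_zero (b := m ^ 2 / 2 + 4 * q ^ 2 + 4 * r ^ 2)
      (by positivity) (by linear_combination E / 2)
    have hq : q = 0 := eq_zero_of_sq_add_eq_zero (b := m ^ 2 / 8 + p ^ 2 / 4 + r ^ 2)
      (by positivity) (by linear_combination E / 8)
    have hr : r = 0 := eq_zero_of_sq_add_eq_zero (b := m ^ 2 / 8 + p ^ 2 / 4 + q ^ 2)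
      (by positivity) (by linear_combination E / 8)
    rw [hp, hq, hr, hm] at heta
    exact isLorentzNormal_of_corner he (by simpa using heta)
  · have hv := hev 1 0 0 (by simp [hwc])
    have v1 := hv 1
    have v2 := hv 2
    simp [h10] at v1 v2
    rw [v1, v2] at E heta
    generalize F 0 0 = p at *
    generalize F 0 1 = q at *
    generalize F 0 2 = r at *
    generalize F 1 1 = m at *
    have hp : p = 0 := eq_zero_of_sq_add_eq_zero (b := m ^ 2 / 2)
      (by positivity) (by linear_combination E / 2)
    have hm : m = 0 := eq_zero_of_sq_add_eq_zero (b := 2 * p ^ 2)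
      (by positivity) (by linear_combination E)
    rw [hp, hm] at heta
    by_cases hq : q = 0
    · rw [hq] at heta
      exact isLorentzNormal_of_corner he heta
    · obtain ⟨e', he', -, -, -, h'⟩ := exists_nullBasis_upper he hq (by ring : q + q = 2 * q) heta
      rw [div_self hq] at h'
      obtain ⟨e'', he'', -, -, -, h''⟩ := lorentzRep_matVI he' 0 (by simpa using h')
      exact Or.inr (Or.inr (Or.inr ⟨e'', he'', h''.trans matVI_zero⟩))

/-- The symmetric part commutes with the skew part and so respects its axis. For a non-null axis the
trace condition kills the symmetric part. For a null axis one corner entry can survive, which gives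
the family (iv). -/
lemma isLorentzNormal_of_not_symmetric
    {e₀ : Basis (Fin 3) ℝ V} (he₀ : IsLorentzBasis B e₀)
    (hf : ∀ e : Basis (Fin 3) ℝ V, IsNullBasis B e → NullEinstein (LinearMap.toMatrix e e f))
    (hsk : skewForm B f ≠ 0) : IsLorentzNormal B f := by
  -- the axis of the skew part of `f`
  obtain ⟨w, hw, hker⟩ : ∃ w : V, w ≠ 0 ∧ skewForm B f w = 0 := by
    obtain ⟨e, he, -⟩ := exists_nullBasis_adapted e₀ he₀ (e₀ 0) (e₀.ne_zero 0)
    have k := skewForm_null (f := f) he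
    set F := LinearMap.toMatrix e e f
    -- The coordinates of the axis are the components `(Ω₁₂, Ω₂₀, Ω₀₁)` of the alternating form `Ω`,
    -- as for a cross product.
    refine ⟨(F 0 1 - F 1 2) • e 0 + (F 2 2 - F 0 0) • e 1 + (F 1 0 - F 2 1) • e 2, fun h0 => hsk ?_,
      e.ext fun j => ?_⟩
    · have h := fun i => congrArg (fun x => e.repr x i) h0
      have h0 := h 0
      have h1 := h 1
      have h2 := h 2
      simp at h0 h1 h2
      refine e.ext fun i => e.ext fun j => ?_
      rw [k]
      fin_cases i <;> fin_cases j <;> simp [Fin.rev] <;> linarith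
    · simp only [map_add, map_smul, LinearMap.add_apply, LinearMap.smul_apply, k, smul_eq_mul]
      fin_cases j <;> simp [Fin.rev] <;> ring
  obtain ⟨e, he, htype⟩ := exists_nullBasis_adapted e₀ he₀ w hw
  have E := hf e he
  have k := skewForm_null (f := f) he
  obtain ⟨F, hF⟩ : ∃ F, LinearMap.toMatrix e e f = F := ⟨_, rfl⟩
  rw [hF] at E
  simp only [hF] at k
  have heta := hF.trans (matrix_eta_three F)
  clear hF hf
  obtain ⟨E00, E01, E02, E12, E22, E33⟩ := E
  have hne : ¬ (F 1 0 = F 2 1 ∧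
      F 0 0 = F 2 2 ∧
      F 0 1 = F 1 2) := by
    rintro ⟨h1, h2, h3⟩
    refine hsk (e.ext fun i => e.ext fun j => ?_)
    rw [k]
    fin_cases i <;> fin_cases j <;> simp [Fin.rev] <;> linarith
  have hker' : ∀ a b c : ℝ, w = a • e 0 + b • e 1 + c • e 2 → ∀ j,
      a * skewForm B f (e 0) (e j) + b * skewForm B f (e 1) (e j) +
        c * skewForm B f (e 2) (e j) = 0 := fun a b c h j => by
    have := LinearMap.congr_fun hker (e j)
    rw [h] at this
    simpa using this
  simp only [k] at hker'
  rcases htype with ⟨c, hc, hwc⟩ | ⟨c, hc, hwc⟩ | hwc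
  · have hv := hker' 0 c 0 (by simp [hwc])
    have v0 := hv 0
    have v2 := hv 2
    simp [Fin.rev, hc] at v0 v2
    clear k hker hker' hv
    generalize F 0 0 = f00 at *
    generalize F 0 1 = f01 at *
    generalize F 0 2 = f02 at *
    generalize F 1 0 = f10 at *
    generalize F 1 1 = f11 at *
    generalize F 1 2 = f12 at *
    generalize F 2 0 = f20 at *
    generalize F 2 1 = f21 at *
    generalize F 2 2 = f22 at *
    have h21 : f21 = f10 := by linarith
    have h12 : f12 = f01 := by linarith
    simp only [h21, h12] at E00 E01 E12 E22 E33 hne heta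
    -- The boost rate of the skew part; every commutation equation can be divided by it.
    have hp : f00 - f22 ≠ 0 := fun h => hne ⟨trivial, by linarith, trivial⟩
    have h20 : f20 = 0 := mul_left_cancel₀ hp (by linear_combination E00)
    have h02 : f02 = 0 := mul_left_cancel₀ hp (by linear_combination -E22)
    simp only [h20, h02] at E01 E12 E33 heta
    have h10 : f10 = 0 := mul_left_cancel₀ hp (by linear_combination E01)
    have h01 : f01 = 0 := mul_left_cancel₀ hp (by linear_combination -E12)
    simp only [h10, h01] at E33 heta
    have h11 : f11 = 0 := eq_zero_of_sq_add_eq_zero (b := (f00 + f22) ^ 2 / 2)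
      (by positivity) (by linear_combination E33)
    have h22 : f22 = - f00 := by
      have : f00 + f22 = 0 := eq_zero_of_sq_add_eq_zero (b := 2 * f11 ^ 2)
        (by positivity) (by linear_combination 2 * E33)
      linarith
    rw [h11, h22] at heta
    have h00 : f00 ≠ 0 := fun h => hp (by rw [h22, h]; ring)
    exact Or.inl ⟨_, lorentzRep_hyperbolic he h00 heta⟩
  · have hv := hker' c 0 (-(2 * c)) (by rw [hwc]; module)
    have v0 := hv 0
    have v1 := hv 1
    simp [Fin.rev, hc] at v0 v1
    clear k hker hker' hv
    generalize F 0 0 = f00 at *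
    generalize F 0 1 = f01 at *
    generalize F 0 2 = f02 at *
    generalize F 1 0 = f10 at *
    generalize F 1 1 = f11 at *
    generalize F 1 2 = f12 at *
    generalize F 2 0 = f20 at *
    generalize F 2 1 = f21 at *
    generalize F 2 2 = f22 at *
    have h22 : f22 = f00 := by
      linarith
    have h21 : f21 = f10 + 2 * (f01 - f12) := mul_left_cancel₀ hc (by linarith)
    obtain ⟨y, hy⟩ : ∃ y, y = f01 - f12 := ⟨_, rfl⟩
    have h12 : f12 = f01 - y := by linarith
    -- The skew part is proportional to `y`. Nonvanishing of `y` turns the commutation equations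
    -- into linear ones.
    have hy0 : y ≠ 0 := by
      rintro rfl
      exact hne ⟨by linarith, h22.symm, by linarith⟩
    rw [← hy] at h21
    simp only [h21, h22, h12] at E00 E01 E12 E22 E33 heta
    have h10 : f10 = - y := mul_left_cancel₀ hy0 (by linear_combination -E00 / 2)
    have h01 : f01 = y / 2 := mul_left_cancel₀ hy0 (by linear_combination -E22)
    simp only [h10, h01] at E01 E12 E33 heta
    have h20 : f20 = 2 * (f11 - f00) := mul_left_cancel₀ hy0 (by linear_combination E01)
    have h02 : f02 = (f11 - f00) / 2 := mul_left_cancel₀ hy0 (by linear_combination E12 / 2)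
    simp only [h20, h02] at E33 heta
    have h00 : f00 = 0 := eq_zero_of_sq_add_eq_zero (b := f11 ^ 2 / 2 + (f11 - f00) ^ 2)
      (by positivity) (by linear_combination E33 / 2)
    have h11 : f11 = 0 := eq_zero_of_sq_add_eq_zero (b := 2 * f00 ^ 2 + 2 * (f11 - f00) ^ 2)
      (by positivity) (by linear_combination E33)
    rw [h00, h11] at heta
    refine Or.inl ⟨_, lorentzRep_elliptic he hy0 (heta.trans ?_)⟩
    ext i j; fin_cases i <;> fin_cases j <;> simp <;> ring
  · have hv := hker' 1 0 0 (by simp [hwc])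
    have v1 := hv 1
    have v2 := hv 2
    simp [Fin.rev] at v1 v2
    clear k hker hker' hv
    generalize F 0 0 = f00 at *
    generalize F 0 1 = f01 at *
    generalize F 0 2 = f02 at *
    generalize F 1 0 = f10 at *
    generalize F 1 1 = f11 at *
    generalize F 1 2 = f12 at *
    generalize F 2 0 = f20 at *
    generalize F 2 1 = f21 at *
    generalize F 2 2 = f22 at *
    have h21 : f21 = f10 := by linarith
    have h22 : f22 = f00 := by linarith
    obtain ⟨y, hy⟩ : ∃ y, y = f01 - f12 := ⟨_, rfl⟩
    have h12 : f12 = f01 - y := by linarith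
    have hy0 : y ≠ 0 := by
      rintro rfl
      exact hne ⟨by linarith, h22.symm, by linarith⟩
    simp only [h21, h22, h12] at E01 E02 E12 E22 E33 heta
    have h20 : f20 = 0 := mul_left_cancel₀ hy0 (by linear_combination E01)
    have h10 : f10 = 0 := mul_left_cancel₀ hy0 (by linear_combination -E02)
    simp only [h20, h10] at E12 E33 heta
    have h11 : f11 = f00 := mul_left_cancel₀ hy0 (by linear_combination -E12)
    have h01 : f01 = y / 2 := mul_left_cancel₀ hy0 (by linear_combination -E22)
    simp only [h11, h01] at E33 heta
    have h00 : f00 = 0 := eq_zero_of_sq_add_eq_zero le_rfl (by linear_combination E33 / 3)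
    have hq : y / 2 ≠ 0 := by simpa using hy0
    rw [h00, show y / 2 - y = -(y / 2) by ring] at heta
    -- The corner entry is all that remains of the symmetric part.
    by_cases hr : f02 = 0
    · rw [hr] at heta
      exact Or.inl ⟨0, lorentzRep_parabolic he hq heta⟩
    · exact Or.inr (Or.inr (Or.inl (lorentzRep_matIV he hr heta)))

/-- The normal forms of Lorentzian endomorphisms whose symmetric and skew parts commute and whose
symmetric part has square of trace zero. -/
lemma isLorentzNormal_of_nullEinstein (hB : ∃ e : Basis (Fin 3) ℝ V, IsLorentzBasis B e)
    (hf : ∀ e : Basis (Fin 3) ℝ V, IsNullBasis B e → NullEinstein (LinearMap.toMatrix e e f)) :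
    IsLorentzNormal B f := by
  obtain ⟨e₀, he₀⟩ := hB
  have : FiniteDimensional ℝ V := Module.Finite.of_basis e₀
  by_cases hsk : skewForm B f = 0
  · exact isLorentzNormal_of_symmetric (by rw [finrank_eq_card_basis e₀]; simp) he₀ hf hsk
  · exact isLorentzNormal_of_not_symmetric he₀ hf hsk

end NormalForms

/-! ### The Einstein equations in frames adapted to the ideal -/

section Frames

variable {𝔤 : Type*} [LieRing 𝔤] [LieAlgebra ℝ 𝔤] [FiniteDimensional ℝ 𝔤] {M : GenMetric 𝔤}
  {n : LieIdeal ℝ 𝔤} {X : 𝔤} {e : Basis (Fin 3) ℝ n} {E : Basis (Fin 4) ℝ 𝔤}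

/-- The matrix of the components `H(e_i, e_j, e_k)` in terms of four independent ones. -/
abbrev formComponents (M : GenMetric 𝔤) (E : Basis (Fin 4) ℝ 𝔤) : Fin 4 → Fin 4 → Fin 4 → ℝ :=
  formTable (M.H ![E 0, E 1, E 2]) (M.H ![E 0, E 1, E 3]) (M.H ![E 0, E 2, E 3])
    (M.H ![E 1, E 2, E 3])

omit [FiniteDimensional ℝ 𝔤] in
lemma gram_extend (hE : ∀ i : Fin 3, E i.castSucc = (e i : 𝔤)) (hX : E 3 = X)
    {G : Matrix (Fin 3) (Fin 3) ℝ} (hG : ∀ i j, M.gOn n (e i) (e j) = G i j) {k : Fin 3 → ℝ}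
    (hk : ∀ j, M.g X (e j) = k j) {c : ℝ} (hc : M.g X X = c) (i j : Fin 4) :
    M.g (E i) (E j) = !![G 0 0, G 0 1, G 0 2, k 0; G 1 0, G 1 1, G 1 2, k 1;
      G 2 0, G 2 1, G 2 2, k 2; k 0, k 1, k 2, c] i j := by
  have h0 : E 0 = (e 0 : 𝔤) := hE 0
  have h1 : E 1 = (e 1 : 𝔤) := hE 1
  have h2 : E 2 = (e 2 : 𝔤) := hE 2
  have hG' : ∀ i j, M.g (e i) (e j) = G i j := hG
  have hk' : ∀ j, M.g (e j) X = k j := fun j => by rw [M.symm, hk]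
  fin_cases i <;> fin_cases j <;> simp [h0, h1, h2, hX, hG', hk, hk', hc]

variable (hab : IsLieAbelian n) (hE : ∀ i : Fin 3, E i.castSucc = (e i : 𝔤)) (hX : E 3 = X)
  {F : Matrix (Fin 3) (Fin 3) ℝ} (hF : HasMatrix n X e F)

include hab hE hX hF

lemma isGenEinstein_iff_lorentz (he : IsLorentzBasis (M.gOn n) e) (hk : ∀ j, M.g X (e j) = 0)
    (hc : M.g X X = 1) :
    M.IsGenEinstein 0 ↔ ∀ a b, frameRicci ![0, 1, 2, 3] ![-1, 1, 1, 1] (bracketTable F)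
      (formComponents M E) a b = 0 := by
  have hg := gram_extend hE hX (isLorentzBasis_iff.mp he) hk hc
  refine M.isGenEinstein_iff_frameRicci E _ _ _ _ ?_ ?_ ?_ (fun i j => ?_)
    (lie_eq_bracketTable hab e E hE hX hF) (form_eq_formTable M.H E)
  · intro i; fin_cases i <;> rfl
  · intro i; fin_cases i <;> simp
  · intro i; fin_cases i <;> simp
  · rw [hg]; fin_cases i <;> fin_cases j <;> simp [gramLorentz]

lemma isGenEinstein_iff_null (he : IsNullBasis (M.gOn n) e) (hk : ∀ j, M.g X (e j) = 0)
    (hc : M.g X X = 1) :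
    M.IsGenEinstein 0 ↔ ∀ a b, frameRicci ![2, 1, 0, 3] ![1, 1, 1, 1] (bracketTable F)
      (formComponents M E) a b = 0 := by
  have hg := gram_extend hE hX he hk hc
  refine M.isGenEinstein_iff_frameRicci E _ _ _ _ ?_ ?_ ?_ (fun i j => ?_)
    (lie_eq_bracketTable hab e E hE hX hF) (form_eq_formTable M.H E)
  · intro i; fin_cases i <;> rfl
  · intro i; fin_cases i <;> simp
  · intro i; fin_cases i <;> simp
  · rw [hg]; fin_cases i <;> fin_cases j <;> simp [gramNull]

lemma isGenEinstein_iff_euclid (he : IsEuclidBasis (M.gOn n) e) (hk : ∀ j, M.g X (e j) = 0)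
    (hc : M.g X X = -1) :
    M.IsGenEinstein 0 ↔ ∀ a b, frameRicci ![0, 1, 2, 3] ![1, 1, 1, -1] (bracketTable F)
      (formComponents M E) a b = 0 := by
  have hg := gram_extend hE hX (G := 1) (fun i j => by rw [he, Matrix.one_apply]) hk hc
  refine M.isGenEinstein_iff_frameRicci E _ _ _ _ ?_ ?_ ?_ (fun i j => ?_)
    (lie_eq_bracketTable hab e E hE hX hF) (form_eq_formTable M.H E)
  · intro i; fin_cases i <;> rfl
  · intro i; fin_cases i <;> simp
  · intro i; fin_cases i <;> simp
  · rw [hg]; fin_cases i <;> fin_cases j <;> simp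

lemma isGenEinstein_iff_degenerate
    (he : ∀ i j, M.gOn n (e i) (e j) = !![(1 : ℝ), 0, 0; 0, 1, 0; 0, 0, 0] i j)
    (hk : ∀ j, M.g X (e j) = ![0, 0, 1] j) (hc : M.g X X = 0) :
    M.IsGenEinstein 0 ↔ ∀ a b, frameRicci ![0, 1, 3, 2] ![1, 1, 1, 1] (bracketTable F)
      (formComponents M E) a b = 0 := by
  have hg := gram_extend hE hX he hk hc
  refine M.isGenEinstein_iff_frameRicci E _ _ _ _ ?_ ?_ ?_ (fun i j => ?_)
    (lie_eq_bracketTable hab e E hE hX hF) (form_eq_formTable M.H E)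
  · intro i; fin_cases i <;> rfl
  · intro i; fin_cases i <;> simp
  · intro i; fin_cases i <;> simp
  · rw [hg]; fin_cases i <;> fin_cases j <;> simp

end Frames

/-! ### Signature, unit normals and orthonormal bases of the ideal -/

section Signature

variable {V : Type*} [AddCommGroup V] [Module ℝ V] {B : LinearMap.BilinForm ℝ V}

lemma nondegenerate_of_symm (hs : ∀ x y, B x y = B y x) (h : ∀ x, (∀ y, B x y = 0) → x = 0) :
    B.Nondegenerate :=
  ⟨h, fun y hy => h y fun x => by rw [hs, hy]⟩

lemma IsLorentzianForm.nondegenerate (hs : ∀ x y, B x y = B y x) (hB : IsLorentzianForm B) :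
    B.Nondegenerate := by
  obtain ⟨m, b, hb⟩ := hB
  refine nondegenerate_of_symm hs fun x hx => b.ext_elem fun i => ?_
  have h := hx (b i)
  rw [← b.sum_repr x] at h
  simp only [map_sum, LinearMap.sum_apply, map_smul, LinearMap.smul_apply, hb _ _] at h
  simp only [smul_eq_mul, mul_ite, mul_zero, Finset.sum_ite_eq', Finset.mem_univ, if_true] at h
  split_ifs at h <;> simpa using h

lemma IsRiemannianForm.nondegenerate (hB : IsRiemannianForm B) : B.Nondegenerate :=
  nondegenerate_of_symm hB.1 fun x hx => by
    by_contra h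
    exact (hB.2 x h).ne' (hx x)

lemma IsLorentzianForm.exists_timelike (hB : IsLorentzianForm B) : ∃ x, B x x < 0 := by
  obtain ⟨m, b, hb⟩ := hB
  exact ⟨b 0, by simp [hb 0 0]⟩

end Signature

section UnitNormal

variable {𝔤 : Type*} [LieRing 𝔤] [LieAlgebra ℝ 𝔤] [FiniteDimensional ℝ 𝔤] {M : GenMetric 𝔤}
  {n : LieIdeal ℝ 𝔤} {X : 𝔤}

lemma exists_add_smul (hdim : finrank ℝ 𝔤 = 4) (hn : finrank ℝ n = 3) (hX : X ∉ n) (v : 𝔤) :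
    ∃ (y : n) (c : ℝ), v = y + c • X := by
  let e : Basis (Fin 3) ℝ n := finBasisOfFinrankEq ℝ n hn
  obtain ⟨E, hE, hE3⟩ := exists_basis_extend hdim hX e
  refine ⟨∑ i : Fin 3, E.repr v i.castSucc • e i, E.repr v 3, ?_⟩
  conv_lhs => rw [← E.sum_repr v, Fin.sum_univ_castSucc]
  have h3 : Fin.last 3 = 3 := rfl
  simp [hE, hE3, h3]

variable (hdim : finrank ℝ 𝔤 = 4) (hM : IsLorentzianForm M.g) (hn : finrank ℝ n = 3)
  (hX : X ∉ n) (hXn : ∀ Y ∈ n, M.g X Y = 0)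

include hM hXn in
omit [FiniteDimensional ℝ 𝔤] in
lemma isRiemannianForm_of_normal (hc : M.g X X = -1) : IsRiemannianForm (M.gOn n) := by
  refine ⟨fun x y => M.symm x y, fun x hx => ?_⟩
  exact pos_of_orthogonal_timelike hM (by rw [hc]; norm_num) (hXn x x.2) (by simpa using hx)

include hdim hn hM hX hXn in
-- The component of a timelike vector along a spacelike unit normal contributes a nonnegative
-- square, so its component in `n` is timelike.
lemma exists_timelike_of_normal (hc : M.g X X = 1) : ∃ y : n, M.g y y < 0 := by
  obtain ⟨t, ht⟩ := hM.exists_timelike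
  obtain ⟨y, c, rfl⟩ := exists_add_smul hdim hn hX t
  refine ⟨y, ?_⟩
  have h1 := hXn y y.2
  have h2 : M.g y X = 0 := by rw [M.symm, h1]
  simp only [map_add, map_smul, LinearMap.add_apply, LinearMap.smul_apply, h1, h2, hc,
    smul_eq_mul] at ht
  nlinarith [sq_nonneg c]

include hdim hn hM hX hXn in
lemma exists_lorentzBasis_of_normal (hc : M.g X X = 1) :
    ∃ e : Basis (Fin 3) ℝ n, IsLorentzBasis (M.gOn n) e := by
  obtain ⟨y, hy⟩ := exists_timelike_of_normal hdim hM hn hX hXn hc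
  have hs : ∀ x y, M.gOn n x y = M.gOn n y x := fun x y => M.symm x y
  obtain ⟨t, ht⟩ : ∃ t : n, M.gOn n t t = -1 := by
    refine ⟨(√(-M.g y y))⁻¹ • y, ?_⟩
    have h1 := Real.mul_self_sqrt (neg_pos.mpr hy).le
    have h2 := (Real.sqrt_pos.mpr (neg_pos.mpr hy)).ne'
    change M.g ((√(-M.g y y))⁻¹ • (y : 𝔤)) ((√(-M.g y y))⁻¹ • (y : 𝔤)) = -1
    simp only [map_smul, LinearMap.smul_apply, smul_eq_mul]
    field_simp
    linear_combination h1
  obtain ⟨a, b, ha, hb, haa, hbb, hab⟩ := exists_orthogonal_two hs hn (M.gOn n t)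
    (fun h => by rw [h] at ht; simp at ht) (fun x hx hx0 =>
      pos_of_orthogonal_timelike hM (x := t) (by
        have : M.g t t = -1 := ht
        rw [this]; norm_num) hx (by simpa using hx0))
  obtain ⟨e, he⟩ := exists_basis_of_gram (B := M.gOn n) hn ![t, a, b] gramLorentz
    (IsUnit.of_mul_eq_one gramLorentz.det (by
      rw [← Matrix.det_mul, gramLorentz_sq, Matrix.det_one])) (fun i j => by
      have h1 := hs a t; have h2 := hs b t; have h3 := hs b a
      rw [ha] at h1; rw [hb] at h2; rw [hab] at h3
      fin_cases i <;> fin_cases j <;> simp only [gramLorentz] <;>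
        first | exact ht | exact ha | exact hb | exact haa | exact hbb | exact hab | exact h1 |
          exact h2 | exact h3)
  refine ⟨e, isLorentzBasis_iff.mpr fun i j => ?_⟩
  rw [he, he]
  have h1 := hs a t; have h2 := hs b t; have h3 := hs b a
  rw [ha] at h1; rw [hb] at h2; rw [hab] at h3
  fin_cases i <;> fin_cases j <;> simp only [gramLorentz] <;>
    first | exact ht | exact ha | exact hb | exact haa | exact hbb | exact hab | exact h1 |
      exact h2 | exact h3

include hM in
omit [FiniteDimensional ℝ 𝔤] in
-- A timelike normal would leave `n` positive definite, so the sign of `g(X, X)` is forced.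
lemma normal_of_lorentzian (hXc : IsComplementary M n X) (hl : IsLorentzianForm (M.gOn n)) :
    (∀ Y ∈ n, M.g X Y = 0) ∧ M.g X X = 1 := by
  obtain ⟨h1, h2⟩ := hXc.2 (hl.nondegenerate fun x y => M.symm x y)
  refine ⟨h1, h2.resolve_right fun hc => ?_⟩
  obtain ⟨t, ht⟩ := hl.exists_timelike
  have := (isRiemannianForm_of_normal hM h1 hc).2 t (by rintro rfl; simp at ht)
  exact lt_asymm this ht

include hdim hM hn in
lemma normal_of_riemannian (hXc : IsComplementary M n X) (hl : IsRiemannianForm (M.gOn n)) :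
    (∀ Y ∈ n, M.g X Y = 0) ∧ M.g X X = -1 := by
  obtain ⟨h1, h2⟩ := hXc.2 hl.nondegenerate
  refine ⟨h1, h2.resolve_left fun hc => ?_⟩
  obtain ⟨y, hy⟩ := exists_timelike_of_normal hdim hM hn hXc.1 h1 hc
  exact lt_asymm (hl.2 y (by rintro rfl; simp at hy)) hy

end UnitNormal

/-! ### Skew endomorphisms of Euclidean three-space -/

section Riemannian

variable {𝔤 : Type*} [LieRing 𝔤] [LieAlgebra ℝ 𝔤] [FiniteDimensional ℝ 𝔤] {M : GenMetric 𝔤}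
  {n : LieIdeal ℝ 𝔤} {X : 𝔤}

/-- The matrix is the cross product with `(x, y, z)`. It becomes a rotation generator in an
orthonormal basis whose third vector is the unit axis. -/
lemma exists_rotation_normal_form {V : Type*} [AddCommGroup V] [Module ℝ V]
    {B : LinearMap.BilinForm ℝ V} {f : End ℝ V} {e : Basis (Fin 3) ℝ V} (he : IsEuclidBasis B e)
    {x y z : ℝ} (hF : LinearMap.toMatrix e e f = !![0, -z, y; z, 0, -x; -y, x, 0]) :
    ∃ (a : ℝ) (e' : Basis (Fin 3) ℝ V), IsEuclidBasis B e' ∧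
      LinearMap.toMatrix e' e' f = matL1 0 a 0 := by
  by_cases h : x ^ 2 + y ^ 2 = 0
  · have hx : x = 0 := by nlinarith [sq_nonneg x, sq_nonneg y]
    have hy : y = 0 := by nlinarith [sq_nonneg x, sq_nonneg y]
    exact ⟨z, e, he, by rw [hF]; simp [matL1, hx, hy]⟩
  obtain ⟨ρ, hρ⟩ : ∃ ρ : ℝ, ρ ^ 2 = x ^ 2 + y ^ 2 := ⟨√(x ^ 2 + y ^ 2), Real.sq_sqrt (by positivity)⟩
  obtain ⟨r, hr⟩ : ∃ r : ℝ, r ^ 2 = x ^ 2 + y ^ 2 + z ^ 2 :=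
    ⟨√(x ^ 2 + y ^ 2 + z ^ 2), Real.sq_sqrt (by positivity)⟩
  have hρ0 : ρ ≠ 0 := by rintro rfl; exact h (by linarith)
  have hr0 : r ≠ 0 := by rintro rfl; apply h; nlinarith [sq_nonneg x, sq_nonneg y, sq_nonneg z]
  obtain ⟨i, hi⟩ : ∃ i : ℝ, ρ * i = 1 := ⟨ρ⁻¹, mul_inv_cancel₀ hρ0⟩
  obtain ⟨k, hk⟩ : ∃ k : ℝ, r * k = 1 := ⟨r⁻¹, mul_inv_cancel₀ hr0⟩
  have hi2 : i ^ 2 * (x ^ 2 + y ^ 2) = 1 := by rw [← hρ]; linear_combination (ρ * i + 1) * hi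
  have hk2 : k ^ 2 * (x ^ 2 + y ^ 2 + z ^ 2) = 1 := by
    rw [← hr]; linear_combination (r * k + 1) * hk
  -- The columns are `(-y, x, 0)/ρ`, the cross product of the axis with it, and the axis `(x, y,
  -- z)/r`.
  obtain ⟨e', -, h2, h3⟩ := exists_basis_change (B := B) e (G := 1) (G' := 1)
    (fun i j => by rw [he, Matrix.one_apply]) (by simp)
    !![-y * i, -z * x * i * k, x * k; x * i, -z * y * i * k, y * k; 0, (x ^ 2 + y ^ 2) * i * k, z * k]
    (by
      ext j l
      fin_cases j <;> fin_cases l <;>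
        simp [Matrix.mul_apply, Fin.sum_univ_three] <;>
        first | ring1 | linear_combination hi2 | linear_combination hk2 |
          linear_combination k ^ 2 * (x ^ 2 + y ^ 2 + z ^ 2) * hi2 + hk2)
  refine ⟨r, e', fun i j => by rw [h2, Matrix.one_apply], h3 f _ _ hF ?_⟩
  ext j l
  fin_cases j <;> fin_cases l <;>
    simp [matL1, Matrix.mul_apply, Fin.sum_univ_three]
  all_goals first | ring1 |
    linear_combination -z * x * i * hk |
    linear_combination -z * y * i * hk |
    linear_combination -(x ^ 2 + y ^ 2) * i * hk |
    linear_combination -y * i * k * hr + y * i * r * hk |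
    linear_combination y * i * k * hr - y * i * r * hk |
    linear_combination -x * i * k * hr + x * i * r * hk |
    linear_combination x * i * k * hr - x * i * r * hk

end Riemannian

/-! ### Necessity for Riemannian and degenerate ideals -/

section Solutions

variable {𝔤 : Type*} [LieRing 𝔤] [LieAlgebra ℝ 𝔤] [FiniteDimensional ℝ 𝔤] {M : GenMetric 𝔤}
  {n : LieIdeal ℝ 𝔤} {X : 𝔤}

omit [FiniteDimensional ℝ 𝔤] in
lemma exists_hasMatrix (n : LieIdeal ℝ 𝔤) (X : 𝔤) (e : Basis (Fin 3) ℝ n) :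
    ∃ f00 f01 f02 f10 f11 f12 f20 f21 f22 : ℝ,
      HasMatrix n X e !![f00, f01, f02; f10, f11, f12; f20, f21, f22] :=
  ⟨_, _, _, _, _, _, _, _, _, matrix_eta_three _⟩

omit [FiniteDimensional ℝ 𝔤] in
lemma form_eq_zero {H : 𝔤 [⋀^Fin 3]→ₗ[ℝ] ℝ} (E : Basis (Fin 4) ℝ 𝔤)
    (h0 : H ![E 0, E 1, E 2] = 0) (h1 : H ![E 0, E 1, E 3] = 0)
    (h2 : H ![E 0, E 2, E 3] = 0) (h3 : H ![E 1, E 2, E 3] = 0) : H = 0 :=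
  form_ext E (by simpa using h0) (by simpa using h1) (by simpa using h2) (by simpa using h3)

variable (hdim : finrank ℝ 𝔤 = 4) (hM : IsLorentzianForm M.g) (hn : finrank ℝ n = 3)
  (hab : IsLieAbelian n) (hX : X ∉ n)

include hdim hM hn hab hX in
lemma exists_caseI (hXn : ∀ Y ∈ n, M.g X Y = 0) (hc : M.g X X = -1) (hGE : M.IsGenEinstein 0) :
    ∃ a, CaseI M n X a := by
  have hr := isRiemannianForm_of_normal hM hXn hc
  obtain ⟨e, he⟩ := exists_euclidBasis hn hr.1 hr.2
  obtain ⟨E, hE, hE3⟩ := exists_basis_extend hdim hX e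
  obtain ⟨f00, f01, f02, f10, f11, f12, f20, f21, f22, hF⟩ := exists_hasMatrix n X e
  rw [isGenEinstein_iff_euclid hab hE hE3 hF he (fun j => hXn _ (e j).2) hc] at hGE
  obtain ⟨h, hh⟩ : ∃ h, M.H ![E 0, E 1, E 2] = h := ⟨_, rfl⟩
  obtain ⟨b01, h01⟩ : ∃ h, M.H ![E 0, E 1, E 3] = h := ⟨_, rfl⟩
  obtain ⟨b02, h02⟩ : ∃ h, M.H ![E 0, E 2, E 3] = h := ⟨_, rfl⟩
  obtain ⟨b12, h12⟩ : ∃ h, M.H ![E 1, E 2, E 3] = h := ⟨_, rfl⟩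
  simp only [formComponents, hh, h01, h02, h12, frameRicci_euclid] at hGE
  have h33 := hGE 3 3
  have h00 := hGE 0 0
  simp only [Matrix.cons_val] at h33 h00
  -- Twice the last diagonal equation is a sum of squares of the `b`'s, the diagonal entries of `f`
  -- and its symmetrised off-diagonal entries. Each square vanishes separately.
  have e1 : b01 = 0 := eq_zero_of_sq_add_eq_zero
    (b := b02 ^ 2 + b12 ^ 2 + 2 * f00 ^ 2 + 2 * f11 ^ 2 + 2 * f22 ^ 2 + (f01 + f10) ^ 2 +
      (f02 + f20) ^ 2 + (f12 + f21) ^ 2) (by positivity) (by linear_combination 2 * h33)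
  have e2 : b02 = 0 := eq_zero_of_sq_add_eq_zero
    (b := b01 ^ 2 + b12 ^ 2 + 2 * f00 ^ 2 + 2 * f11 ^ 2 + 2 * f22 ^ 2 + (f01 + f10) ^ 2 +
      (f02 + f20) ^ 2 + (f12 + f21) ^ 2) (by positivity) (by linear_combination 2 * h33)
  have e3 : b12 = 0 := eq_zero_of_sq_add_eq_zero
    (b := b01 ^ 2 + b02 ^ 2 + 2 * f00 ^ 2 + 2 * f11 ^ 2 + 2 * f22 ^ 2 + (f01 + f10) ^ 2 +
      (f02 + f20) ^ 2 + (f12 + f21) ^ 2) (by positivity) (by linear_combination 2 * h33)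
  subst e1 e2 e3
  have e4 : f00 = 0 := eq_zero_of_sq_add_eq_zero
    (b := f11 ^ 2 + f22 ^ 2 + (f01 + f10) ^ 2 / 2 +
      (f02 + f20) ^ 2 / 2 + (f12 + f21) ^ 2 / 2) (by positivity) (by linear_combination h33)
  have e5 : f11 = 0 := eq_zero_of_sq_add_eq_zero
    (b := f00 ^ 2 + f22 ^ 2 + (f01 + f10) ^ 2 / 2 +
      (f02 + f20) ^ 2 / 2 + (f12 + f21) ^ 2 / 2) (by positivity) (by linear_combination h33)
  have e6 : f22 = 0 := eq_zero_of_sq_add_eq_zero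
    (b := f00 ^ 2 + f11 ^ 2 + (f01 + f10) ^ 2 / 2 +
      (f02 + f20) ^ 2 / 2 + (f12 + f21) ^ 2 / 2) (by positivity) (by linear_combination h33)
  subst e4 e5 e6
  have e7 : f01 + f10 = 0 := eq_zero_of_sq_add_eq_zero
    (b := (f02 + f20) ^ 2 + (f12 + f21) ^ 2) (by positivity) (by linear_combination 2 * h33)
  have e8 : f02 + f20 = 0 := eq_zero_of_sq_add_eq_zero
    (b := (f01 + f10) ^ 2 + (f12 + f21) ^ 2) (by positivity) (by linear_combination 2 * h33)
  have e9 : f12 + f21 = 0 := eq_zero_of_sq_add_eq_zero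
    (b := (f01 + f10) ^ 2 + (f02 + f20) ^ 2) (by positivity) (by linear_combination 2 * h33)
  obtain rfl : f01 = -f10 := by linear_combination e7
  obtain rfl : f20 = -f02 := by linear_combination e8
  obtain rfl : f12 = -f21 := by linear_combination e9
  have e10 : h = 0 := eq_zero_of_sq_add_eq_zero (b := 0) le_rfl (by linear_combination 2 * h00)
  obtain ⟨a, e', he', ha⟩ := exists_rotation_normal_form he hF
  exact ⟨a, hr, form_eq_zero E (hh.trans e10) h01 h02 h12, e', he', ha⟩

omit [FiniteDimensional ℝ 𝔤] in
include hab in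
/-- Adding an element of the Abelian ideal `n` to `X` does not change `ad_X` on `n`. -/
lemma hasMatrix_add_smul {e : Basis (Fin 3) ℝ n} {A : Matrix (Fin 3) (Fin 3) ℝ} (u : n) (c : ℝ) :
    HasMatrix n (X + c • (u : 𝔤)) e A ↔ HasMatrix n X e A := by
  have : adOn n (X + c • (u : 𝔤)) = adOn n X := by
    ext v
    have : ⁅(u : 𝔤), (v : 𝔤)⁆ = 0 := congrArg Subtype.val (hab.trivial u v)
    simp [this]
  rw [HasMatrix, HasMatrix, this]

include hdim hn hX in
lemma exists_null_normal (hnd : ¬ (M.gOn n).Nondegenerate) :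
    ∃ u : n, (∀ y : n, M.g u y = 0) ∧ M.g u X = 1 := by
  have h1 : ∃ u : n, u ≠ 0 ∧ ∀ y : n, M.g u y = 0 := by
    by_contra hcon
    push Not at hcon
    refine hnd (nondegenerate_of_symm (fun x y => M.symm x y) fun x hx => ?_)
    by_contra h0
    obtain ⟨y, hy⟩ := hcon x h0
    exact hy (hx y)
  obtain ⟨u, hu0, hu⟩ := h1
  -- Otherwise `u` would be orthogonal to all of `𝔤`.
  have hux : M.g u X ≠ 0 := fun h => hu0 <| by
    have : (u : 𝔤) = 0 := M.nondeg.1 u fun v => by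
      obtain ⟨y, c, rfl⟩ := exists_add_smul hdim hn hX v
      simp [hu y, h]
    simpa using this
  refine ⟨(M.g u X)⁻¹ • u, fun y => ?_, ?_⟩
  · simp [hu y]
  · simp [inv_mul_cancel₀ hux]

include hdim hM hn hX in
lemma exists_basis_degenerate (hnd : ¬ (M.gOn n).Nondegenerate) :
    ∃ e : Basis (Fin 3) ℝ n,
      (∀ i j, M.gOn n (e i) (e j) = !![(1 : ℝ), 0, 0; 0, 1, 0; 0, 0, 0] i j) ∧
      ∀ j, M.g X (e j) = ![0, 0, 1] j := by
  obtain ⟨u, hu, huX⟩ := exists_null_normal hdim hn hX hnd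
  have huX' : M.g X u = 1 := by rw [M.symm, huX]
  have hs : ∀ x y, M.gOn n x y = M.gOn n y x := fun x y => M.symm x y
  have hu' : ∀ y : n, M.g y u = 0 := fun y => by rw [M.symm, hu]
  obtain ⟨a, b, ha, hb, haa, hbb, hab⟩ := exists_orthogonal_two hs hn
    (M.g X ∘ₗ n.toSubmodule.subtype)
    (fun h => by
      have := LinearMap.congr_fun h u
      exact one_ne_zero (huX'.symm.trans this))
    (fun x hx hx0 => by
      -- This combination has square `-1` and is orthogonal to every vector of `n` that is
      -- orthogonal to `X`.
      refine pos_of_orthogonal_timelike hM (x := X - ((M.g X X + 1) / 2) • (u : 𝔤)) ?_ ?_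
        (by simpa using hx0)
      · simp only [map_sub, map_smul, LinearMap.sub_apply, LinearMap.smul_apply, huX, huX', hu u,
          smul_eq_mul]
        linarith
      · have hx' : M.g X x = 0 := hx
        simp [hx', hu x])
  have ha' : M.g X a = 0 := ha
  have hb' : M.g X b = 0 := hb
  have hba := hs b a
  rw [hab] at hba
  have hgram : ∀ i j, M.gOn n (![a, b, u] i) (![a, b, u] j) =
      !![(1 : ℝ), 0, 0; 0, 1, 0; 0, 0, 0] i j := fun i j => by
    fin_cases i <;> fin_cases j <;> simp only [Matrix.of_apply] <;>
      first | exact haa | exact hbb | exact hab | exact hba | exact hu _ | exact hu' _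
  have hli : LinearIndependent ℝ ![a, b, u] := by
    rw [Fintype.linearIndependent_iff]
    intro c hc
    rw [Fin.sum_univ_three] at hc
    simp only [Matrix.cons_val] at hc
    have h0 := congrArg (M.gOn n a) hc
    have h1 := congrArg (M.gOn n b) hc
    have h2 := congrArg (fun v : n => M.g X v) hc
    have hau : M.gOn n a u = 0 := hu' a
    have hbu : M.gOn n b u = 0 := hu' b
    simp only [map_add, map_smul, haa, hab, hau, hbu, hbb, hba, smul_eq_mul, map_zero] at h0 h1
    simp [ha', hb', huX'] at h2
    intro i
    fin_cases i
    · simpa using h0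
    · simpa using h1
    · exact h2
  refine ⟨basisOfLinearIndependentOfCardEqFinrank hli (by simp [hn]), ?_, ?_⟩
  · rw [coe_basisOfLinearIndependentOfCardEqFinrank]
    exact hgram
  · rw [coe_basisOfLinearIndependentOfCardEqFinrank]
    intro j
    fin_cases j
    · exact ha'
    · exact hb'
    · exact huX'

omit [FiniteDimensional ℝ 𝔤] in
include hX in
lemma add_smul_notMem (u : n) (c : ℝ) : X + c • (u : 𝔤) ∉ n := fun h => hX <| by
  have := n.toSubmodule.sub_mem h (n.toSubmodule.smul_mem c u.2)
  simpa using this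

include hdim hM hn hab hX in
lemma exists_caseVII (hnd : ¬ (M.gOn n).Nondegenerate) (hGE : M.IsGenEinstein 0) :
    ∃ a b₁ b₂, CaseVII M n X a b₁ b₂ := by
  obtain ⟨e, he, hk⟩ := exists_basis_degenerate hdim hM hn hX hnd
  -- The vector `X + c e₂` is null, as the frame requires. Adding an element of the Abelian ideal
  -- leaves `ad_X` on `n` unchanged.
  obtain ⟨c, hcdef⟩ : ∃ c : ℝ, c = -(M.g X X / 2) := ⟨_, rfl⟩
  have hk0 : M.g X (e 0) = 0 := hk 0
  have hk1 : M.g X (e 1) = 0 := hk 1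
  have hk2 : M.g X (e 2) = 1 := hk 2
  have hk2' : M.g (e 2) X = 1 := by rw [M.symm, hk2]
  have he2 : ∀ i, M.g (e 2) (e i) = 0 := fun i => by
    refine (he 2 i).trans ?_
    fin_cases i <;> rfl
  obtain ⟨f00, f01, f02, f10, f11, f12, f20, f21, f22, hF⟩ := exists_hasMatrix n X e
  have hX' := add_smul_notMem hX (e 2) c
  obtain ⟨E, hE, hE3⟩ := exists_basis_extend hdim hX' e
  rw [isGenEinstein_iff_degenerate hab hE hE3 ((hasMatrix_add_smul hab (e 2) c).mpr hF) he
    (fun j => by simp [he2, hk]) (by simp [hk2, hk2', he2, hcdef]; ring)] at hGE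
  obtain ⟨h, hh⟩ : ∃ h, M.H ![E 0, E 1, E 2] = h := ⟨_, rfl⟩
  obtain ⟨b01, h01⟩ : ∃ h, M.H ![E 0, E 1, E 3] = h := ⟨_, rfl⟩
  obtain ⟨b02, h02⟩ : ∃ h, M.H ![E 0, E 2, E 3] = h := ⟨_, rfl⟩
  obtain ⟨b12, h12⟩ : ∃ h, M.H ![E 1, E 2, E 3] = h := ⟨_, rfl⟩
  simp only [formComponents, hh, h01, h02, h12, frameRicci_degenerate] at hGE
  have h22 := hGE 2 2
  have h23 := hGE 2 3
  have h33 := hGE 3 3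
  simp only [Matrix.cons_val] at h22 h23 h33
  obtain rfl : h = 0 := eq_zero_of_sq_add_eq_zero (b := 0) le_rfl (by linear_combination 2 * h22)
  -- Once `h = 0`, component `(2, 3)` is minus half a sum of four squares.
  obtain rfl : b02 = 0 := eq_zero_of_sq_add_eq_zero (b := b12 ^ 2 + f02 ^ 2 + f12 ^ 2)
    (by positivity) (by linear_combination -2 * h23)
  obtain rfl : b12 = 0 := eq_zero_of_sq_add_eq_zero (b := f02 ^ 2 + f12 ^ 2)
    (by positivity) (by linear_combination -2 * h23)
  obtain rfl : f02 = 0 := eq_zero_of_sq_add_eq_zero (b := f12 ^ 2)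
    (by positivity) (by linear_combination -2 * h23)
  obtain rfl : f12 = 0 := eq_zero_of_sq_add_eq_zero (b := 0)
    (by positivity) (by linear_combination -2 * h23)
  obtain rfl : b01 = 0 := eq_zero_of_sq_add_eq_zero
    (b := 2 * f00 ^ 2 + 2 * f11 ^ 2 + 2 * f22 ^ 2 + (f01 + f10) ^ 2)
    (by positivity) (by linear_combination 2 * h33)
  obtain rfl : f00 = 0 := eq_zero_of_sq_add_eq_zero
    (b := f11 ^ 2 + f22 ^ 2 + (f01 + f10) ^ 2 / 2)
    (by positivity) (by linear_combination h33)
  obtain rfl : f11 = 0 := eq_zero_of_sq_add_eq_zero (b := f22 ^ 2 + (f01 + f10) ^ 2 / 2)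
    (by positivity) (by linear_combination h33)
  obtain rfl : f22 = 0 := eq_zero_of_sq_add_eq_zero (b := (f01 + f10) ^ 2 / 2)
    (by positivity) (by linear_combination h33)
  have e7 : f01 + f10 = 0 := eq_zero_of_sq_add_eq_zero (b := 0)
    (by positivity) (by linear_combination 2 * h33)
  obtain rfl : f01 = -f10 := by linear_combination e7
  exact ⟨f10, f20, f21, hnd, form_eq_zero E hh h01 h02 h12, e, he 0 0, he 1 1, he 0 1, he2,
    hk2', hk0, hk1, hF⟩

end Solutions

lemma wedge3_apply {V : Type*} [AddCommGroup V] [Module ℝ V] (α β γ : Dual ℝ V) (x y z : V) :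
    wedge3 α β γ ![x, y, z] = α x * (β y * γ z - γ y * β z) - β x * (α y * γ z - γ y * α z) +
      γ x * (α y * β z - β y * α z) := by
  have : wedge3 α β γ ![x, y, z] =
      Matrix.det !![α x, β x, γ x; α y, β y, γ y; α z, β z, γ z] := by
    change Matrix.det (fun i => LinearMap.pi ![α, β, γ] (![x, y, z] i)) = _
    refine congrArg Matrix.det ?_
    ext i j
    fin_cases i <;> fin_cases j <;> rfl
  rw [this, Matrix.det_fin_three]
  simp only [Matrix.of_apply, Matrix.cons_val]
  ring

lemma eq_smul_wedge3_iff {𝔤 : Type*} [LieRing 𝔤] [LieAlgebra ℝ 𝔤] {H : 𝔤 [⋀^Fin 3]→ₗ[ℝ] ℝ}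
    (E : Basis (Fin 4) ℝ 𝔤) (a : ℝ) :
    H = a • wedge3 (E.coord 0 + E.coord 2) (E.coord 1) (E.coord 3) ↔
      H ![E 0, E 1, E 2] = 0 ∧ H ![E 0, E 1, E 3] = a ∧ H ![E 0, E 2, E 3] = 0 ∧
        H ![E 1, E 2, E 3] = -a := by
  constructor
  · rintro rfl
    refine ⟨?_, ?_, ?_, ?_⟩ <;>
      simp [AlternatingMap.smul_apply, wedge3_apply]
  · rintro ⟨h0, h1, h2, h3⟩
    refine form_ext E ?_ ?_ ?_ ?_ <;>
      simp [AlternatingMap.smul_apply, wedge3_apply, h0, h1, h2, h3]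

lemma metric_eq_coord {𝔤 : Type*} [LieRing 𝔤] [LieAlgebra ℝ 𝔤] {M : GenMetric 𝔤}
    {n : LieIdeal ℝ 𝔤} {X : 𝔤} {e : Basis (Fin 3) ℝ n} {E : Basis (Fin 4) ℝ 𝔤}
    (hE : ∀ i : Fin 3, E i.castSucc = (e i : 𝔤)) (hE3 : E 3 = X) (hXn : ∀ Y ∈ n, M.g X Y = 0)
    (hc : M.g X X = 1) : M.g X = E.coord 3 := by
  refine E.ext fun i => Fin.lastCases ?_ (fun i => ?_) i
  · rw [show Fin.last 3 = 3 from rfl, hE3, hc, ← hE3]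
    simp
  · rw [hE, hXn _ (e i).2, ← hE, Basis.coord_apply, Basis.repr_self, Finsupp.single_apply,
      if_neg (show i.castSucc ≠ 3 from (Fin.castSucc_lt_last i).ne)]

/-! ### Necessity for Lorentzian ideals -/

section Solutions

variable {𝔤 : Type*} [LieRing 𝔤] [LieAlgebra ℝ 𝔤] [FiniteDimensional ℝ 𝔤] {M : GenMetric 𝔤}
  {n : LieIdeal ℝ 𝔤} {X : 𝔤}

variable (hdim : finrank ℝ 𝔤 = 4) (hM : IsLorentzianForm M.g) (hn : finrank ℝ n = 3)
  (hab : IsLieAbelian n) (hX : X ∉ n) (hXn : ∀ Y ∈ n, M.g X Y = 0) (hc : M.g X X = 1)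

include hab hXn hc in
-- The second conclusion says that the axis `(b12, -b02, b01)` of `H(·, ·, X)` on `n` has square
-- zero.
lemma form_eq_of_isGenEinstein {e : Basis (Fin 3) ℝ n} (he : IsNullBasis (M.gOn n) e)
    {E : Basis (Fin 4) ℝ 𝔤} (hE : ∀ i : Fin 3, E i.castSucc = (e i : 𝔤)) (hE3 : E 3 = X)
    (hGE : M.IsGenEinstein 0) : M.H ![E 0, E 1, E 2] = 0 ∧
      2 * M.H ![E 0, E 1, E 3] * M.H ![E 1, E 2, E 3] + M.H ![E 0, E 2, E 3] ^ 2 = 0 := by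
  obtain ⟨f00, f01, f02, f10, f11, f12, f20, f21, f22, hF⟩ := exists_hasMatrix n X e
  rw [isGenEinstein_iff_null hab hE hE3 hF he (fun j => hXn _ (e j).2) hc] at hGE
  simp only [formComponents, frameRicci_null] at hGE
  generalize M.H ![E 0, E 1, E 2] = h at *
  generalize M.H ![E 0, E 1, E 3] = b01 at *
  generalize M.H ![E 0, E 2, E 3] = b02 at *
  generalize M.H ![E 1, E 2, E 3] = b12 at *
  have h03 := hGE 0 3
  have h13 := hGE 1 3
  have h23 := hGE 2 3
  have h02 := hGE 0 2
  have h20 := hGE 2 0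
  have h11 := hGE 1 1
  simp only [Matrix.cons_val] at h03 h13 h23 h02 h20 h11
  -- The metric trace of the equations over `n`: the terms in `f` form the trace of a commutator and
  -- disappear.
  have hsum : 2 * b01 * b12 + b02 ^ 2 + 3 / 2 * h ^ 2 = 0 := by
    linear_combination -h02 - h20 - h11
  have hh : h = 0 := by
    by_contra h0
    have e1 : b01 = 0 := mul_right_cancel₀ h0 (by linear_combination -2 * h03)
    have e2 : b02 = 0 := mul_right_cancel₀ h0 (by linear_combination 2 * h13)
    have e3 : b12 = 0 := mul_right_cancel₀ h0 (by linear_combination -2 * h23)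
    subst e1 e2 e3
    exact h0 (eq_zero_of_sq_add_eq_zero (b := 0) le_rfl (by linear_combination 2 / 3 * hsum))
  subst hh
  exact ⟨rfl, by linear_combination hsum⟩

include hdim hab hX hXn hc in
lemma nullEinstein_of_isGenEinstein (hH : M.H = 0) (hGE : M.IsGenEinstein 0)
    {e : Basis (Fin 3) ℝ n} (he : IsNullBasis (M.gOn n) e) :
    NullEinstein (LinearMap.toMatrix e e (adOn n X)) := by
  obtain ⟨E, hE, hE3⟩ := exists_basis_extend hdim hX e
  obtain ⟨f00, f01, f02, f10, f11, f12, f20, f21, f22, hF⟩ := exists_hasMatrix n X e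
  rw [isGenEinstein_iff_null hab hE hE3 hF he (fun j => hXn _ (e j).2) hc] at hGE
  simp only [formComponents, hH, AlternatingMap.zero_apply, frameRicci_null] at hGE
  rw [HasMatrix] at hF
  rw [hF]
  have h00 := hGE 0 0
  have h01 := hGE 0 1
  have h02 := hGE 0 2
  have h12 := hGE 1 2
  have h22 := hGE 2 2
  have h33 := hGE 3 3
  constructor <;> simp only [Matrix.of_apply, Matrix.cons_val] at *
  · linear_combination h00
  · linear_combination 2 * h01
  · linear_combination 2 * h02
  · linear_combination 2 * h12
  · linear_combination h22
  · linear_combination h33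

include hdim hM hn hab hX hXn hc in
/-- If `H ≠ 0`, there is a null basis of `n` whose first vector spans the kernel of
`H(X, ·, ·)` on `n`. -/
lemma exists_nullBasis_kernel (hH : M.H ≠ 0) (hGE : M.IsGenEinstein 0) :
    ∃ e : Basis (Fin 3) ℝ n, IsNullBasis (M.gOn n) e ∧
      ∀ y : n, M.H ![(e 0 : 𝔤), (y : 𝔤), X] = 0 := by
  obtain ⟨l, hl⟩ := exists_lorentzBasis_of_normal hdim hM hn hX hXn hc
  obtain ⟨e, he, -⟩ := exists_nullBasis_adapted l hl (l 0) (l.ne_zero 0)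
  obtain ⟨E, hE, hE3⟩ := exists_basis_extend hdim hX e
  obtain ⟨hh, hb⟩ := form_eq_of_isGenEinstein hab hXn hc he hE hE3 hGE
  have hE0 : E 0 = (e 0 : 𝔤) := hE 0
  have hE1 : E 1 = (e 1 : 𝔤) := hE 1
  have hE2 : E 2 = (e 2 : 𝔤) := hE 2
  have hne : ¬ (M.H ![E 0, E 1, E 3] = 0 ∧ M.H ![E 0, E 2, E 3] = 0 ∧
      M.H ![E 1, E 2, E 3] = 0) := fun h => hH (form_eq_zero E hh h.1 h.2.1 h.2.2)
  rw [hE0, hE1, hE2, hE3] at hb hne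
  obtain ⟨b01, h01⟩ : ∃ h, M.H ![(e 0 : 𝔤), (e 1 : 𝔤), X] = h := ⟨_, rfl⟩
  obtain ⟨b02, h02⟩ : ∃ h, M.H ![(e 0 : 𝔤), (e 2 : 𝔤), X] = h := ⟨_, rfl⟩
  obtain ⟨b12, h12⟩ : ∃ h, M.H ![(e 1 : 𝔤), (e 2 : 𝔤), X] = h := ⟨_, rfl⟩
  rw [h01, h02, h12] at hb hne
  have h10 := (form_swap_zero_one M.H (e 0 : 𝔤) (e 1) X).trans (congrArg Neg.neg h01)
  have h20 := (form_swap_zero_one M.H (e 0 : 𝔤) (e 2) X).trans (congrArg Neg.neg h02)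
  have h21 := (form_swap_zero_one M.H (e 1 : 𝔤) (e 2) X).trans (congrArg Neg.neg h12)
  -- As in the cross product, `w` annihilates the two-form. Its square is the quadratic expression
  -- just shown to vanish.
  obtain ⟨w, hw⟩ : ∃ w : n, w = b12 • e 0 + (-b02) • e 1 + b01 • e 2 := ⟨_, rfl⟩
  have hw0 : w ≠ 0 := by
    rintro rfl
    have h := Fintype.linearIndependent_iff.mp e.linearIndependent ![b12, -b02, b01] (by
      rw [Fin.sum_univ_three]; simpa using hw.symm)
    exact hne ⟨h 2, neg_eq_zero.mp (h 1), h 0⟩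
  have hww : M.gOn n w w = 0 := by
    rw [hw]
    simp only [map_add, map_smul, LinearMap.add_apply, LinearMap.smul_apply, he _ _, smul_eq_mul]
    simp [gramNull]
    linear_combination hb
  have hker : ∀ y : n, M.H ![(w : 𝔤), (y : 𝔤), X] = 0 := fun y => by
    obtain ⟨x0, x1, x2, rfl⟩ : ∃ x0 x1 x2 : ℝ, y = x0 • e 0 + x1 • e 1 + x2 • e 2 :=
      ⟨_, _, _, by rw [← Fin.sum_univ_three (fun i => e.repr y i • e i), e.sum_repr]⟩
    rw [hw]
    simp only [LieSubmodule.coe_add, LieSubmodule.coe_smul, GenMetric.form_add_zero,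
      GenMetric.form_smul_zero, GenMetric.form_add_one, GenMetric.form_smul_one,
      form_self_zero_one, h01, h02, h12, h10, h20, h21]
    ring
  obtain ⟨e', he', ⟨c, hc0, h⟩ | ⟨c, hc0, h⟩ | rfl⟩ := exists_nullBasis_adapted l hl w hw0
  · exfalso
    rw [h] at hww
    simp only [map_smul, LinearMap.smul_apply, he' _ _, smul_eq_mul] at hww
    simp [gramNull, hc0] at hww
  · exfalso
    rw [h] at hww
    simp only [map_sub, map_smul, LinearMap.sub_apply, LinearMap.smul_apply, he' _ _,
      smul_eq_mul] at hww
    simp [gramNull] at hww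
    exact hc0 (eq_zero_of_sq_add_eq_zero (b := 0) le_rfl (by linear_combination -hww / 4))
  · exact ⟨e', he', hker⟩

include hab hXn hc in
-- The antisymmetric part of the equations is linear in `f` with coefficient `b ≠ 0`. It kills two
-- entries and ties two diagonal ones, after which the remaining diagonal equations are squares.
lemma nilpotent_of_kernel {e : Basis (Fin 3) ℝ n} (he : IsNullBasis (M.gOn n) e)
    {E : Basis (Fin 4) ℝ 𝔤} (hE : ∀ i : Fin 3, E i.castSucc = (e i : 𝔤)) (hE3 : E 3 = X)
    (hGE : M.IsGenEinstein 0) (h01 : M.H ![E 0, E 1, E 3] = 0) (h02 : M.H ![E 0, E 2, E 3] = 0)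
    (h12 : M.H ![E 1, E 2, E 3] ≠ 0) :
    ∃ q r t : ℝ, HasMatrix n X e !![0, q, r; 0, 0, t; 0, 0, 0] ∧
      q ^ 2 - t ^ 2 = M.H ![E 1, E 2, E 3] ^ 2 := by
  have hh := (form_eq_of_isGenEinstein hab hXn hc he hE hE3 hGE).1
  obtain ⟨f00, f01, f02, f10, f11, f12, f20, f21, f22, hF⟩ := exists_hasMatrix n X e
  rw [isGenEinstein_iff_null hab hE hE3 hF he (fun j => hXn _ (e j).2) hc] at hGE
  simp only [formComponents, hh, h01, h02, frameRicci_null] at hGE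
  generalize M.H ![E 1, E 2, E 3] = b at *
  have e00 := hGE 0 0
  have e01 := hGE 0 1
  have e10 := hGE 1 0
  have e02 := hGE 0 2
  have e20 := hGE 2 0
  have e12 := hGE 1 2
  have e21 := hGE 2 1
  have e22 := hGE 2 2
  have e33 := hGE 3 3
  simp only [Matrix.cons_val] at e00 e01 e10 e02 e20 e12 e21 e22 e33
  obtain rfl : f20 = 0 := mul_left_cancel₀ h12 (by linear_combination e10 - e01)
  obtain rfl : f21 = 0 := mul_left_cancel₀ h12 (by linear_combination e02 - e20)
  obtain rfl : f11 = -f00 := mul_left_cancel₀ h12 (by linear_combination e12 - e21)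
  obtain rfl : f10 = 0 := eq_zero_of_sq_add_eq_zero (b := 0) le_rfl (by linear_combination 2 * e00)
  obtain rfl : f00 = 0 := eq_zero_of_sq_add_eq_zero (b := (f00 + f22) ^ 2 / 2) (by positivity)
    (by linear_combination e33)
  obtain rfl : f22 = 0 := eq_zero_of_sq_add_eq_zero (b := 0) le_rfl (by linear_combination 2 * e33)
  exact ⟨f01, f02, f12, by simpa using hF, by linear_combination -2 * e22⟩

include hdim hM hn hab hX hXn hc in
lemma exists_caseVI (hH : M.H ≠ 0) (hGE : M.IsGenEinstein 0) : ∃ a, a ≠ 0 ∧ CaseVI M n X a := by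
  obtain ⟨e, he, hker⟩ := exists_nullBasis_kernel hdim hM hn hab hX hXn hc hH hGE
  obtain ⟨E, hE, hE3⟩ := exists_basis_extend hdim hX e
  have hE0 : E 0 = (e 0 : 𝔤) := hE 0
  have hE1 : E 1 = (e 1 : 𝔤) := hE 1
  have hE2 : E 2 = (e 2 : 𝔤) := hE 2
  have hh := (form_eq_of_isGenEinstein hab hXn hc he hE hE3 hGE).1
  have h01 : M.H ![E 0, E 1, E 3] = 0 := by rw [hE0, hE1, hE3, hker]
  have h02 : M.H ![E 0, E 2, E 3] = 0 := by rw [hE0, hE2, hE3, hker]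
  have h12 : M.H ![E 1, E 2, E 3] ≠ 0 := fun h => hH (form_eq_zero E hh h01 h02 h)
  obtain ⟨q, r, t, hF, hqt⟩ := nilpotent_of_kernel hab hXn hc he hE hE3 hGE h01 h02 h12
  rw [hE1, hE2, hE3] at h12 hqt
  obtain ⟨b, hb⟩ : ∃ b, M.H ![(e 1 : 𝔤), (e 2 : 𝔤), X] = b := ⟨_, rfl⟩
  rw [hb] at h12 hqt
  obtain ⟨s, hs⟩ : ∃ s : ℝ, q + t = 2 * s := ⟨(q + t) / 2, by ring⟩
  -- If `q + t = 0`, then `q² - t² = 0`, contradicting `b ≠ 0`.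
  have hs0 : s ≠ 0 := by
    rintro rfl
    apply h12
    exact eq_zero_of_sq_add_eq_zero (b := 0) le_rfl (by linear_combination -hqt + (q - t) * hs)
  obtain ⟨d, hd, hd0, ⟨c1, hd1⟩, ⟨c2, c3, hd2⟩, hdF⟩ := exists_nullBasis_upper he hs0 hs hF
  have k01 : M.H ![(d 0 : 𝔤), (d 1 : 𝔤), X] = 0 := by
    rw [hd0, LieSubmodule.coe_smul, GenMetric.form_smul_zero, hker, mul_zero]
  have k02 : M.H ![(d 0 : 𝔤), (d 2 : 𝔤), X] = 0 := by
    rw [hd0, LieSubmodule.coe_smul, GenMetric.form_smul_zero, hker, mul_zero]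
  have k12 : M.H ![(d 1 : 𝔤), (d 2 : 𝔤), X] = b / s := by
    have h10 := (form_swap_zero_one M.H (e 0 : 𝔤) (e 1) X).trans (congrArg Neg.neg (hker _))
    rw [hd1, hd2]
    simp only [LieSubmodule.coe_add, LieSubmodule.coe_smul, GenMetric.form_add_zero,
      GenMetric.form_smul_zero, GenMetric.form_add_one, GenMetric.form_smul_one,
      form_self_zero_one, hker, h10, hb]
    field_simp
    ring
  -- After scaling, the two entries have sum `2` and difference of squares `(b/s)²`. Writing the
  -- latter as `2a²` makes them `1 ± a²/2`. The sign and the factor `√2` come from the orthonormal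
  -- basis built on the null one.
  obtain ⟨a, ha⟩ : ∃ a, a = -(b / s / √2) := ⟨_, rfl⟩
  have hsq2 : (√2 : ℝ) ^ 2 = 2 := Real.sq_sqrt (by norm_num)
  have hsq0 : (√2 : ℝ) ≠ 0 := by positivity
  have ha2 : a ^ 2 = (q ^ 2 - t ^ 2) / (2 * s ^ 2) := by
    rw [ha, hqt, neg_sq, div_pow, hsq2]
    field_simp
  have hdF' : LinearMap.toMatrix d d (adOn n X) =
      !![0, 1 + a ^ 2 / 2, 0; 0, 0, 1 - a ^ 2 / 2; 0, 0, 0] := by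
    rw [hdF, ha2, show q / s = 1 + (q ^ 2 - t ^ 2) / (2 * s ^ 2) / 2 by
      field_simp; linear_combination (2 * s + t - q) * hs,
      show t / s = 1 - (q ^ 2 - t ^ 2) / (2 * s ^ 2) / 2 by
      field_simp; linear_combination (2 * s + q - t) * hs]
  have d012 : M.H ![(d 0 : 𝔤), (d 1 : 𝔤), (d 2 : 𝔤)] = 0 := by
    obtain ⟨D, hD, hD3⟩ := exists_basis_extend hdim hX d
    have h := (form_eq_of_isGenEinstein hab hXn hc hd hD hD3 hGE).1
    rwa [show D 0 = (d 0 : 𝔤) from hD 0, show D 1 = (d 1 : 𝔤) from hD 1,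
      show D 2 = (d 2 : 𝔤) from hD 2] at h
  have d210 : M.H ![(d 2 : 𝔤), (d 1 : 𝔤), (d 0 : 𝔤)] = 0 := by
    rw [form_swap_zero_one, GenMetric.form_cycle, GenMetric.form_cycle, d012, neg_zero]
  obtain ⟨l, hl, hl0, hl1, hl2, hlF⟩ := lorentzRep_matVI hd a hdF'
  obtain ⟨L, hL, hL3⟩ := exists_basis_extend hdim hX l
  refine ⟨a, ?_, ⟨2, l, hl⟩, l, L, hl, hL, hL3, ?_, hlF⟩
  · rw [ha, neg_ne_zero]
    exact div_ne_zero (div_ne_zero h12 hs0) hsq0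
  have hL0 : L 0 = (l 0 : 𝔤) := hL 0
  have hL1 : L 1 = (l 1 : 𝔤) := hL 1
  have hL2 : L 2 = (l 2 : 𝔤) := hL 2
  have hab' : b / s = -(a * √2) := by rw [ha]; field_simp
  have k10 := (form_swap_zero_one M.H (d 0 : 𝔤) (d 1) X).trans (congrArg Neg.neg k01)
  have k20 := (form_swap_zero_one M.H (d 0 : 𝔤) (d 2) X).trans (congrArg Neg.neg k02)
  have k21 := (form_swap_zero_one M.H (d 1 : 𝔤) (d 2) X).trans (congrArg Neg.neg k12)
  rw [metric_eq_coord hL hL3 hXn hc, eq_smul_wedge3_iff, hL0, hL1, hL2, hL3, hl0, hl1, hl2]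
  simp only [smul_add, sub_eq_add_neg, ← neg_one_smul ℝ (d 0), smul_smul,
    LieSubmodule.coe_add, LieSubmodule.coe_smul, GenMetric.form_add_zero,
    GenMetric.form_smul_zero, GenMetric.form_add_one, GenMetric.form_smul_one,
    GenMetric.form_add_two, GenMetric.form_smul_two, form_self_zero_one, form_self_zero_two,
    k01, k02, k12, k10, k20, k21, hab']
  have k3 : 1 / √2 * √2 = 1 := by field_simp
  refine ⟨?_, ?_, ?_, ?_⟩
  · rw [d210, d012]; ring
  · linear_combination a * k3
  · ring
  · linear_combination -a * k3

end Solutions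

/-! ### Sufficiency: the normal forms solve the equations -/

section Converse

variable {𝔤 : Type*} [LieRing 𝔤] [LieAlgebra ℝ 𝔤] [FiniteDimensional ℝ 𝔤] {M : GenMetric 𝔤}
  {n : LieIdeal ℝ 𝔤} {X : 𝔤}

variable (hdim : finrank ℝ 𝔤 = 4) (hM : IsLorentzianForm M.g) (hn : finrank ℝ n = 3)
  (hab : IsLieAbelian n) (hX : IsComplementary M n X)

include hdim hM hn hab hX in
lemma CaseI.isGenEinstein {a : ℝ} (h : CaseI M n X a) : M.IsGenEinstein 0 := by
  obtain ⟨hr, hH, e, he, hF⟩ := h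
  obtain ⟨hXn, hc⟩ := normal_of_riemannian hdim hM hn hX hr
  obtain ⟨E, hE, hE3⟩ := exists_basis_extend hdim hX.1 e
  rw [isGenEinstein_iff_euclid hab hE hE3 hF he (fun j => hXn _ (e j).2) hc]
  intro i j
  simp only [formComponents, hH, AlternatingMap.zero_apply, matL1, frameRicci_euclid]
  fin_cases i <;> fin_cases j <;> simp <;> ring1

include hdim hM hab hX in
lemma isGenEinstein_iff_of_lorentz (hl : IsLorentzianForm (M.gOn n)) (hH : M.H = 0)
    {e : Basis (Fin 3) ℝ n} (he : IsLorentzBasis (M.gOn n) e)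
    {F : Matrix (Fin 3) (Fin 3) ℝ} (hF : HasMatrix n X e F) :
    M.IsGenEinstein 0 ↔ ∀ a b, frameRicci ![0, 1, 2, 3] ![-1, 1, 1, 1] (bracketTable F)
      (formTable 0 0 0 0) a b = 0 := by
  obtain ⟨hXn, hc⟩ := normal_of_lorentzian hM hX hl
  obtain ⟨E, hE, hE3⟩ := exists_basis_extend hdim hX.1 e
  rw [isGenEinstein_iff_lorentz hab hE hE3 hF he (fun j => hXn _ (e j).2) hc]
  simp only [formComponents, hH, AlternatingMap.zero_apply]

include hdim hM hab hX in
lemma CaseII.isGenEinstein {σ : ℝ} (h : CaseII M n X σ) : M.IsGenEinstein 0 := by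
  obtain ⟨hl, hH, e, he, hF⟩ := h
  rw [isGenEinstein_iff_of_lorentz hdim hM hab hX hl hH he hF]
  intro i j
  simp only [matM3, frameRicci_lorentz]
  fin_cases i <;> fin_cases j <;> simp <;> ring1

include hdim hM hab hX in
lemma CaseIII.isGenEinstein {α a : ℝ} (h : CaseIII M n X α a) : M.IsGenEinstein 0 := by
  obtain ⟨hl, hH, e, he, hF⟩ := h
  rw [isGenEinstein_iff_of_lorentz hdim hM hab hX hl hH he hF]
  have hβ : √(α ^ 2 + a ^ 2 / 2) ^ 2 = α ^ 2 + a ^ 2 / 2 := Real.sq_sqrt (by positivity)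
  generalize √(α ^ 2 + a ^ 2 / 2) = β at hβ
  intro i j
  simp only [matL1, frameRicci_lorentz]
  fin_cases i <;> fin_cases j <;> simp <;> first | ring1 | linear_combination -2 * hβ

include hdim hM hab hX in
lemma CaseIV.isGenEinstein {ε v : ℝ} (h : CaseIV M n X ε v) : M.IsGenEinstein 0 := by
  obtain ⟨hl, hH, e, he, hF⟩ := h
  rw [isGenEinstein_iff_of_lorentz hdim hM hab hX hl hH he hF]
  intro i j
  simp only [matIV, frameRicci_lorentz]
  fin_cases i <;> fin_cases j <;> simp <;> ring1

lemma matVI_eq (a : ℝ) : matVI a = !![0, 1 / √2 * (-1 - a ^ 2 / 2), 0;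
    1 / √2 * (1 - a ^ 2 / 2), 0, 1 / √2 * (1 - a ^ 2 / 2); 0, 1 / √2 * (1 + a ^ 2 / 2), 0] := by
  ext i j
  fin_cases i <;> fin_cases j <;> simp [matVI]

include hM hab hX in
lemma CaseVI.isGenEinstein {a : ℝ} (h : CaseVI M n X a) : M.IsGenEinstein 0 := by
  obtain ⟨hl, e, E, he, hE, hE3, hH, hF⟩ := h
  obtain ⟨hXn, hc⟩ := normal_of_lorentzian hM hX hl
  rw [metric_eq_coord hE hE3 hXn hc, eq_smul_wedge3_iff] at hH
  obtain ⟨h0, h1, h2, h3⟩ := hH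
  rw [matVI_eq] at hF
  rw [isGenEinstein_iff_lorentz hab hE hE3 hF he (fun j => hXn _ (e j).2) hc]
  have hk : 2 * (1 / √2) ^ 2 = 1 := by
    rw [div_pow, Real.sq_sqrt (by norm_num)]; norm_num
  generalize 1 / √2 = k at hk
  intro i j
  simp only [formComponents, h0, h1, h2, h3, frameRicci_lorentz]
  fin_cases i <;> fin_cases j <;> simp <;>
    first | ring1 | linear_combination a ^ 2 / 2 * hk | linear_combination -a ^ 2 / 2 * hk

include hdim hM hab hX in
lemma CaseV.isGenEinstein (h : CaseV M n X) : M.IsGenEinstein 0 := by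
  obtain ⟨hl, hH, e, he, hF⟩ := h
  rw [isGenEinstein_iff_of_lorentz hdim hM hab hX hl hH he hF]
  intro i j
  simp only [matL3, frameRicci_lorentz]
  fin_cases i <;> fin_cases j <;> simp

include hdim hab hX in
lemma CaseVII.isGenEinstein {a b₁ b₂ : ℝ} (h : CaseVII M n X a b₁ b₂) : M.IsGenEinstein 0 := by
  obtain ⟨-, hH, e, h00, h11, h01, h2, h2X, hX0, hX1, hF⟩ := h
  have hX2 : M.g X (e 2) = 1 := by rw [M.symm, h2X]
  have h10 : M.g (e 1) (e 0) = 0 := by rw [M.symm, h01]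
  have h2' : ∀ i, M.g (e i) (e 2) = 0 := fun i => by rw [M.symm, h2]
  -- Again `X` is shifted along the radical of `n` to a null vector, which does not affect the
  -- matrix.
  obtain ⟨E, hE, hE3⟩ := exists_basis_extend hdim
    (add_smul_notMem hX.1 (e 2) (-(M.g X X / 2))) e
  rw [isGenEinstein_iff_degenerate hab hE hE3 ((hasMatrix_add_smul hab (e 2) _).mpr hF)]
  · intro i j
    simp only [formComponents, hH, AlternatingMap.zero_apply, matVII, frameRicci_degenerate]
    fin_cases i <;> fin_cases j <;> simp <;> ring1
  · intro i j
    change M.g (e i) (e j) = _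
    fin_cases i <;> fin_cases j <;> simp [h00, h11, h01, h10, h2, h2']
  · intro j
    fin_cases j <;> simp [h2, hX0, hX1, hX2]
  · simp [h2, h2X, hX2]
    ring

end Converse

/-! ### Almost Abelian Lie algebras and their isomorphisms -/

section Isomorphisms

variable {𝔤 : Type*} [LieRing 𝔤] [LieAlgebra ℝ 𝔤]

lemma LieIso.trans {𝔥 𝔨 : Type*} [LieRing 𝔥] [LieAlgebra ℝ 𝔥] [LieRing 𝔨] [LieAlgebra ℝ 𝔨]
    (h : LieIso 𝔤 𝔥) (h' : LieIso 𝔥 𝔨) : LieIso 𝔤 𝔨 :=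
  h.elim fun f => h'.elim fun f' => ⟨f.trans f'⟩

lemma LieIso.symm {𝔥 : Type*} [LieRing 𝔥] [LieAlgebra ℝ 𝔥] (h : LieIso 𝔤 𝔥) : LieIso 𝔥 𝔤 :=
  h.elim fun f => ⟨f.symm⟩

namespace AlmostAbelian

variable {m : ℕ} (A A' : Matrix (Fin m) (Fin m) ℝ)

/-- Elements of the semidirect product. -/
def mk (x : Fin m → ℝ) (t : ℝ) : AlmostAbelian A := (x, t)

variable {A}

lemma lie_def (p q : AlmostAbelian A) :
    ⁅p, q⁆ = mk A (p.2 • A.mulVec q.1 - q.2 • A.mulVec p.1) 0 := rfl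

variable {A'}

/-- Semidirect products by matrices that are conjugate up to a scalar are isomorphic. -/
lemma lieIso_of_conj {Q : Matrix (Fin m) (Fin m) ℝ} {s : ℝ} (hQ : Q.det ≠ 0) (hs : s ≠ 0)
    (h : A * Q = s • (Q * A')) : LieIso (AlmostAbelian A) (AlmostAbelian A') := by
  have hu : IsUnit Q.det := hQ.isUnit
  let f : AlmostAbelian A' ≃ₗ[ℝ] AlmostAbelian A :=
    { toFun := fun p => mk A (Q.mulVec p.1) (s⁻¹ * p.2)
      invFun := fun p => mk A' (Q⁻¹.mulVec p.1) (s * p.2)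
      map_add' := fun p q => Prod.ext (Matrix.mulVec_add Q p.1 q.1) (mul_add s⁻¹ p.2 q.2)
      map_smul' := fun c p => Prod.ext (Matrix.mulVec_smul Q c p.1) (mul_left_comm s⁻¹ c p.2)
      left_inv := fun p => Prod.ext
        (show Q⁻¹.mulVec (Q.mulVec p.1) = p.1 by
          rw [Matrix.mulVec_mulVec, Matrix.nonsing_inv_mul _ hu, Matrix.one_mulVec])
        (mul_inv_cancel_left₀ hs _)
      right_inv := fun p => Prod.ext
        (show Q.mulVec (Q⁻¹.mulVec p.1) = p.1 by
          rw [Matrix.mulVec_mulVec, Matrix.mul_nonsing_inv _ hu, Matrix.one_mulVec])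
        (inv_mul_cancel_left₀ hs _) }
  have hAQ : ∀ x, A.mulVec (Q.mulVec x) = s • Q.mulVec (A'.mulVec x) := fun x => by
    rw [Matrix.mulVec_mulVec, h, Matrix.smul_mulVec, Matrix.mulVec_mulVec]
  refine LieIso.symm ⟨{ f with map_lie' := fun {p q} => Prod.ext ?_ ?_ }⟩
  · change Q.mulVec (p.2 • A'.mulVec q.1 - q.2 • A'.mulVec p.1) =
      (s⁻¹ * p.2) • A.mulVec (Q.mulVec q.1) - (s⁻¹ * q.2) • A.mulVec (Q.mulVec p.1)
    rw [hAQ, hAQ, smul_smul, smul_smul, mul_right_comm, inv_mul_cancel₀ hs, one_mul,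
      mul_right_comm, inv_mul_cancel₀ hs, one_mul, Matrix.mulVec_sub, Matrix.mulVec_smul,
      Matrix.mulVec_smul]
  · exact mul_zero _

/-- A direct product with `ℝ` is the semidirect product by the matrix extended by zero. -/
lemma lieIso_prod (a b c d : ℝ) : LieIso (AlmostAbelian !![a, b, 0; c, d, 0; 0, 0, 0])
    (AlmostAbelian !![a, b; c, d] × R1) := by
  let f : AlmostAbelian !![a, b, 0; c, d, 0; 0, 0, 0] ≃ₗ[ℝ] AlmostAbelian !![a, b; c, d] × R1 :=
    { toFun := fun p => (mk _ ![p.1 0, p.1 1] p.2, (fun _ => p.1 2 : Fin 1 → ℝ))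
      invFun := fun p => mk _ ![p.1.1 0, p.1.1 1, (p.2 : Fin 1 → ℝ) 0] p.1.2
      map_add' := fun p q => by
        refine Prod.ext (Prod.ext ?_ rfl) rfl
        ext i; fin_cases i <;> rfl
      map_smul' := fun r p => by
        refine Prod.ext (Prod.ext ?_ rfl) rfl
        ext i; fin_cases i <;> rfl
      left_inv := fun p => by
        refine Prod.ext ?_ rfl
        ext i; fin_cases i <;> rfl
      right_inv := fun p => by
        refine Prod.ext (Prod.ext ?_ rfl) ?_
        · ext i; fin_cases i <;> rfl
        · funext i; rw [Subsingleton.elim i 0]; rfl }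
  let B : Matrix (Fin 3) (Fin 3) ℝ := !![a, b, 0; c, d, 0; 0, 0, 0]
  refine ⟨{ f with map_lie' := fun {p q} => Prod.ext (Prod.ext ?_ rfl) ?_ }⟩
  · ext i
    change ![(p.2 • B.mulVec q.1 - q.2 • B.mulVec p.1 : Fin 3 → ℝ) 0,
      (p.2 • B.mulVec q.1 - q.2 • B.mulVec p.1 : Fin 3 → ℝ) 1] i =
      (p.2 • Matrix.mulVec !![a, b; c, d] ![q.1 0, q.1 1] -
        q.2 • Matrix.mulVec !![a, b; c, d] ![p.1 0, p.1 1]) i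
    fin_cases i <;> simp [B, dotProduct, Fin.sum_univ_three] <;> ring
  · funext i
    change (p.2 • B.mulVec q.1 - q.2 • B.mulVec p.1 : Fin 3 → ℝ) 2 = 0
    simp [B, dotProduct, Fin.sum_univ_three]

lemma lieIso_zero : LieIso (AlmostAbelian (0 : Matrix (Fin 3) (Fin 3) ℝ)) R4 := by
  let f : AlmostAbelian (0 : Matrix (Fin 3) (Fin 3) ℝ) ≃ₗ[ℝ] R4 :=
    { toFun := fun p => (![p.1 0, p.1 1, p.1 2, p.2] : Fin 4 → ℝ)
      invFun := fun p => mk _ ![(p : Fin 4 → ℝ) 0, (p : Fin 4 → ℝ) 1, (p : Fin 4 → ℝ) 2]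
        ((p : Fin 4 → ℝ) 3)
      map_add' := fun p q => by
        funext i; fin_cases i <;> rfl
      map_smul' := fun r p => by
        funext i; fin_cases i <;> rfl
      left_inv := fun p => by
        refine Prod.ext ?_ rfl
        ext i; fin_cases i <;> rfl
      right_inv := fun p => by
        funext i; fin_cases i <;> rfl }
  refine ⟨{ f with map_lie' := fun {p q} => ?_ }⟩
  have h : ⁅p, q⁆ = 0 := by
    rw [lie_def, Matrix.zero_mulVec, Matrix.zero_mulVec, smul_zero, smul_zero, sub_zero]
    rfl
  change f ⁅p, q⁆ = 0
  rw [h, map_zero]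

end AlmostAbelian

variable [FiniteDimensional ℝ 𝔤] {n : LieIdeal ℝ 𝔤} {X : 𝔤} (hdim : finrank ℝ 𝔤 = 4)
  (hab : IsLieAbelian n) (hX : X ∉ n)

include hdim hab hX in
lemma lieIso_almostAbelian {e : Basis (Fin 3) ℝ n} {F : Matrix (Fin 3) (Fin 3) ℝ}
    (hF : HasMatrix n X e F) : LieIso 𝔤 (AlmostAbelian F) := by
  have hn : finrank ℝ n = 3 := (finrank_eq_card_basis e).trans (by simp)
  let f : AlmostAbelian F →ₗ[ℝ] 𝔤 :=
    { toFun := fun p => (e.equivFun.symm p.1 : 𝔤) + p.2 • X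
      map_add' := fun p q => by
        have h1 : (p + q).1 = p.1 + q.1 := rfl
        have h2 : (p + q).2 = p.2 + q.2 := rfl
        rw [h1, h2, map_add, LieSubmodule.coe_add]
        module
      map_smul' := fun c p => by
        have h1 : (c • p).1 = c • p.1 := rfl
        have h2 : (c • p).2 = c * p.2 := rfl
        rw [h1, h2, map_smul, LieSubmodule.coe_smul, RingHom.id_apply]
        module }
  have hf : ∀ p, f p = (e.equivFun.symm p.1 : 𝔤) + p.2 • X := fun p => rfl
  have hlie : ∀ p q, f ⁅p, q⁆ = ⁅f p, f q⁆ := fun p q => by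
    have hX' : ∀ x : Fin 3 → ℝ, ⁅X, (e.equivFun.symm x : 𝔤)⁆ =
        (e.equivFun.symm (F.mulVec x) : 𝔤) := fun x => by
      have h : adOn n X (e.equivFun.symm x) = e.equivFun.symm (F.mulVec x) := by
        apply e.equivFun.injective
        rw [LinearEquiv.apply_symm_apply, ← hF]
        have := LinearMap.toMatrix_mulVec_repr e e (adOn n X) (e.equivFun.symm x)
        rw [← Basis.equivFun_apply, LinearEquiv.apply_symm_apply] at this
        exact this.symm
      exact congrArg Subtype.val h
    have hX'' : ∀ x : Fin 3 → ℝ, ⁅(e.equivFun.symm x : 𝔤), X⁆ =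
        -(e.equivFun.symm (F.mulVec x) : 𝔤) := fun x => by rw [← hX', lie_skew]
    have h0 : ∀ u v : n, ⁅(u : 𝔤), (v : 𝔤)⁆ = 0 := fun u v =>
      congrArg Subtype.val (hab.trivial u v)
    have h1 : (⁅p, q⁆ : AlmostAbelian F).1 = p.2 • F.mulVec q.1 - q.2 • F.mulVec p.1 := rfl
    have h2 : (⁅p, q⁆ : AlmostAbelian F).2 = 0 := rfl
    rw [hf, hf, hf, h1, h2, map_sub, map_smul, map_smul, LieSubmodule.coe_sub,
      LieSubmodule.coe_smul, LieSubmodule.coe_smul]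
    simp only [add_lie, lie_add, smul_lie, lie_smul, h0, hX', hX'', lie_self]
    module
  have hbij : Function.Bijective f := by
    refine ⟨(injective_iff_map_eq_zero f).mpr fun p hp => ?_, fun v => ?_⟩
    · rw [hf] at hp
      have h2 : p.2 = 0 := by
        by_contra h
        apply hX
        have h3 : X = -(p.2⁻¹) • (e.equivFun.symm p.1 : 𝔤) := by
          rw [eq_neg_of_add_eq_zero_left hp, smul_neg, neg_smul, neg_neg, smul_smul,
            inv_mul_cancel₀ h, one_smul]
        rw [h3]
        exact n.toSubmodule.smul_mem _ (e.equivFun.symm p.1).2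
      rw [h2, zero_smul, add_zero] at hp
      have h1 : p.1 = 0 := by
        rw [← LinearEquiv.map_eq_zero_iff e.equivFun.symm]
        exact Subtype.val_injective hp
      exact Prod.ext h1 h2
    · obtain ⟨y, c, rfl⟩ := exists_add_smul hdim hn hX v
      refine ⟨AlmostAbelian.mk F (e.equivFun y) c, ?_⟩
      rw [hf]
      simp [AlmostAbelian.mk]
  refine LieIso.symm ⟨{ LinearEquiv.ofBijective f hbij with map_lie' := fun {p q} => hlie p q }⟩

include hdim hab hX in
lemma lieIso_of_conj {e : Basis (Fin 3) ℝ n} {F A Q : Matrix (Fin 3) (Fin 3) ℝ} {s : ℝ}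
    (hF : HasMatrix n X e F) (hQ : Q.det ≠ 0) (hs : s ≠ 0) (h : F * Q = s • (Q * A)) :
    LieIso 𝔤 (AlmostAbelian A) :=
  (lieIso_almostAbelian hdim hab hX hF).trans (AlmostAbelian.lieIso_of_conj hQ hs h)

end Isomorphisms

lemma matVII_zero : matVII 0 0 0 = 0 := by
  ext i j
  fin_cases i <;> fin_cases j <;> simp [matVII]

lemma matL1_zero : matL1 0 0 0 = 0 := by
  ext i j
  fin_cases i <;> fin_cases j <;> simp [matL1]

/-! ### Identification of the Lie algebra in each case -/

section CaseIsomorphisms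

variable {𝔤 : Type*} [LieRing 𝔤] [LieAlgebra ℝ 𝔤] [FiniteDimensional ℝ 𝔤] {n : LieIdeal ℝ 𝔤}
  {X : 𝔤} {e : Basis (Fin 3) ℝ n} (hdim : finrank ℝ 𝔤 = 4) (hab : IsLieAbelian n) (hX : X ∉ n)

include hdim hab hX

lemma lieIso_matVII {a b₁ b₂ : ℝ} (ha : a ≠ 0) (hF : HasMatrix n X e (matVII a b₁ b₂)) :
    LieIso 𝔤 (Euc2 × R1) := by
  -- Shearing along `e₂` absorbs `b₁` and `b₂`, since the rotation block is invertible when `a ≠ 0`.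
  refine (lieIso_of_conj hdim hab hX hF (Q := !![1, 0, 0; 0, 1, 0; -b₂ / a, b₁ / a, 1]) (s := -a)
    ?_ (neg_ne_zero.mpr ha) ?_).trans (AlmostAbelian.lieIso_prod 0 1 (-1) 0)
  · simp [Matrix.det_fin_three]
  · ext i j
    fin_cases i <;> fin_cases j <;> simp [matVII, Matrix.mul_apply, Fin.sum_univ_three] <;>
      field_simp

lemma lieIso_matVII_zero {b₁ b₂ : ℝ} (hb : (b₁, b₂) ≠ (0, 0))
    (hF : HasMatrix n X e (matVII 0 b₁ b₂)) : LieIso 𝔤 (Heis3 × R1) := by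
  have h0 : b₁ ^ 2 + b₂ ^ 2 ≠ 0 := fun h => hb <| by
    have h1 : b₁ = 0 := eq_zero_of_sq_add_eq_zero (sq_nonneg b₂) h
    have h2 : b₂ = 0 := eq_zero_of_sq_add_eq_zero (sq_nonneg b₁) (by linear_combination h)
    rw [h1, h2]
  -- The first two columns are the image of `(b₁, b₂, 0)` and that vector itself; the third lies in
  -- the kernel.
  refine (lieIso_of_conj hdim hab hX hF (Q := !![0, b₁, -b₂; 0, b₂, b₁; b₁ ^ 2 + b₂ ^ 2, 0, 0])
    (s := 1) ?_ one_ne_zero ?_).trans (AlmostAbelian.lieIso_prod 0 1 0 0)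
  · rw [Matrix.det_fin_three]
    convert pow_ne_zero 2 h0 using 1
    simp
    ring
  · ext i j
    fin_cases i <;> fin_cases j <;> simp [matVII, Matrix.mul_apply, Fin.sum_univ_three] <;> ring

lemma lieIso_zero (hF : HasMatrix n X e 0) : LieIso 𝔤 R4 :=
  (lieIso_almostAbelian hdim hab hX hF).trans AlmostAbelian.lieIso_zero

/-- The eigenvalues are `0` and `±i s` with `s = 2√σ`. Dividing by `s` gives the standard rotation,
and the last column of `Q` spans the kernel. -/
lemma lieIso_matM3_pos {σ : ℝ} (hσ : 0 < σ) (hF : HasMatrix n X e (matM3 σ)) :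
    LieIso 𝔤 (Euc2 × R1) := by
  obtain ⟨s, hs⟩ : ∃ s : ℝ, s ^ 2 = 4 * σ := ⟨√(4 * σ), Real.sq_sqrt (by positivity)⟩
  have hs0 : s ≠ 0 := by rintro rfl; linarith
  refine (lieIso_of_conj hdim hab hX hF (Q := !![0, 1 - σ, 1 + σ; 0, 1 + σ, 1 - σ; s, 0, 0])
    (s := s) ?_ hs0 ?_).trans (AlmostAbelian.lieIso_prod 0 1 (-1) 0)
  · rw [Matrix.det_fin_three]
    convert neg_ne_zero.mpr (mul_ne_zero (mul_ne_zero four_ne_zero hσ.ne') hs0) using 1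
    simp
    ring
  · ext i j
    fin_cases i <;> fin_cases j <;> simp [matM3, Matrix.mul_apply, Fin.sum_univ_three] <;>
      first | ring1 | linear_combination -hs

lemma lieIso_matM3_neg {σ : ℝ} (hσ : σ < 0) (hF : HasMatrix n X e (matM3 σ)) :
    LieIso 𝔤 (Euc11 × R1) := by
  obtain ⟨s, hs⟩ : ∃ s : ℝ, s ^ 2 = -4 * σ := ⟨√(-4 * σ), Real.sq_sqrt (by linarith)⟩
  have hs0 : s ≠ 0 := by rintro rfl; linarith
  refine (lieIso_of_conj hdim hab hX hF (Q := !![0, -1 + σ, 1 + σ; 0, -1 - σ, 1 - σ; s, 0, 0])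
    (s := s) ?_ hs0 ?_).trans (AlmostAbelian.lieIso_prod 0 1 1 0)
  · rw [Matrix.det_fin_three]
    convert mul_ne_zero (mul_ne_zero four_ne_zero hσ.ne) hs0 using 1
    simp
    ring
  · ext i j
    fin_cases i <;> fin_cases j <;> simp [matM3, Matrix.mul_apply, Fin.sum_univ_three] <;>
      first | ring1 | linear_combination -hs

lemma lieIso_matM3_zero (hF : HasMatrix n X e (matM3 0)) : LieIso 𝔤 A41 := by
  -- The columns form the Jordan chain `f²w, f w, w` with `w` the first basis vector.
  refine lieIso_of_conj hdim hab hX hF (Q := !![1, 0, 1; 1, 0, 0; 0, -1, 0]) (s := 1) ?_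
    one_ne_zero ?_
  · simp [Matrix.det_fin_three]
  · ext i j
    fin_cases i <;> fin_cases j <;> simp [matM3, Matrix.mul_apply, Fin.sum_univ_three]

lemma lieIso_matL1 {α a : ℝ} (ha : a ≠ 0)
    (hF : HasMatrix n X e (matL1 α (√(α ^ 2 + a ^ 2 / 2)) a)) :
    ∃ φ : ℝ, 0 < Real.cos φ ∧ LieIso 𝔤 (A46 (√2 * Real.cos φ) (Real.sin φ)) := by
  have ha2 : 0 < a ^ 2 := by positivity
  have hβ : √(α ^ 2 + a ^ 2 / 2) ^ 2 = α ^ 2 + a ^ 2 / 2 := Real.sq_sqrt (by positivity)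
  have hβ0 : 0 < √(α ^ 2 + a ^ 2 / 2) := Real.sqrt_pos.mpr (by positivity)
  generalize √(α ^ 2 + a ^ 2 / 2) = β at hβ hβ0 hF
  obtain ⟨δ, hδ, hδa⟩ : ∃ δ : ℝ, δ * δ = 1 ∧ 0 < δ * a := by
    rcases lt_or_gt_of_ne ha with h | h
    · exact ⟨-1, by norm_num, by linarith⟩
    · exact ⟨1, by norm_num, by linarith⟩
  have hδ0 : δ ≠ 0 := by rintro rfl; simp at hδ
  -- Dividing by `δβ`, with `δ` the sign of `a`, leaves the parameters `δa/β` and `δα/β`. The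
  -- relation `β² = α² + a²/2` places them on the ellipse `(√2 cos φ, sin φ)`.
  obtain ⟨y, hy⟩ : ∃ y, y = δ * α / β := ⟨_, rfl⟩
  have hyβ : y * β = δ * α := by rw [hy]; field_simp
  have hy2 : 1 - y ^ 2 = a ^ 2 / (2 * β ^ 2) := by
    rw [hy]
    field_simp
    linear_combination 2 * hβ - 2 * α ^ 2 * hδ
  have hy1 : 0 < 1 - y ^ 2 := by rw [hy2]; positivity
  have hsin : Real.sin (Real.arcsin y) = y := Real.sin_arcsin (by nlinarith) (by nlinarith)
  have hcos : √2 * Real.cos (Real.arcsin y) = δ * a / β := by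
    rw [Real.cos_arcsin, ← Real.sqrt_mul (by norm_num), hy2,
      Real.sqrt_eq_iff_mul_self_eq (by positivity) (by positivity)]
    field_simp
    linear_combination -hδ
  refine ⟨Real.arcsin y, by rw [Real.cos_arcsin]; exact Real.sqrt_pos.mpr hy1, ?_⟩
  rw [hsin, hcos]
  refine lieIso_of_conj hdim hab hX hF (Q := !![0, 1, 0; 0, 0, -δ; 1, 0, 0]) (s := δ * β) ?_
    (mul_ne_zero hδ0 hβ0.ne') ?_
  · simpa [Matrix.det_fin_three] using hδ0
  · ext i j
    fin_cases i <;> fin_cases j <;> simp [matL1, Matrix.mul_apply, Fin.sum_univ_three] <;>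
      first | ring1 | (field_simp; linear_combination -hδ) | (field_simp; linear_combination hδ) |
        linear_combination -δ * hyβ - α * hδ | linear_combination β * hδ | linear_combination -β * hδ |
        linear_combination -hyβ * δ ^ 2 - δ * α * hδ

lemma lieIso_matL1_zero {α : ℝ} (hα : α ≠ 0) (hF : HasMatrix n X e (matL1 α (√(α ^ 2)) 0)) :
    LieIso 𝔤 (R3' 1 × R1) := by
  -- Here `β = |α|`; a reflection absorbs the sign `η` of `α`.
  obtain ⟨η, hη, hηα⟩ : ∃ η : ℝ, η * η = 1 ∧ √(α ^ 2) = η * α := by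
    rw [Real.sqrt_sq_eq_abs]
    rcases lt_or_gt_of_ne hα with h | h
    · exact ⟨-1, by norm_num, by rw [abs_of_neg h]; ring⟩
    · exact ⟨1, by norm_num, by rw [abs_of_pos h]; ring⟩
  have hη0 : η ≠ 0 := by rintro rfl; simp at hη
  rw [hηα] at hF
  refine (lieIso_of_conj hdim hab hX hF (Q := !![1, 0, 0; 0, -η, 0; 0, 0, 1]) (s := α) ?_
    hα ?_).trans (AlmostAbelian.lieIso_prod 1 1 (-1) 1)
  · simpa [Matrix.det_fin_three] using hη0
  · ext i j
    fin_cases i <;> fin_cases j <;> simp [matL1, Matrix.mul_apply, Fin.sum_univ_three] <;>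
      first | ring1 | linear_combination α * hη

lemma lieIso_matIV {ε v : ℝ} (hv : v ≠ 0) (hF : HasMatrix n X e (matIV ε v)) :
    LieIso 𝔤 A41 := by
  -- A Jordan chain of length three, generated by the first basis vector.
  refine lieIso_of_conj hdim hab hX hF
    (Q := !![v ^ 2, ε / 2, 1; -v ^ 2, -(ε / 2), 0; 0, v, 0]) (s := 1) ?_ one_ne_zero ?_
  · rw [Matrix.det_fin_three]
    simpa using hv
  · ext i j
    fin_cases i <;> fin_cases j <;> simp [matIV, Matrix.mul_apply, Fin.sum_univ_three] <;> ring

lemma lieIso_matIV_zero {ε : ℝ} (hε : ε ≠ 0) (hF : HasMatrix n X e (matIV ε 0)) :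
    LieIso 𝔤 (Heis3 × R1) := by
  refine (lieIso_of_conj hdim hab hX hF
    (Q := !![ε / 2, 1, 0; -(ε / 2), 0, 0; 0, 0, 1]) (s := 1) ?_ one_ne_zero ?_).trans
      (AlmostAbelian.lieIso_prod 0 1 0 0)
  · simpa [Matrix.det_fin_three] using hε
  · ext i j
    fin_cases i <;> fin_cases j <;> simp [matIV, Matrix.mul_apply, Fin.sum_univ_three]

lemma lieIso_matVI {a : ℝ} (ha : a ≠ √2 ∧ a ≠ -√2) (hF : HasMatrix n X e (matVI a)) :
    LieIso 𝔤 A41 := by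
  have hk : 1 / √2 ≠ 0 := by positivity
  -- The entry whose vanishing at `a = ±√2` lowers the nilpotency index from three to two.
  have h1 : 1 - a ^ 2 / 2 ≠ 0 := fun h => by
    have h2 : a ^ 2 = √2 ^ 2 := by rw [Real.sq_sqrt (by norm_num)]; linear_combination -2 * h
    exact (sq_eq_sq_iff_eq_or_eq_neg.mp h2).elim ha.1 ha.2
  have h2 : 1 + a ^ 2 / 2 ≠ 0 := by positivity
  rw [matVI_eq] at hF
  generalize 1 / √2 = k at *
  obtain ⟨p, hp⟩ : ∃ p, p = k * (1 + a ^ 2 / 2) := ⟨_, rfl⟩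
  obtain ⟨m, hm⟩ : ∃ m, m = k * (1 - a ^ 2 / 2) := ⟨_, rfl⟩
  have hp0 : p ≠ 0 := hp ▸ mul_ne_zero hk h2
  have hm0 : m ≠ 0 := hm ▸ mul_ne_zero hk h1
  rw [show k * (-1 - a ^ 2 / 2) = -p by rw [hp]; ring, ← hp, ← hm] at hF
  refine lieIso_of_conj hdim hab hX hF
    (Q := !![-(m * p), 0, 1; 0, m, 0; m * p, 0, 0]) (s := 1) ?_ one_ne_zero ?_
  · simpa [Matrix.det_fin_three] using ⟨hm0, hp0⟩
  · ext i j
    fin_cases i <;> fin_cases j <;> simp [Matrix.mul_apply, Fin.sum_univ_three] <;> ring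

lemma lieIso_matVI_sqrt_two {a : ℝ} (ha : a = √2 ∨ a = -√2) (hF : HasMatrix n X e (matVI a)) :
    LieIso 𝔤 (Heis3 × R1) := by
  have ha2 : a ^ 2 = 2 := by
    rcases ha with rfl | rfl <;> simp
  have hk : 1 / √2 ≠ 0 := by positivity
  rw [matVI_eq, ha2] at hF
  generalize 1 / √2 = k at *
  refine (lieIso_of_conj hdim hab hX hF
    (Q := !![-2 * k, 0, 1; 0, 1, 0; 2 * k, 0, 0]) (s := 1) ?_ one_ne_zero ?_).trans
      (AlmostAbelian.lieIso_prod 0 1 0 0)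
  · simpa [Matrix.det_fin_three] using hk
  · ext i j
    fin_cases i <;> fin_cases j <;> simp [Matrix.mul_apply, Fin.sum_univ_three] <;> ring

end CaseIsomorphisms

/-! ### The symmetric part and the case of nonzero three-form -/

section SymmetricPart

variable {V : Type*} [AddCommGroup V] [Module ℝ V] {B : LinearMap.BilinForm ℝ V}

lemma IsLorentzBasis.apply_right {m : ℕ} {b : Basis (Fin (m + 1)) ℝ V} (hb : IsLorentzBasis B b)
    (x : V) (i : Fin (m + 1)) : B x (b i) = (if i = 0 then -1 else 1) * b.repr x i := by
  conv_lhs => rw [← b.sum_repr x]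
  simp only [map_sum, LinearMap.sum_apply, map_smul, LinearMap.smul_apply, hb _ _]
  simp [mul_comm]

lemma toMatrix_symmPart [FiniteDimensional ℝ V] (hs : ∀ x y, B x y = B y x) (hB : B.Nondegenerate)
    {m : ℕ} {b : Basis (Fin (m + 1)) ℝ V} (hb : IsLorentzBasis B b) (f : End ℝ V)
    (i j : Fin (m + 1)) :
    LinearMap.toMatrix b b (symmPart B hB f) i j = (1 / 2 : ℝ) * (LinearMap.toMatrix b b f i j +
      (if i = 0 then -1 else 1) * (if j = 0 then -1 else 1) * LinearMap.toMatrix b b f j i) := by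
  have hadj : B (B.leftAdjointOfNondegenerate hB f (b j)) (b i) = B (b j) (f (b i)) :=
    LinearMap.BilinForm.isAdjointPairLeftAdjointOfNondegenerate B hB f (b j) (b i)
  rw [hs (b j), hb.apply_right, hb.apply_right] at hadj
  have hsymm : symmPart B hB f (b j) =
      (1 / 2 : ℝ) • (f (b j) + B.leftAdjointOfNondegenerate hB f (b j)) := rfl
  rw [LinearMap.toMatrix_apply, LinearMap.toMatrix_apply, LinearMap.toMatrix_apply, hsymm, map_smul,
    map_add, Finsupp.smul_apply, Finsupp.add_apply, smul_eq_mul]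
  split_ifs at hadj ⊢ <;>
    first | linear_combination (1 / 2) * hadj | linear_combination -(1 / 2) * hadj

lemma charpoly_matL3 : matL3.charpoly = Polynomial.X ^ 3 := by
  rw [Matrix.charpoly, Matrix.det_fin_three]
  simp [matL3]
  ring

end SymmetricPart

/-! ### Assembly of the classification -/

section Main

variable {𝔤 : Type*} [LieRing 𝔤] [LieAlgebra ℝ 𝔤] [FiniteDimensional ℝ 𝔤] {M : GenMetric 𝔤}
  {n : LieIdeal ℝ 𝔤} {X : 𝔤}

/-- The terms in `a²` are skew, so the symmetric part has matrix `L₃(0)` for every `a`. -/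
lemma CaseVI.charpoly_symmPart {a : ℝ} (h : CaseVI M n X a) (hnd : (M.gOn n).Nondegenerate) :
    (symmPart (M.gOn n) hnd (adOn n X)).charpoly = Polynomial.X ^ 3 := by
  obtain ⟨hl, e, E, he, hE, hE3, hH, hF⟩ := h
  rw [← charpoly_matL3, ← LinearMap.charpoly_toMatrix _ e]
  congr 1
  ext i j
  rw [toMatrix_symmPart (B := M.gOn n) (fun x y => M.symm x y) hnd he, hF, matVI_eq]
  fin_cases i <;> fin_cases j <;> simp [matL3] <;> ring

lemma CaseVI.exists_normalFormH (hM : IsLorentzianForm M.g) (hX : IsComplementary M n X) {a : ℝ}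
    (h : CaseVI M n X a) : ∃ E : Basis (Fin 4) ℝ 𝔤, NormalFormH M n a E := by
  obtain ⟨hl, e, E, he, hE, hE3, hH, hF⟩ := h
  obtain ⟨hXn, hc⟩ := normal_of_lorentzian hM hX hl
  rw [metric_eq_coord hE hE3 hXn hc] at hH
  refine ⟨E, fun i j => ?_, hH, e, hE, by rwa [hE3]⟩
  rw [gram_extend hE hE3 (isLorentzBasis_iff.mp he) (k := 0) (fun j => hXn _ (e j).2) hc]
  fin_cases i <;> fin_cases j <;> simp [gramLorentz]

omit [FiniteDimensional ℝ 𝔤] in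
lemma NormalFormH.caseVI {b : ℝ} {E : Basis (Fin 4) ℝ 𝔤} (h : NormalFormH M n b E) :
    IsComplementary M n (E 3) ∧ CaseVI M n (E 3) b := by
  obtain ⟨hE, hH, e, he, hF⟩ := h
  have hc : M.g (E 3) (E 3) = 1 := by simp [hE 3 3]
  have hXn : ∀ Y ∈ n, M.g (E 3) Y = 0 := fun Y hY => by
    have h0 : M.g (E 3) ∘ₗ n.toSubmodule.subtype = 0 := e.ext fun i => by
      change M.g (E 3) (e i) = 0
      rw [← he, hE, if_neg (show (3 : Fin 4) ≠ i.castSucc from (Fin.castSucc_lt_last i).ne')]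
    exact LinearMap.congr_fun h0 ⟨Y, hY⟩
  have hl : IsLorentzBasis (M.gOn n) e := fun i j => by
    change M.g (e i) (e j) = _
    rw [← he, ← he, hE]
    simp
  refine ⟨⟨fun h => ?_, fun _ => ⟨hXn, Or.inl hc⟩⟩, ⟨2, e, hl⟩, e, E, hl, he, rfl, ?_, hF⟩
  · exact one_ne_zero (hc.symm.trans (hXn _ h))
  · rw [metric_eq_coord he rfl hXn hc, hH]

variable (hdim : finrank ℝ 𝔤 = 4) (hM : IsLorentzianForm M.g) (hn : finrank ℝ n = 3)
  (hab : IsLieAbelian n) (hX : IsComplementary M n X)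

include hdim hM hn hab hX in
lemma isGenEinstein_iff :
    M.IsGenEinstein 0 ↔
      (∃ a, CaseI M n X a) ∨
      (∃ σ, CaseII M n X σ) ∨
      (∃ α a, CaseIII M n X α a) ∨
      (∃ ε v, (ε = 1 ∨ ε = -1) ∧ CaseIV M n X ε v) ∨
      CaseV M n X ∨
      (∃ a, a ≠ 0 ∧ CaseVI M n X a) ∨
      (∃ a b₁ b₂, CaseVII M n X a b₁ b₂) := by
  constructor
  · intro hGE
    by_cases hnd : (M.gOn n).Nondegenerate
    · obtain ⟨hXn, hc | hc⟩ := hX.2 hnd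
      · by_cases hH : M.H = 0
        · have hl := exists_lorentzBasis_of_normal hdim hM hn hX.1 hXn hc
          have hl' : IsLorentzianForm (M.gOn n) := ⟨2, hl⟩
          rcases isLorentzNormal_of_nullEinstein hl
            (fun e he => nullEinstein_of_isGenEinstein hdim hab hX.1 hXn hc hH hGE he) with
            ⟨σ, h⟩ | ⟨α, a, h⟩ | ⟨ε, v, hε, h⟩ | h
          · exact Or.inr (Or.inl ⟨σ, hl', hH, h⟩)
          · exact Or.inr (Or.inr (Or.inl ⟨α, a, hl', hH, h⟩))
          · exact Or.inr (Or.inr (Or.inr (Or.inl ⟨ε, v, hε, hl', hH, h⟩)))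
          · exact Or.inr (Or.inr (Or.inr (Or.inr (Or.inl ⟨hl', hH, h⟩))))
        · exact Or.inr (Or.inr (Or.inr (Or.inr (Or.inr (Or.inl
            (exists_caseVI hdim hM hn hab hX.1 hXn hc hH hGE))))))
      · exact Or.inl (exists_caseI hdim hM hn hab hX.1 hXn hc hGE)
    · exact Or.inr (Or.inr (Or.inr (Or.inr (Or.inr (Or.inr
        (exists_caseVII hdim hM hn hab hX.1 hnd hGE))))))
  · rintro (⟨a, h⟩ | ⟨σ, h⟩ | ⟨α, a, h⟩ | ⟨ε, v, -, h⟩ | h | ⟨a, -, h⟩ | ⟨a, b₁, b₂, h⟩)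
    · exact h.isGenEinstein hdim hM hn hab hX
    · exact h.isGenEinstein hdim hM hab hX
    · exact h.isGenEinstein hdim hM hab hX
    · exact h.isGenEinstein hdim hM hab hX
    · exact h.isGenEinstein hdim hM hab hX
    · exact h.isGenEinstein hM hab hX
    · exact h.isGenEinstein hdim hab hX

include hdim hM hn hab hX in
lemma isGenEinstein_iff_caseVI (hnd : (M.gOn n).Nondegenerate) (hH : M.H ≠ 0) :
    M.IsGenEinstein 0 ↔ ∃ a, a ≠ 0 ∧ CaseVI M n X a := by
  rw [isGenEinstein_iff hdim hM hn hab hX]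
  constructor
  · rintro (⟨a, h⟩ | ⟨σ, h⟩ | ⟨α, a, h⟩ | ⟨ε, v, -, h⟩ | h | h | ⟨a, b₁, b₂, h⟩)
    exacts [absurd h.2.1 hH, absurd h.2.1 hH, absurd h.2.1 hH, absurd h.2.1 hH, absurd h.2.1 hH,
      h, absurd hnd h.1]
  · exact fun h => Or.inr (Or.inr (Or.inr (Or.inr (Or.inr (Or.inl h)))))

end Main

end GenLie

end

theorem mainTheorem9 {𝔤 : Type*} [LieRing 𝔤] [LieAlgebra ℝ 𝔤] [FiniteDimensional ℝ 𝔤]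
    (hdim : Module.finrank ℝ 𝔤 = 4)
    (M : GenMetric 𝔤) (hM : IsLorentzianForm M.g)
    (n : LieIdeal ℝ 𝔤) (hn : Module.finrank ℝ n = 3) (hab : IsLieAbelian n)
    (X : 𝔤) (hX : IsComplementary M n X) :
    -- the classification
    (M.IsGenEinstein 0 ↔
      (∃ a, CaseI M n X a) ∨
      (∃ σ, CaseII M n X σ) ∨
      (∃ α a, CaseIII M n X α a) ∨
      (∃ ε v, (ε = 1 ∨ ε = -1) ∧ CaseIV M n X ε v) ∨
      CaseV M n X ∨
      (∃ a, a ≠ 0 ∧ CaseVI M n X a) ∨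
      (∃ a b₁ b₂, CaseVII M n X a b₁ b₂)) ∧
    -- the underlying Lie algebras
    (∀ a, CaseI M n X a →
      (a ≠ 0 → LieIso 𝔤 (Euc2 × R1)) ∧ (a = 0 → LieIso 𝔤 R4)) ∧
    (∀ σ, CaseII M n X σ →
      (0 < σ → LieIso 𝔤 (Euc2 × R1)) ∧ (σ = 0 → LieIso 𝔤 A41) ∧
      (σ < 0 → LieIso 𝔤 (Euc11 × R1))) ∧
    (∀ α a, CaseIII M n X α a →
      (a ≠ 0 → ∃ φ : ℝ, 0 < Real.cos φ ∧ LieIso 𝔤 (A46 (√2 * Real.cos φ) (Real.sin φ))) ∧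
      (a = 0 → α ≠ 0 → LieIso 𝔤 (R3' 1 × R1)) ∧
      (a = 0 → α = 0 → LieIso 𝔤 R4)) ∧
    (∀ ε v, (ε = 1 ∨ ε = -1) → CaseIV M n X ε v →
      (v ≠ 0 → LieIso 𝔤 A41) ∧ (v = 0 → LieIso 𝔤 (Heis3 × R1))) ∧
    (CaseV M n X → LieIso 𝔤 A41) ∧
    (∀ a, a ≠ 0 → CaseVI M n X a →
      (a ≠ √2 ∧ a ≠ -√2 → LieIso 𝔤 A41) ∧
      (a = √2 ∨ a = -√2 → LieIso 𝔤 (Heis3 × R1))) ∧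
    (∀ a b₁ b₂, CaseVII M n X a b₁ b₂ →
      (a ≠ 0 → LieIso 𝔤 (Euc2 × R1)) ∧
      (a = 0 → (b₁, b₂) ≠ (0, 0) → LieIso 𝔤 (Heis3 × R1)) ∧
      (a = 0 → b₁ = 0 → b₂ = 0 → LieIso 𝔤 R4)) ∧
    -- nondegenerate `n` and nonzero `H`
    (∀ hnd : (M.gOn n).Nondegenerate, M.H ≠ 0 →
      (M.IsGenEinstein 0 ↔
        ∃ b, b ≠ 0 ∧ ∃ E : Module.Basis (Fin 4) ℝ 𝔤, NormalFormH M n b E) ∧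
      (∀ b, b ≠ 0 → (∃ E : Module.Basis (Fin 4) ℝ 𝔤, NormalFormH M n b E) →
        (b ≠ √2 ∧ b ≠ -√2 → LieIso 𝔤 A41) ∧
        (b = √2 ∨ b = -√2 → LieIso 𝔤 (Heis3 × R1))) ∧
      (M.IsGenEinstein 0 → ∀ z : ℂ,
        Polynomial.aeval z (symmPart (M.gOn n) hnd (adOn n X)).charpoly = 0 → z.im = 0)) := by
  refine ⟨isGenEinstein_iff hdim hM hn hab hX, ?_, ?_, ?_, ?_, ?_, ?_, ?_, ?_⟩
  · rintro a ⟨-, -, e, -, hF⟩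
    -- `matL1 0 a 0` and `matVII a 0 0` unfold to the same matrix.
    refine ⟨fun ha => lieIso_matVII (b₁ := 0) (b₂ := 0) hdim hab hX.1 ha hF, ?_⟩
    rintro rfl
    exact lieIso_zero hdim hab hX.1 (by rwa [matL1_zero] at hF)
  · rintro σ ⟨-, -, e, -, hF⟩
    refine ⟨fun h => lieIso_matM3_pos hdim hab hX.1 h hF, ?_,
      fun h => lieIso_matM3_neg hdim hab hX.1 h hF⟩
    rintro rfl
    exact lieIso_matM3_zero hdim hab hX.1 hF
  · rintro α a ⟨-, -, e, -, hF⟩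
    refine ⟨fun ha => lieIso_matL1 hdim hab hX.1 ha hF, ?_, ?_⟩
    · rintro rfl hα
      exact lieIso_matL1_zero hdim hab hX.1 hα (by simpa using hF)
    · rintro rfl rfl
      exact lieIso_zero hdim hab hX.1 (by simpa [matL1_zero] using hF)
  · rintro ε v hε ⟨-, -, e, -, hF⟩
    refine ⟨fun hv => lieIso_matIV hdim hab hX.1 hv hF, ?_⟩
    rintro rfl
    exact lieIso_matIV_zero hdim hab hX.1 (by rcases hε with rfl | rfl <;> norm_num) hF
  · rintro ⟨-, -, e, -, hF⟩
    -- `L₃(0)` is the member `a = 0` of the family (vi), and `0 ≠ ±√2`.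
    rw [← matVI_zero] at hF
    have h2 : (√2 : ℝ) ≠ 0 := by positivity
    exact lieIso_matVI hdim hab hX.1 ⟨h2.symm, (neg_ne_zero.mpr h2).symm⟩ hF
  · rintro a - ⟨-, e, E, -, -, -, -, hF⟩
    exact ⟨fun ha => lieIso_matVI hdim hab hX.1 ha hF,
      fun ha => lieIso_matVI_sqrt_two hdim hab hX.1 ha hF⟩
  · rintro a b₁ b₂ ⟨-, -, e, -, -, -, -, -, -, -, hF⟩
    refine ⟨fun ha => lieIso_matVII hdim hab hX.1 ha hF, ?_, ?_⟩
    · rintro rfl hb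
      exact lieIso_matVII_zero hdim hab hX.1 hb hF
    · rintro rfl rfl rfl
      exact lieIso_zero hdim hab hX.1 (by rwa [matVII_zero] at hF)
  · intro hnd hH
    have hiff := isGenEinstein_iff_caseVI hdim hM hn hab hX hnd hH
    refine ⟨⟨fun hGE => ?_, ?_⟩, ?_, fun hGE z hz => ?_⟩
    · obtain ⟨a, ha, h⟩ := hiff.mp hGE
      exact ⟨a, ha, h.exists_normalFormH hM hX⟩
    · rintro ⟨b, -, E, hE⟩
      -- The Einstein condition does not involve `X`, so the fourth vector of the given basis takes
      -- its place.
      exact hE.caseVI.2.isGenEinstein hM hab hE.caseVI.1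
    · rintro b - ⟨E, hE⟩
      have hX3 := hE.caseVI.1.1
      obtain ⟨-, -, e, -, hF⟩ := hE
      exact ⟨fun hb => lieIso_matVI hdim hab hX3 hb hF,
        fun hb => lieIso_matVI_sqrt_two hdim hab hX3 hb hF⟩
    · obtain ⟨a, -, h⟩ := hiff.mp hGE
      rw [h.charpoly_symmPart hnd, map_pow, Polynomial.aeval_X] at hz
      rw [pow_eq_zero_iff three_ne_zero |>.mp hz, Complex.zero_im]
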